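/- Let $D\subset\mathbb{R}^d$ be a domain (a nonempty connected open set). Let $$\mathrm{BL}(D)=\Big\{u\in L^2_{loc}(D):\ \tfrac{\partial u}{\partial x_i}\in L^2(D),\ 1\le i\le d\Big\},\qquad \mathbf{D}(u,v)=\sum_{i=1}^d\int_D\frac{\partial u}{\partial x_i}\frac{\partial v}{\partial x_i}\,dx,$$ with derivatives in the sense of distributions and functions identified when equal a.e., let $W^{1,2}(D)=\mathrm{BL}(D)\cap L^2(D)$, and let $\dot{\mathrm{BL}}(D)$ be the quotient of $\mathrm{BL}(D)$ by the constant functions. Let $W^{1,2}_e(D)$ be the extended Dirichlet space of $(\mathcal E,\mathcal F)=(\tfrac12\mathbf{D},W^{1,2}(D))$: the a.e. finite functions $u$ on $D$ for which there is a $\mathbf{D}$-Cauchy sequence $u_n\in W^{1,2}(D)$ (an approximating sequence) with $u_n\to u$ a.e.; put $\mathcal E(u,u)=\lim_n\tfrac12\mathbf{D}(u_n,u_n)$. Let $\mathbb{H}^*(D)$ be the space of all $u\in\mathrm{BL}(D)$ with $\mathbf{D}(u,v)=0$ for every $v\in W^{1,2}_e(D)$. Assume that the Dirichlet form $(\tfrac12\mathbf{D},W^{1,2}(D))$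 on $L^2(D)$ is transient: if $(T_t)_{t\ge0}$ is its $L^2$-semigroup and $S_tf=\int_0^tT_sf\,ds$ (extended from $L^1\cap L^2$ to $L^1(D)$), then there is an integrable $f$ on $D$ with $f>0$ a.e. and $\lim_{N\to\infty}S_Nf<\infty$ a.e. Then: 1. $(\dot{\mathrm{BL}}(D),\tfrac12\mathbf{D})$ is a Hilbert space. Moreover $W^{1,2}_e(D)\subset\mathrm{BL}(D)$, and $\tfrac12\mathbf{D}(u_n,u_n)\to\tfrac12\mathbf{D}(u,u)$ for every $u\in W^{1,2}_e(D)$ and every approximating sequence $(u_n)$ of $u$, so that $\mathcal E(u,u)=\tfrac12\mathbf{D}(u,u)$. The canonical map $\mathrm{BL}(D)\to\dot{\mathrm{BL}}(D)$, restricted to $W^{1,2}_e(D)$, is an injective linear isometry of $(W^{1,2}_e(D),\tfrac12\mathbf{D})$ onto a closed linear subspace of $(\dot{\mathrm{BL}}(D),\tfrac12\mathbf{D})$. 2. $\mathrm{BL}(D)$ is the linear span of $W^{1,2}_e(D)$ and $\mathbb{H}^*(D)$, and every function in $\mathbb{H}^*(D)$ is a.e. equal to a harmonic function on $D$. -/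

import Mathlib

open MeasureTheory Filter Topology
open scoped ENNReal ContDiff

noncomputable section

namespace BeppoLevi

/-! ### Symmetric forms on `L²`, their semigroups, and transience -/

section Forms

variable {α : Type*} [MeasurableSpace α] {μ : Measure α}

/-- `T` (used only at times `t ≥ 0`) is the strongly continuous symmetric contraction semigroup on
`L²(μ)` generated by the symmetric form `(ℰ, F)`: the form is recovered as
`F = {u : lim_{t → 0+} t⁻¹ (u - T_t u, u) < ∞}` and `ℰ(u, v) = lim_{t → 0+} t⁻¹ (u - T_t u, v)`. -/
structure IsSemigroupOfForm (T : ℝ → (Lp ℝ 2 μ →L[ℝ] Lp ℝ 2 μ))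
    (F : Set (Lp ℝ 2 μ)) (ℰ : Lp ℝ 2 μ → Lp ℝ 2 μ → ℝ) : Prop where
  zero : T 0 = ContinuousLinearMap.id ℝ (Lp ℝ 2 μ)
  add : ∀ s t : ℝ, 0 ≤ s → 0 ≤ t → T (s + t) = (T s).comp (T t)
  contraction : ∀ t : ℝ, 0 ≤ t → ∀ f, ‖T t f‖ ≤ ‖f‖
  symm : ∀ t : ℝ, 0 ≤ t → ∀ f g, inner ℝ (T t f) g = inner ℝ f (T t g)
  strongCont : ∀ f, Tendsto (fun t => T t f) (𝓝[>] (0 : ℝ)) (𝓝 f)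
  mem_iff : ∀ u, u ∈ F ↔
    ∃ c : ℝ, Tendsto (fun t : ℝ => t⁻¹ * inner ℝ (u - T t u) u) (𝓝[>] (0 : ℝ)) (𝓝 c)
  form_eq : ∀ u ∈ F, ∀ v ∈ F,
    Tendsto (fun t : ℝ => t⁻¹ * inner ℝ (u - T t u) v) (𝓝[>] (0 : ℝ)) (𝓝 (ℰ u v))

/-- `S_t f = ∫₀ᵗ T_s f ds`, a Bochner integral in `L²`. -/
def timeIntegral (T : ℝ → (Lp ℝ 2 μ →L[ℝ] Lp ℝ 2 μ)) (t : ℝ) (f : Lp ℝ 2 μ) : Lp ℝ 2 μ :=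
  ∫ s in (0 : ℝ)..t, T s f

theorem memLp_truncate {f : α → ℝ} (hf : Integrable f μ) (h0 : ∀ᵐ x ∂μ, 0 ≤ f x) (n : ℕ) :
    MemLp (fun x => min (f x) (n : ℝ)) 2 μ := by
  have hm : AEStronglyMeasurable (fun x => min (f x) (n : ℝ)) μ :=
    hf.aestronglyMeasurable.inf aestronglyMeasurable_const
  rw [memLp_two_iff_integrable_sq hm]
  refine (hf.const_mul (n : ℝ)).mono' (hm.pow 2) ?_
  filter_upwards [h0] with x hx
  have hn : (0 : ℝ) ≤ n := Nat.cast_nonneg n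
  have h1 : 0 ≤ min (f x) (n : ℝ) := le_min hx hn
  rw [Real.norm_of_nonneg (by positivity), sq]
  exact mul_le_mul (min_le_right _ _) (min_le_left _ _) h1 hn

/-- The truncation `f ∧ n`, an element of `L¹ ∩ L²`, of a nonnegative integrable function `f`. -/
def truncate (f : α → ℝ) (hf : Integrable f μ) (h0 : ∀ᵐ x ∂μ, 0 ≤ f x) (n : ℕ) : Lp ℝ 2 μ :=
  (memLp_truncate hf h0 n).toLp (fun x => min (f x) (n : ℝ))

/-- The Green function `G f = lim_{N → ∞} S_N f ≤ ∞` of `f ∈ L¹₊`. The extension of `S_N` from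
`L¹ ∩ L²` to `f ∈ L¹₊` is the increasing limit of `S_N (f ∧ n)` as `n → ∞`, and `S_N f` increases
with `N`, so both limits are suprema. -/
def green (T : ℝ → (Lp ℝ 2 μ →L[ℝ] Lp ℝ 2 μ)) (f : α → ℝ) (hf : Integrable f μ)
    (h0 : ∀ᵐ x ∂μ, 0 ≤ f x) (x : α) : ℝ≥0∞ :=
  ⨆ N : ℕ, ⨆ n : ℕ, ENNReal.ofReal (timeIntegral T (N : ℝ) (truncate f hf h0 n) x)

/-- The form `(ℰ, F)` on `L²(μ)` is transient: its semigroup satisfies `G f < ∞` a.e. for some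
`f ∈ L¹₊` with `f > 0` a.e. -/
def IsTransientForm (F : Set (Lp ℝ 2 μ)) (ℰ : Lp ℝ 2 μ → Lp ℝ 2 μ → ℝ) : Prop :=
  ∃ T : ℝ → (Lp ℝ 2 μ →L[ℝ] Lp ℝ 2 μ), IsSemigroupOfForm T F ℰ ∧
    ∃ (f : α → ℝ) (hf : Integrable f μ) (h0 : ∀ᵐ x ∂μ, 0 ≤ f x),
      (∀ᵐ x ∂μ, 0 < f x) ∧ ∀ᵐ x ∂μ, green T f hf h0 x < ⊤

end Forms

/-! ### Weak derivatives and Beppo Levi functions -/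

variable {d : ℕ}

/-- Lebesgue measure on the open set `D`. -/
abbrev leb (D : TopologicalSpace.Opens (EuclideanSpace ℝ (Fin d))) :
    Measure (EuclideanSpace ℝ (Fin d)) :=
  volume.restrict (D : Set (EuclideanSpace ℝ (Fin d)))

/-- Measurable real functions on `D`, modulo a.e. equality. -/
abbrev Fn (D : TopologicalSpace.Opens (EuclideanSpace ℝ (Fin d))) : Type :=
  EuclideanSpace ℝ (Fin d) →ₘ[leb D] ℝ

/-- Test functions: `C_c^∞(D)`. -/
structure IsTest (D : TopologicalSpace.Opens (EuclideanSpace ℝ (Fin d)))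
    (φ : EuclideanSpace ℝ (Fin d) → ℝ) : Prop where
  smooth : ContDiff ℝ ∞ φ
  compact : HasCompactSupport φ
  supp : tsupport φ ⊆ (D : Set (EuclideanSpace ℝ (Fin d)))

/-- The classical partial derivative `∂φ/∂x_i`. -/
def pd (i : Fin d) (φ : EuclideanSpace ℝ (Fin d) → ℝ) (x : EuclideanSpace ℝ (Fin d)) : ℝ :=
  fderiv ℝ φ x (EuclideanSpace.single i 1)

/-- `u ∈ L²_loc(D)`. -/
def IsL2Loc (D : TopologicalSpace.Opens (EuclideanSpace ℝ (Fin d))) (u : Fn D) : Prop :=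
  ∀ K : Set (EuclideanSpace ℝ (Fin d)), IsCompact K → K ⊆ D → MemLp u 2 (volume.restrict K)

/-- `g ∈ L²(D)` is the distributional derivative `∂u/∂x_i` on `D`. -/
def IsWeakPartial (D : TopologicalSpace.Opens (EuclideanSpace ℝ (Fin d))) (i : Fin d)
    (u : Fn D) (g : Lp ℝ 2 (leb D)) : Prop :=
  ∀ φ, IsTest D φ → ∫ x in D, u x * pd i φ x = - ∫ x in D, g x * φ x

section Calculus

variable {D : TopologicalSpace.Opens (EuclideanSpace ℝ (Fin d))}

theorem IsTest.pd_continuous {φ : EuclideanSpace ℝ (Fin d) → ℝ} (hφ : IsTest D φ) (i : Fin d) :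
    Continuous (pd i φ) :=
  (hφ.smooth.continuous_fderiv (by simp)).clm_apply continuous_const

theorem pd_eq_zero {φ : EuclideanSpace ℝ (Fin d) → ℝ} (i : Fin d)
    {x : EuclideanSpace ℝ (Fin d)} (hx : x ∉ tsupport φ) : pd i φ x = 0 := by
  have : fderiv ℝ φ x = 0 := by
    by_contra h
    exact hx (support_fderiv_subset ℝ h)
  simp [pd, this]

theorem integrable_mul_of_isL2Loc {u : Fn D} (hu : IsL2Loc D u)
    {K : Set (EuclideanSpace ℝ (Fin d))} (hK : IsCompact K) (hKD : K ⊆ D)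
    {ψ : EuclideanSpace ℝ (Fin d) → ℝ} (hψ : Continuous ψ) (h0 : ∀ x ∉ K, ψ x = 0) :
    Integrable (fun x => u x * ψ x) (leb D) := by
  have h1 : IntegrableOn (fun x => u x * ψ x) K volume := by
    have : IsFiniteMeasure (volume.restrict K) :=
      ⟨by rw [Measure.restrict_apply_univ]; exact hK.measure_lt_top⟩
    have hu1 : IntegrableOn u K volume := (hu K hK hKD).integrable (by norm_num)
    exact hu1.mul_continuousOn hψ.continuousOn hK
  have h2 : IntegrableOn (fun x => u x * ψ x) D volume := by
    refine h1.of_forall_sdiff_eq_zero D.isOpen.measurableSet ?_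
    intro x hx
    simp [h0 x hx.2]
  exact h2

theorem isL2Loc_of_mem (g : Lp ℝ 2 (leb D)) : IsL2Loc D (g : Fn D) := fun _ _ hKD =>
  (Lp.memLp g).mono_measure (Measure.restrict_mono hKD le_rfl)

theorem IsTest.integrable_mul {φ : EuclideanSpace ℝ (Fin d) → ℝ} (hφ : IsTest D φ) {u : Fn D}
    (hu : IsL2Loc D u) : Integrable (fun x => u x * φ x) (leb D) :=
  integrable_mul_of_isL2Loc hu hφ.compact.isCompact hφ.supp hφ.smooth.continuous
    (fun _ hx => image_eq_zero_of_notMem_tsupport hx)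

theorem IsTest.integrable_mul_pd {φ : EuclideanSpace ℝ (Fin d) → ℝ} (hφ : IsTest D φ) (i : Fin d)
    {u : Fn D} (hu : IsL2Loc D u) : Integrable (fun x => u x * pd i φ x) (leb D) :=
  integrable_mul_of_isL2Loc hu hφ.compact.isCompact hφ.supp (hφ.pd_continuous i)
    (fun _ hx => pd_eq_zero i hx)

theorem ae_restrict_of_subset {K : Set (EuclideanSpace ℝ (Fin d))} (hKD : K ⊆ D)
    {p : EuclideanSpace ℝ (Fin d) → Prop} (h : ∀ᵐ x ∂(leb D), p x) :
    ∀ᵐ x ∂(volume.restrict K), p x :=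
  ae_mono (Measure.restrict_mono hKD le_rfl) h

theorem IsL2Loc.add {u v : Fn D} (hu : IsL2Loc D u) (hv : IsL2Loc D v) : IsL2Loc D (u + v) :=
  fun K hK hKD => ((hu K hK hKD).add (hv K hK hKD)).ae_eq
    (EventuallyEq.symm (ae_restrict_of_subset hKD (AEEqFun.coeFn_add u v)))

theorem IsL2Loc.smul {u : Fn D} (c : ℝ) (hu : IsL2Loc D u) : IsL2Loc D (c • u) :=
  fun K hK hKD => ((hu K hK hKD).const_smul c).ae_eq
    (EventuallyEq.symm (ae_restrict_of_subset hKD (AEEqFun.coeFn_smul c u)))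

theorem IsWeakPartial.add {i : Fin d} {u v : Fn D} {g h : Lp ℝ 2 (leb D)} (hu : IsL2Loc D u)
    (hv : IsL2Loc D v) (hg : IsWeakPartial D i u g) (hh : IsWeakPartial D i v h) :
    IsWeakPartial D i (u + v) (g + h) := by
  intro φ hφ
  have e1 : ∫ x in D, (u + v : Fn D) x * pd i φ x
      = ∫ x in D, (u x * pd i φ x + v x * pd i φ x) := by
    refine integral_congr_ae ?_
    filter_upwards [AEEqFun.coeFn_add u v] with x hx
    rw [hx, Pi.add_apply, add_mul]
  have e2 : ∫ x in D, (g + h : Lp ℝ 2 (leb D)) x * φ x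
      = ∫ x in D, (g x * φ x + h x * φ x) := by
    refine integral_congr_ae ?_
    filter_upwards [Lp.coeFn_add g h] with x hx
    rw [hx, Pi.add_apply, add_mul]
  rw [e1, e2, integral_add (hφ.integrable_mul_pd i hu) (hφ.integrable_mul_pd i hv),
    integral_add (hφ.integrable_mul (isL2Loc_of_mem g)) (hφ.integrable_mul (isL2Loc_of_mem h)),
    hg φ hφ, hh φ hφ]
  ring

theorem IsWeakPartial.smul {i : Fin d} {u : Fn D} {g : Lp ℝ 2 (leb D)} (c : ℝ)
    (hg : IsWeakPartial D i u g) : IsWeakPartial D i (c • u) (c • g) := by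
  intro φ hφ
  have e1 : ∫ x in D, (c • u : Fn D) x * pd i φ x = ∫ x in D, c * (u x * pd i φ x) := by
    refine integral_congr_ae ?_
    filter_upwards [AEEqFun.coeFn_smul c u] with x hx
    rw [hx, Pi.smul_apply, smul_eq_mul, mul_assoc]
  have e2 : ∫ x in D, (c • g : Lp ℝ 2 (leb D)) x * φ x = ∫ x in D, c * (g x * φ x) := by
    refine integral_congr_ae ?_
    filter_upwards [Lp.coeFn_smul c g] with x hx
    rw [hx, Pi.smul_apply, smul_eq_mul, mul_assoc]
  rw [e1, e2, integral_const_mul, integral_const_mul, hg φ hφ]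
  ring

theorem IsWeakPartial.unique {i : Fin d} {u : Fn D} {g h : Lp ℝ 2 (leb D)}
    (hg : IsWeakPartial D i u g) (hh : IsWeakPartial D i u h) : g = h := by
  have hloc : LocallyIntegrableOn (fun x => g x - h x) (D : Set (EuclideanSpace ℝ (Fin d)))
      volume := by
    rw [locallyIntegrableOn_iff D.isOpen.isLocallyClosed]
    intro K hKD hK
    have : IsFiniteMeasure (volume.restrict K) :=
      ⟨by rw [Measure.restrict_apply_univ]; exact hK.measure_lt_top⟩
    exact ((isL2Loc_of_mem g K hK hKD).integrable (by norm_num)).sub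
      ((isL2Loc_of_mem h K hK hKD).integrable (by norm_num))
  have key := D.isOpen.ae_eq_zero_of_integral_contDiff_smul_eq_zero hloc (by
    intro φ h1 h2 h3
    have hφ : IsTest D φ := ⟨h1, h2, h3⟩
    have e : ∫ x, φ x • (g x - h x) = ∫ x in D, (g x * φ x - h x * φ x) := by
      rw [← setIntegral_eq_integral_of_forall_compl_eq_zero
        (s := (D : Set (EuclideanSpace ℝ (Fin d))))]
      · refine integral_congr_ae (Eventually.of_forall fun x => ?_)
        simp only [smul_eq_mul]
        ring
      · intro x hx
        rw [image_eq_zero_of_notMem_tsupport (fun hx' => hx (h3 hx')), zero_smul]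
    rw [e, integral_sub (hφ.integrable_mul (isL2Loc_of_mem g))
      (hφ.integrable_mul (isL2Loc_of_mem h))]
    have := (hg φ hφ).symm.trans (hh φ hφ)
    linarith)
  refine Lp.ext ?_
  rw [← ae_restrict_iff' D.isOpen.measurableSet] at key
  filter_upwards [key] with x hx
  linarith

theorem isWeakPartial_const (i : Fin d) (c : ℝ) :
    IsWeakPartial D i (AEEqFun.const _ c) (0 : Lp ℝ 2 (leb D)) := by
  intro φ hφ
  have e1 : ∫ x in D, (AEEqFun.const _ c : Fn D) x * pd i φ x = ∫ x in D, c * pd i φ x := by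
    refine integral_congr_ae ?_
    filter_upwards [AEEqFun.coeFn_const _ c] with x hx
    rw [hx, Function.const_apply]
  have e2 : ∫ x in D, (0 : Lp ℝ 2 (leb D)) x * φ x = 0 := by
    refine integral_eq_zero_of_ae ?_
    filter_upwards [Lp.coeFn_zero ℝ 2 (leb D)] with x hx
    rw [hx, Pi.zero_apply, zero_mul]
  have hc : HasCompactSupport (pd i φ) :=
    HasCompactSupport.intro hφ.compact.isCompact fun _ hx => pd_eq_zero i hx
  have e3 : ∫ x in D, c * pd i φ x = ∫ x, c * pd i φ x := by
    refine setIntegral_eq_integral_of_forall_compl_eq_zero fun x hx => ?_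
    rw [pd_eq_zero i (fun hx' => hx (hφ.supp hx')), mul_zero]
  have e4 : ∫ x, c * pd i φ x = 0 := by
    have := integral_mul_fderiv_eq_neg_fderiv_mul_of_integrable (μ := volume)
      (f := fun _ : EuclideanSpace ℝ (Fin d) => c) (g := φ)
      (v := EuclideanSpace.single i 1) (by simp)
      (((hφ.pd_continuous i).integrable_of_hasCompactSupport hc).const_mul c)
      ((hφ.smooth.continuous.integrable_of_hasCompactSupport hφ.compact).const_mul c)
      (fun _ _ => differentiableAt_const c)
      (fun x _ => (hφ.smooth.differentiable (by simp)) x)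
    simpa [pd] using this
  rw [e1, e2, e3, e4, neg_zero]

end Calculus

/-- `BL(D)`: the functions in `L²_loc(D)` all of whose first order distributional derivatives are
in `L²(D)`. -/
def BL (D : TopologicalSpace.Opens (EuclideanSpace ℝ (Fin d))) : Submodule ℝ (Fn D) where
  carrier := {u | IsL2Loc D u ∧ ∀ i, ∃ g : Lp ℝ 2 (leb D), IsWeakPartial D i u g}
  zero_mem' := by
    refine ⟨fun K hK hKD => ?_, fun i => ⟨0, ?_⟩⟩
    · exact MemLp.zero.ae_eq (EventuallyEq.symm (ae_restrict_of_subset hKD AEEqFun.coeFn_zero))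
    · exact isWeakPartial_const i 0
  add_mem' := by
    rintro u v ⟨hu, hu'⟩ ⟨hv, hv'⟩
    refine ⟨hu.add hv, fun i => ?_⟩
    obtain ⟨g, hg⟩ := hu' i
    obtain ⟨h, hh⟩ := hv' i
    exact ⟨g + h, hg.add hu hv hh⟩
  smul_mem' := by
    rintro c u ⟨hu, hu'⟩
    refine ⟨hu.smul c, fun i => ?_⟩
    obtain ⟨g, hg⟩ := hu' i
    exact ⟨c • g, hg.smul c⟩

open Classical in
/-- The distributional derivative `∂u/∂x_i ∈ L²(D)`; used only for `u ∈ BL(D)`, where it exists and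
is unique (the value is `0` if it does not exist). -/
def weakPartial (D : TopologicalSpace.Opens (EuclideanSpace ℝ (Fin d))) (i : Fin d) (u : Fn D) :
    Lp ℝ 2 (leb D) :=
  if h : ∃ g : Lp ℝ 2 (leb D), IsWeakPartial D i u g then h.choose else 0

/-- The Dirichlet integral `𝐃(u, v) = ∑ᵢ ∫_D ∂ᵢu ∂ᵢv dx`. -/
def dirichlet (D : TopologicalSpace.Opens (EuclideanSpace ℝ (Fin d))) (u v : Fn D) : ℝ :=
  ∑ i, ∫ x in D, weakPartial D i u x * weakPartial D i v x

/-- `W^{1,2}(D) = BL(D) ∩ L²(D)`. -/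
def W12 (D : TopologicalSpace.Opens (EuclideanSpace ℝ (Fin d))) : Submodule ℝ (Fn D) :=
  BL D ⊓ Lp.LpSubmodule ℝ ℝ 2 (leb D)

/-- The Dirichlet form `(½𝐃, W^{1,2}(D))` on `L²(D)` is transient. -/
def IsTransient (D : TopologicalSpace.Opens (EuclideanSpace ℝ (Fin d))) : Prop :=
  IsTransientForm (μ := leb D) {u | (u : Fn D) ∈ W12 D}
    (fun u v => (1 / 2) * dirichlet D (u : Fn D) (v : Fn D))

/-- `w` is an approximating sequence of `u`: a `½𝐃`-Cauchy sequence in `W^{1,2}(D)` that converges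
to `u` a.e. on `D`. -/
structure IsApprox (D : TopologicalSpace.Opens (EuclideanSpace ℝ (Fin d))) (w : ℕ → Fn D)
    (u : Fn D) : Prop where
  mem : ∀ n, w n ∈ W12 D
  cauchy : ∀ ε : ℝ, 0 < ε → ∃ N : ℕ, ∀ m ≥ N, ∀ n ≥ N,
    (1 / 2) * dirichlet D (w m - w n) (w m - w n) < ε
  lim : ∀ᵐ x ∂(leb D), Tendsto (fun n => w n x) atTop (𝓝 (u x))

section Gradient

variable {D : TopologicalSpace.Opens (EuclideanSpace ℝ (Fin d))}

theorem weakPartial_spec {u : Fn D} (hu : u ∈ BL D) (i : Fin d) :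
    IsWeakPartial D i u (weakPartial D i u) := by
  have h := hu.2 i
  rw [weakPartial, dif_pos h]
  exact h.choose_spec

theorem weakPartial_eq {u : Fn D} (hu : u ∈ BL D) {i : Fin d} {g : Lp ℝ 2 (leb D)}
    (hg : IsWeakPartial D i u g) : weakPartial D i u = g :=
  (weakPartial_spec hu i).unique hg

variable (D) in
/-- The distributional gradient as a linear map on `BL(D)`. -/
def grad : BL D →ₗ[ℝ] PiLp 2 (fun _ : Fin d => Lp ℝ 2 (leb D)) where
  toFun u := WithLp.toLp 2 fun i => weakPartial D i (u : Fn D)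
  map_add' u v := by
    ext1 i
    exact weakPartial_eq (u + v).2
      ((weakPartial_spec u.2 i).add u.2.1 v.2.1 (weakPartial_spec v.2 i))
  map_smul' c u := by
    ext1 i
    exact weakPartial_eq (c • u).2 ((weakPartial_spec u.2 i).smul c)

theorem dirichlet_eq_inner (u v : BL D) :
    dirichlet D (u : Fn D) (v : Fn D) = inner ℝ (grad D u) (grad D v) := by
  rw [PiLp.inner_apply, dirichlet]
  refine Finset.sum_congr rfl fun i _ => ?_
  rw [L2.inner_def]
  refine integral_congr_ae (Eventually.of_forall fun x => ?_)
  simp [grad, mul_comm]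

theorem dirichlet_self_eq (u : BL D) :
    dirichlet D (u : Fn D) (u : Fn D) = ‖grad D u‖ ^ 2 := by
  rw [dirichlet_eq_inner, real_inner_self_eq_norm_sq]

end Gradient

/-- The extended Sobolev space `W_e^{1,2}(D)`: the extended Dirichlet space of
`(½𝐃, W^{1,2}(D))`. -/
def extSobolev (D : TopologicalSpace.Opens (EuclideanSpace ℝ (Fin d))) : Submodule ℝ (Fn D) where
  carrier := {u | ∃ w : ℕ → Fn D, IsApprox D w u}
  zero_mem' := by
    refine ⟨fun _ => 0, fun _ => (W12 D).zero_mem, fun ε hε => ⟨0, fun m _ n _ => ?_⟩,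
      Eventually.of_forall fun x => tendsto_const_nhds⟩
    have := dirichlet_self_eq (0 : BL D)
    simp only [ZeroMemClass.coe_zero, map_zero, norm_zero] at this
    rw [sub_self, this]
    simpa using hε
  add_mem' := by
    rintro u v ⟨w, hw⟩ ⟨z, hz⟩
    refine ⟨fun n => w n + z n, fun n => (W12 D).add_mem (hw.mem n) (hz.mem n), fun ε hε => ?_, ?_⟩
    · obtain ⟨N, hN⟩ := hw.cauchy (ε / 4) (by positivity)
      obtain ⟨M, hM⟩ := hz.cauchy (ε / 4) (by positivity)
      refine ⟨max N M, fun m hm n hn => ?_⟩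
      have h1 := hN m (le_trans (le_max_left _ _) hm) n (le_trans (le_max_left _ _) hn)
      have h2 := hM m (le_trans (le_max_right _ _) hm) n (le_trans (le_max_right _ _) hn)
      let a : BL D := ⟨w m - w n, (BL D).sub_mem (hw.mem m).1 (hw.mem n).1⟩
      let b : BL D := ⟨z m - z n, (BL D).sub_mem (hz.mem m).1 (hz.mem n).1⟩
      have ea := dirichlet_self_eq a
      have eb := dirichlet_self_eq b
      have eab := dirichlet_self_eq (a + b)
      have e : w m + z m - (w n + z n) = ((a + b : BL D) : Fn D) := by
        simp only [a, b, Submodule.coe_add]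
        abel
      rw [e, eab, map_add]
      change (1 / 2) * dirichlet D (a : Fn D) (a : Fn D) < _ at h1
      change (1 / 2) * dirichlet D (b : Fn D) (b : Fn D) < _ at h2
      rw [ea] at h1
      rw [eb] at h2
      have h3 := norm_add_le (grad D a) (grad D b)
      have h4 := norm_nonneg (grad D a + grad D b)
      nlinarith [sq_nonneg (‖grad D a‖ - ‖grad D b‖)]
    · have hc : ∀ᵐ x ∂(leb D), ∀ n, (w n + z n : Fn D) x = w n x + z n x :=
        ae_all_iff.2 fun n => AEEqFun.coeFn_add (w n) (z n)
      filter_upwards [hw.lim, hz.lim, hc, AEEqFun.coeFn_add u v] with x h1 h2 h3 h4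
      rw [h4]
      simp only [h3]
      exact h1.add h2
  smul_mem' := by
    rintro c u ⟨w, hw⟩
    refine ⟨fun n => c • w n, fun n => (W12 D).smul_mem c (hw.mem n), fun ε hε => ?_, ?_⟩
    · obtain ⟨N, hN⟩ := hw.cauchy (ε / (c ^ 2 + 1)) (by positivity)
      refine ⟨N, fun m hm n hn => ?_⟩
      have h1 := hN m hm n hn
      let a : BL D := ⟨w m - w n, (BL D).sub_mem (hw.mem m).1 (hw.mem n).1⟩
      have ea := dirichlet_self_eq a
      have eca := dirichlet_self_eq (c • a)
      have e : c • w m - c • w n = ((c • a : BL D) : Fn D) := by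
        simp only [a, Submodule.coe_smul, smul_sub]
      rw [e, eca, map_smul, norm_smul, mul_pow, Real.norm_eq_abs, sq_abs]
      change (1 / 2) * dirichlet D (a : Fn D) (a : Fn D) < _ at h1
      rw [ea, lt_div_iff₀ (by positivity)] at h1
      nlinarith [sq_nonneg ‖grad D a‖]
    · have hc : ∀ᵐ x ∂(leb D), ∀ n, (c • w n : Fn D) x = c * w n x :=
        ae_all_iff.2 fun n => AEEqFun.coeFn_smul c (w n)
      filter_upwards [hw.lim, hc, AEEqFun.coeFn_smul c u] with x h1 h3 h4
      rw [h4]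
      simp only [h3]
      exact h1.const_mul c

/-- `ℍ*(D)`: the functions in `BL(D)` that are `𝐃`-orthogonal to `W_e^{1,2}(D)`. -/
def Hstar (D : TopologicalSpace.Opens (EuclideanSpace ℝ (Fin d))) : Submodule ℝ (Fn D) where
  carrier := {u | u ∈ BL D ∧ ∀ v ∈ BL D, v ∈ extSobolev D → dirichlet D u v = 0}
  zero_mem' := by
    refine ⟨(BL D).zero_mem, fun v hv _ => ?_⟩
    have := dirichlet_eq_inner (0 : BL D) ⟨v, hv⟩
    simpa using this
  add_mem' := by
    rintro a b ⟨ha, ha'⟩ ⟨hb, hb'⟩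
    refine ⟨(BL D).add_mem ha hb, fun v hv hve => ?_⟩
    have h := dirichlet_eq_inner (⟨a, ha⟩ + ⟨b, hb⟩ : BL D) ⟨v, hv⟩
    rw [map_add, inner_add_left, ← dirichlet_eq_inner, ← dirichlet_eq_inner] at h
    exact h.trans (by rw [ha' v hv hve, hb' v hv hve, add_zero])
  smul_mem' := by
    rintro c a ⟨ha, ha'⟩
    refine ⟨(BL D).smul_mem c ha, fun v hv hve => ?_⟩
    have h := dirichlet_eq_inner (c • ⟨a, ha⟩ : BL D) ⟨v, hv⟩
    rw [map_smul, real_inner_smul_left, ← dirichlet_eq_inner] at h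
    exact h.trans (by rw [ha' v hv hve, mul_zero])

/-! ### Beppo Levi functions modulo constants, with the inner product `½𝐃` -/

section Quotient

variable (D : TopologicalSpace.Opens (EuclideanSpace ℝ (Fin d)))

/-- The constant functions, as a subspace of `BL(D)`. -/
def constants : Submodule ℝ (BL D) where
  carrier := {u | ∃ c : ℝ, (u : Fn D) = AEEqFun.const _ c}
  zero_mem' := ⟨0, rfl⟩
  add_mem' := by
    rintro u v ⟨a, ha⟩ ⟨b, hb⟩
    exact ⟨a + b, by rw [Submodule.coe_add, ha, hb]; rfl⟩
  smul_mem' := by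
    rintro c u ⟨a, ha⟩
    exact ⟨c * a, by rw [Submodule.coe_smul, ha]; rfl⟩

/-- The quotient of `BL(D)` by the constant functions. -/
def BLdot : Type := BL D ⧸ constants D

instance : AddCommGroup (BLdot D) := inferInstanceAs (AddCommGroup (BL D ⧸ constants D))

instance : Module ℝ (BLdot D) := inferInstanceAs (Module ℝ (BL D ⧸ constants D))

/-- The canonical map from `BL(D)` to its quotient by the constant functions. -/
def toBLdot : BL D →ₗ[ℝ] BLdot D := (constants D).mkQ

/-- The gradient on the quotient. -/
def gradDot : BLdot D →ₗ[ℝ] PiLp 2 (fun _ : Fin d => Lp ℝ 2 (leb D)) :=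
  (constants D).liftQ (grad D) (by
    rintro u ⟨c, hc⟩
    rw [LinearMap.mem_ker]
    ext1 i
    exact weakPartial_eq u.2 (hc ▸ isWeakPartial_const i c))

/-- The form `½𝐃` on the quotient; that it is definite is not built in. -/
@[reducible]
def blCore : PreInnerProductSpace.Core ℝ (BLdot D) where
  inner x y := (1 / 2) * inner ℝ (gradDot D x) (gradDot D y)
  conj_inner_symm x y := by
    simp only [conj_trivial]
    rw [real_inner_comm]
  re_inner_nonneg x := by
    simp only [RCLike.re_to_real]
    have := real_inner_self_nonneg (x := gradDot D x)
    positivity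
  add_left x y z := by rw [map_add, inner_add_left, mul_add]
  smul_left x y r := by
    rw [map_smul, real_inner_smul_left, conj_trivial]
    ring

instance : SeminormedAddCommGroup (BLdot D) :=
  @InnerProductSpace.Core.toSeminormedAddCommGroup ℝ (BLdot D) _ _ _ (blCore D)

instance : InnerProductSpace ℝ (BLdot D) := InnerProductSpace.ofCore (blCore D)

theorem inner_toBLdot (u v : BL D) :
    inner ℝ (toBLdot D u) (toBLdot D v) = (1 / 2) * dirichlet D (u : Fn D) (v : Fn D) := by
  rw [dirichlet_eq_inner]
  rfl

end Quotient

end BeppoLevi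

end

noncomputable section

namespace BeppoLevi

/-! ### Functionals on test functions that are bounded in `L²` -/

theorem exists_inner_eq_of_abs_le {X H : Type*} [AddCommGroup X] [Module ℝ X]
    [NormedAddCommGroup H] [InnerProductSpace ℝ H] [CompleteSpace H] (ι : X →ₗ[ℝ] H)
    (Λ : X →ₗ[ℝ] ℝ) {C : ℝ} (hC : 0 ≤ C) (h : ∀ x, |Λ x| ≤ C * ‖ι x‖) :
    ∃ g : H, ‖g‖ ≤ C ∧ ∀ x, Λ x = inner ℝ g (ι x) := by
  have hker : LinearMap.ker ι ≤ LinearMap.ker Λ := by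
    intro x hx
    rw [LinearMap.mem_ker] at hx ⊢
    have := h x
    rw [hx, norm_zero, mul_zero] at this
    exact abs_nonpos_iff.1 this
  let f₀ : LinearMap.range ι →ₗ[ℝ] ℝ :=
    ((LinearMap.ker ι).liftQ Λ hker).comp ι.quotKerEquivRange.symm.toLinearMap
  have hf₀ : ∀ x, f₀ ⟨ι x, LinearMap.mem_range_self ι x⟩ = Λ x := by
    intro x
    have e : ι.quotKerEquivRange.symm ⟨ι x, LinearMap.mem_range_self ι x⟩
        = (LinearMap.ker ι).mkQ x := by
      rw [LinearEquiv.symm_apply_eq]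
      rfl
    simp [f₀, e]
  let f : StrongDual ℝ (LinearMap.range ι) := f₀.mkContinuous C (by
    rintro ⟨_, x, rfl⟩
    rw [hf₀, Real.norm_eq_abs]
    exact h x)
  obtain ⟨F, hF, hFn⟩ := exists_extension_norm_eq (LinearMap.range ι) f
  refine ⟨(InnerProductSpace.toDual ℝ H).symm F, ?_, fun x => ?_⟩
  · rw [LinearIsometryEquiv.norm_map, hFn]
    exact LinearMap.mkContinuous_norm_le _ hC _
  · rw [InnerProductSpace.toDual_symm_apply]
    have := hF ⟨ι x, LinearMap.mem_range_self ι x⟩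
    rw [show F (ι x) = _ from this]
    exact (hf₀ x).symm

variable {d : ℕ} {D : TopologicalSpace.Opens (EuclideanSpace ℝ (Fin d))}

theorem IsTest.add {φ ψ : EuclideanSpace ℝ (Fin d) → ℝ} (hφ : IsTest D φ) (hψ : IsTest D ψ) :
    IsTest D (φ + ψ) :=
  ⟨hφ.smooth.add hψ.smooth, hφ.compact.add hψ.compact,
    (tsupport_add φ ψ).trans (Set.union_subset hφ.supp hψ.supp)⟩

theorem IsTest.const_smul {φ : EuclideanSpace ℝ (Fin d) → ℝ} (hφ : IsTest D φ) (c : ℝ) :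
    IsTest D (c • φ) :=
  ⟨hφ.smooth.const_smul c, hφ.compact.smul_left (f := fun _ => c),
    (tsupport_smul_subset_right (fun _ => c) φ).trans hφ.supp⟩

theorem isTest_zero : IsTest D (0 : EuclideanSpace ℝ (Fin d) → ℝ) :=
  ⟨contDiff_const, HasCompactSupport.zero, by simp [tsupport]⟩

variable (D) in
/-- The space `C_c^∞(D)`. -/
def testSpace : Submodule ℝ (EuclideanSpace ℝ (Fin d) → ℝ) where
  carrier := {φ | IsTest D φ}
  zero_mem' := isTest_zero
  add_mem' := IsTest.add
  smul_mem' c _ h := h.const_smul c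

theorem IsTest.memLp {φ : EuclideanSpace ℝ (Fin d) → ℝ} (hφ : IsTest D φ) : MemLp φ 2 volume :=
  hφ.smooth.continuous.memLp_of_hasCompactSupport hφ.compact

variable (D) in
/-- The inclusion of `C_c^∞(D)` into `L²(D)`. -/
def testToLp : testSpace D →ₗ[ℝ] Lp ℝ 2 (leb D) where
  toFun φ := (φ.2.memLp.restrict (D : Set (EuclideanSpace ℝ (Fin d)))).toLp φ.1
  map_add' _ _ := rfl
  map_smul' _ _ := rfl

theorem inner_testToLp (g : Lp ℝ 2 (leb D)) (φ : testSpace D) :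
    inner ℝ g (testToLp D φ) = ∫ x in D, g x * φ.1 x := by
  rw [L2.inner_def]
  refine integral_congr_ae ?_
  filter_upwards [(φ.2.memLp.restrict (D : Set (EuclideanSpace ℝ (Fin d)))).coeFn_toLp] with x hx
  rw [show (testToLp D φ : EuclideanSpace ℝ (Fin d) → ℝ) x = φ.1 x from hx]
  simp [mul_comm]

theorem norm_testToLp (φ : testSpace D) : ‖testToLp D φ‖ = (eLpNorm φ.1 2 (leb D)).toReal :=
  Lp.norm_toLp φ.1 (φ.2.memLp.restrict (D : Set (EuclideanSpace ℝ (Fin d))))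

theorem IsTest.eLpNorm_leb {φ : EuclideanSpace ℝ (Fin d) → ℝ} (hφ : IsTest D φ) :
    eLpNorm φ 2 (leb D) = eLpNorm φ 2 volume := by
  refine eLpNorm_restrict_eq_of_support_subset ?_
  exact (subset_tsupport φ).trans hφ.supp

/-- `L²` duality against test functions. -/
theorem eLpNorm_le_of_abs_integral_test_le (U : TopologicalSpace.Opens (EuclideanSpace ℝ (Fin d)))
    {w : EuclideanSpace ℝ (Fin d) → ℝ} (hw : IntegrableOn w U) {C : ℝ} (hC : 0 ≤ C)
    (h : ∀ φ, IsTest U φ → |∫ x in U, w x * φ x| ≤ C * (eLpNorm φ 2 volume).toReal) :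
    eLpNorm w 2 (leb U) ≤ ENNReal.ofReal C := by
  have hint : ∀ φ, IsTest U φ → Integrable (fun x => w x * φ x) (leb U) := by
    intro φ hφ
    obtain ⟨M, hM⟩ := hφ.compact.exists_bound_of_continuous hφ.smooth.continuous
    exact hw.mul_bdd hφ.smooth.continuous.aestronglyMeasurable (Eventually.of_forall hM)
  let Λ : testSpace U →ₗ[ℝ] ℝ :=
    { toFun := fun φ => ∫ x in U, w x * φ.1 x
      map_add' := fun φ ψ => by
        rw [← integral_add (hint _ φ.2) (hint _ ψ.2)]
        simp [mul_add]
      map_smul' := fun c φ => by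
        rw [RingHom.id_apply, smul_eq_mul, ← integral_const_mul]
        simp [mul_left_comm] }
  obtain ⟨g, hg, hgΛ⟩ := exists_inner_eq_of_abs_le (testToLp U) Λ hC (fun φ => by
    rw [norm_testToLp, φ.2.eLpNorm_leb]
    exact h φ.1 φ.2)
  have hloc : LocallyIntegrableOn (fun x => w x - g x) (U : Set (EuclideanSpace ℝ (Fin d)))
      volume := by
    rw [locallyIntegrableOn_iff U.isOpen.isLocallyClosed]
    intro K hKU hK
    have : IsFiniteMeasure (volume.restrict K) :=
      ⟨by rw [Measure.restrict_apply_univ]; exact hK.measure_lt_top⟩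
    exact (hw.mono_set hKU).sub ((isL2Loc_of_mem g K hK hKU).integrable (by norm_num))
  have key := U.isOpen.ae_eq_zero_of_integral_contDiff_smul_eq_zero hloc (by
    intro φ h1 h2 h3
    have hφ : IsTest U φ := ⟨h1, h2, h3⟩
    have e : ∫ x, φ x • (w x - g x) = ∫ x in U, (w x * φ x - g x * φ x) := by
      rw [← setIntegral_eq_integral_of_forall_compl_eq_zero
        (s := (U : Set (EuclideanSpace ℝ (Fin d))))]
      · refine integral_congr_ae (Eventually.of_forall fun x => ?_)
        simp only [smul_eq_mul]
        ring
      · intro x hx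
        rw [image_eq_zero_of_notMem_tsupport (fun hx' => hx (h3 hx')), zero_smul]
    rw [e, integral_sub (hint φ hφ) (hφ.integrable_mul (isL2Loc_of_mem g)),
      ← inner_testToLp g ⟨φ, hφ⟩, ← hgΛ]
    exact sub_self _)
  rw [← ae_restrict_iff' U.isOpen.measurableSet] at key
  have e : w =ᵐ[leb U] g := by
    filter_upwards [key] with x hx
    linarith
  rw [eLpNorm_congr_ae e, ← Lp.enorm_def, ← ofReal_norm]
  exact ENNReal.ofReal_le_ofReal hg

/-- Differentiation under the integral sign over a compact set. -/
theorem hasDerivAt_setIntegral_mul {K : Set (EuclideanSpace ℝ (Fin d))} (hK : IsCompact K)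
    {u : EuclideanSpace ℝ (Fin d) → ℝ} (hu : IntegrableOn u K)
    {F F' : ℝ → EuclideanSpace ℝ (Fin d) → ℝ} (hF : ∀ s y, HasDerivAt (fun s => F s y) (F' s y) s)
    (hFc : ∀ s, Continuous (F s)) (hF'c : Continuous (Function.uncurry F')) (s₀ : ℝ) :
    HasDerivAt (fun s => ∫ y in K, u y * F s y) (∫ y in K, u y * F' s₀ y) s₀ := by
  obtain ⟨M, hM⟩ := ((isCompact_closedBall s₀ 1).prod hK).exists_bound_of_continuousOn
    hF'c.continuousOn
  have hF's : Continuous (F' s₀) := hF'c.comp (Continuous.prodMk_right s₀)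
  refine (hasDerivAt_integral_of_dominated_loc_of_deriv_le (F := fun s y => u y * F s y)
    (F' := fun s y => u y * F' s y) (bound := fun y => ‖u y‖ * M)
    (Metric.closedBall_mem_nhds s₀ one_pos) ?_ ?_ ?_ ?_ ?_ ?_).2
  · exact Eventually.of_forall fun s =>
      hu.aestronglyMeasurable.mul (hFc s).aestronglyMeasurable
  · exact hu.mul_continuousOn (hFc s₀).continuousOn hK
  · exact hu.aestronglyMeasurable.mul hF's.aestronglyMeasurable
  · filter_upwards [ae_restrict_mem hK.measurableSet] with y hy s hs
    rw [norm_mul]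
    exact mul_le_mul_of_nonneg_left (hM (s, y) ⟨hs, hy⟩) (norm_nonneg _)
  · exact hu.norm.mul_const M
  · exact Eventually.of_forall fun y s _ => (hF s y).const_mul (u y)

theorem IsTest.comp_sub {φ : EuclideanSpace ℝ (Fin d) → ℝ}
    {U : TopologicalSpace.Opens (EuclideanSpace ℝ (Fin d))} (hφ : IsTest U φ)
    (a : EuclideanSpace ℝ (Fin d)) (h : ∀ x ∈ U, x + a ∈ D) : IsTest D (fun x => φ (x - a)) := by
  have hs : tsupport (fun x => φ (x - a)) = (fun x => x - a) ⁻¹' tsupport φ :=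
    tsupport_comp_eq_preimage φ (Homeomorph.subRight a)
  refine ⟨hφ.smooth.comp (contDiff_id.sub contDiff_const),
    hφ.compact.comp_homeomorph (Homeomorph.subRight a), ?_⟩
  rw [hs]
  intro x hx
  have := h _ (hφ.supp hx)
  rwa [sub_add_cancel] at this

theorem fderiv_apply_eq_sum_pd (φ : EuclideanSpace ℝ (Fin d) → ℝ)
    (x h : EuclideanSpace ℝ (Fin d)) : fderiv ℝ φ x h = ∑ i, h i * pd i φ x := by
  have e : h = ∑ i, h i • EuclideanSpace.single i (1 : ℝ) := by
    ext j
    simp [Finset.sum_apply, Pi.single_apply]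
  conv_lhs => rw [e]
  simp [pd]

theorem IsL2Loc.integrableOn {u : Fn D} (hu : IsL2Loc D u) {K : Set (EuclideanSpace ℝ (Fin d))}
    (hK : IsCompact K) (hKD : K ⊆ D) : IntegrableOn u K := by
  have : IsFiniteMeasure (volume.restrict K) :=
    ⟨by rw [Measure.restrict_apply_univ]; exact hK.measure_lt_top⟩
  exact (hu K hK hKD).integrable (by norm_num)

theorem setIntegral_eq_of_support_subset {K : Set (EuclideanSpace ℝ (Fin d))} (hKD : K ⊆ D)
    {f : EuclideanSpace ℝ (Fin d) → ℝ} (h0 : ∀ x ∉ K, f x = 0) :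
    ∫ x in K, f x = ∫ x in D, f x := by
  rw [setIntegral_eq_integral_of_forall_compl_eq_zero h0,
    setIntegral_eq_integral_of_forall_compl_eq_zero fun x hx => h0 x fun hx' => hx (hKD hx')]

theorem abs_integral_mul_test_le (g : Lp ℝ 2 (leb D)) {φ : EuclideanSpace ℝ (Fin d) → ℝ}
    (hφ : IsTest D φ) : |∫ x in D, g x * φ x| ≤ ‖g‖ * (eLpNorm φ 2 volume).toReal := by
  rw [← hφ.eLpNorm_leb]
  have := abs_real_inner_le_norm g (testToLp D ⟨φ, hφ⟩)
  rwa [inner_testToLp, norm_testToLp] at this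

theorem IsWeakPartial.sum_smul {u : Fn D} (hu : IsL2Loc D u) {g : Fin d → Lp ℝ 2 (leb D)}
    (hg : ∀ i, IsWeakPartial D i u (g i)) (h : EuclideanSpace ℝ (Fin d))
    {φ : EuclideanSpace ℝ (Fin d) → ℝ} (hφ : IsTest D φ) :
    ∫ x in D, u x * fderiv ℝ φ x h = - ∫ x in D, (∑ i, h i • g i : Lp ℝ 2 (leb D)) x * φ x := by
  have e1 : ∫ x in D, u x * fderiv ℝ φ x h = ∑ i, h i * ∫ x in D, u x * pd i φ x := by
    simp_rw [fderiv_apply_eq_sum_pd, Finset.mul_sum, ← integral_const_mul]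
    rw [integral_finsetSum]
    · refine Finset.sum_congr rfl fun i _ => integral_congr_ae (Eventually.of_forall fun x => ?_)
      simp only
      ring
    · intro i _
      refine ((hφ.integrable_mul_pd i hu).const_mul (h i)).congr (Eventually.of_forall fun x => ?_)
      simp only
      ring
  rw [e1, ← inner_testToLp _ ⟨φ, hφ⟩, sum_inner, ← Finset.sum_neg_distrib]
  refine Finset.sum_congr rfl fun i _ => ?_
  rw [hg i φ hφ, real_inner_smul_left, inner_testToLp]
  ring

theorem abs_integral_translate_sub_le {u : Fn D} (hu : IsL2Loc D u) {g : Fin d → Lp ℝ 2 (leb D)}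
    (hg : ∀ i, IsWeakPartial D i u (g i)) (h : EuclideanSpace ℝ (Fin d))
    {K : Set (EuclideanSpace ℝ (Fin d))} (hK : IsCompact K) (hKD : K ⊆ D)
    {U : TopologicalSpace.Opens (EuclideanSpace ℝ (Fin d))}
    (hU : ∀ x ∈ U, ∀ s ∈ Set.Icc (0 : ℝ) 1, x + s • h ∈ K)
    {φ : EuclideanSpace ℝ (Fin d) → ℝ} (hφ : IsTest U φ) :
    |(∫ x in K, u x * φ (x - h)) - ∫ x in K, u x * φ x| ≤
      ‖∑ i, h i • g i‖ * (eLpNorm φ 2 volume).toReal := by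
  set F : ℝ → EuclideanSpace ℝ (Fin d) → ℝ := fun s x => φ (x - s • h) with hFdef
  set F' : ℝ → EuclideanSpace ℝ (Fin d) → ℝ := fun s x => - fderiv ℝ φ (x - s • h) h with hF'def
  have hdiff : Differentiable ℝ φ := hφ.smooth.differentiable (by simp)
  have hF : ∀ s y, HasDerivAt (fun s => F s y) (F' s y) s := by
    intro s y
    have h1 : HasDerivAt (fun s : ℝ => y - s • h) (-((1 : ℝ) • h)) s :=
      ((hasDerivAt_id s).smul_const h).const_sub y
    have h2 := (hdiff (y - s • h)).hasFDerivAt.comp_hasDerivAt s h1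
    simpa [hFdef, hF'def, Function.comp_def] using h2
  have hFc : ∀ s, Continuous (F s) := fun s =>
    hφ.smooth.continuous.comp (continuous_id.sub continuous_const)
  have hF'c : Continuous (Function.uncurry F') := by
    have h1 := hφ.smooth.continuous_fderiv (by simp)
    have h2 : Continuous fun p : ℝ × EuclideanSpace ℝ (Fin d) => p.2 - p.1 • h := by fun_prop
    exact ((h1.comp h2).clm_apply continuous_const).neg
  have hder := hasDerivAt_setIntegral_mul hK (hu.integrableOn hK hKD) hF hFc hF'c
  have hbound : ∀ s ∈ Set.Ico (0 : ℝ) 1, ‖∫ y in K, u y * F' s y‖ ≤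
      ‖∑ i, h i • g i‖ * (eLpNorm φ 2 volume).toReal := by
    intro s hs
    have hs' : s ∈ Set.Icc (0 : ℝ) 1 := ⟨hs.1, hs.2.le⟩
    have hts : IsTest D (fun x => φ (x - s • h)) :=
      hφ.comp_sub (s • h) fun x hx => hKD (hU x hx s hs')
    have e1 : ∀ x, F' s x = - fderiv ℝ (fun x => φ (x - s • h)) x h := by
      intro x
      rw [fderiv_comp_sub]
    have hsub : ∀ x ∉ K, u x * F' s x = 0 := by
      intro x hx
      have : x - s • h ∉ tsupport φ := fun hx' => hx (by
        have := hU _ (hφ.supp hx') s hs'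
        rwa [sub_add_cancel] at this)
      have h0 : fderiv ℝ φ (x - s • h) = 0 := by
        by_contra hne
        exact this (support_fderiv_subset ℝ hne)
      simp [hF'def, h0]
    have e2 : ∫ y in K, u y * F' s y
        = ∫ x in D, (∑ i, h i • g i : Lp ℝ 2 (leb D)) x * φ (x - s • h) := by
      rw [setIntegral_eq_of_support_subset hKD hsub]
      simp_rw [e1, mul_neg]
      rw [integral_neg, IsWeakPartial.sum_smul hu hg h hts, neg_neg]
    rw [e2, Real.norm_eq_abs]
    refine (abs_integral_mul_test_le _ hts).trans_eq ?_
    congr 2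
    exact eLpNorm_comp_measurePreserving hφ.smooth.continuous.aestronglyMeasurable
      (measurePreserving_sub_right volume (s • h))
  have := norm_image_sub_le_of_norm_deriv_le_segment_01'
    (fun s _ => (hder s).hasDerivWithinAt) hbound
  simpa [hFdef] using this

theorem setIntegral_translate_sub_mul {v : EuclideanSpace ℝ (Fin d) → ℝ}
    {K : Set (EuclideanSpace ℝ (Fin d))} (hv : IntegrableOn v K) (h : EuclideanSpace ℝ (Fin d))
    {U : TopologicalSpace.Opens (EuclideanSpace ℝ (Fin d))}
    (hU0 : (U : Set (EuclideanSpace ℝ (Fin d))) ⊆ K)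
    (hU1 : (U : Set (EuclideanSpace ℝ (Fin d))) ⊆ (fun x => x + h) ⁻¹' K) :
    IntegrableOn (fun x => v (x + h) - v x) U ∧ ∀ φ, IsTest U φ →
      ∫ x in U, (v (x + h) - v x) * φ x
        = (∫ x in K, v x * φ (x - h)) - ∫ x in K, v x * φ x := by
  have hmp := measurePreserving_add_right (volume : Measure (EuclideanSpace ℝ (Fin d))) h
  have hI1 : IntegrableOn (fun x => v (x + h)) U :=
    ((hmp.integrableOn_comp_preimage (measurableEmbedding_addRight h)).2 hv).mono_set hU1
  have hI0 : IntegrableOn (fun x => v x) U := hv.mono_set hU0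
  refine ⟨hI1.sub hI0, fun φ hφ => ?_⟩
  obtain ⟨M, hM⟩ := hφ.compact.exists_bound_of_continuous hφ.smooth.continuous
  have hb : ∀ {v : EuclideanSpace ℝ (Fin d) → ℝ}, IntegrableOn v U →
      IntegrableOn (fun x => v x * φ x) U := fun hv =>
    hv.mul_bdd hφ.smooth.continuous.aestronglyMeasurable (Eventually.of_forall hM)
  have h0 : ∀ x ∉ U, φ x = 0 := fun x hx =>
    image_eq_zero_of_notMem_tsupport fun hx' => hx (hφ.supp hx')
  simp_rw [sub_mul]
  rw [integral_sub (hb hI1) (hb hI0)]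
  congr 1
  · rw [setIntegral_eq_integral_of_forall_compl_eq_zero fun x hx => by rw [h0 x hx, mul_zero],
      setIntegral_eq_integral_of_forall_compl_eq_zero fun x hx => ?_]
    · rw [← integral_add_right_eq_self (fun x => v x * φ (x - h)) h]
      simp only [add_sub_cancel_right]
    · rw [h0 (x - h) fun hx' => hx (by simpa using hU1 hx'), mul_zero]
  · rw [setIntegral_eq_integral_of_forall_compl_eq_zero fun x hx => by rw [h0 x hx, mul_zero],
      setIntegral_eq_integral_of_forall_compl_eq_zero fun x hx => ?_]
    rw [h0 x fun hx' => hx (hU0 hx'), mul_zero]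

/-- The `L²` modulus of continuity of a function with square integrable weak gradient. -/
theorem eLpNorm_translate_sub_le {u : Fn D} (hu : IsL2Loc D u) {g : Fin d → Lp ℝ 2 (leb D)}
    (hg : ∀ i, IsWeakPartial D i u (g i)) (h : EuclideanSpace ℝ (Fin d))
    {K : Set (EuclideanSpace ℝ (Fin d))} (hK : IsCompact K) (hKD : K ⊆ D)
    {U : TopologicalSpace.Opens (EuclideanSpace ℝ (Fin d))}
    (hU : ∀ x ∈ U, ∀ s ∈ Set.Icc (0 : ℝ) 1, x + s • h ∈ K) :
    eLpNorm (fun x => u (x + h) - u x) 2 (leb U) ≤ ENNReal.ofReal ‖∑ i, h i • g i‖ := by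
  obtain ⟨hI, e⟩ := setIntegral_translate_sub_mul (hu.integrableOn hK hKD) h (U := U)
    (fun x hx => by simpa using hU x hx 0 (by simp))
    (fun x hx => by simpa using hU x hx 1 (by simp))
  refine eLpNorm_le_of_abs_integral_test_le U hI (norm_nonneg _) fun φ hφ => ?_
  rw [e φ hφ]
  exact abs_integral_translate_sub_le hu hg h hK hKD hU hφ

end BeppoLevi

end

noncomputable section

namespace BeppoLevi

/-! ### A local Poincaré inequality -/

theorem eLpNorm_two_sq {α : Type*} [MeasurableSpace α] {μ : Measure α} (f : α → ℝ) :
    eLpNorm f 2 μ ^ 2 = ∫⁻ x, ‖f x‖ₑ ^ 2 ∂μ := by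
  have := eLpNorm_nnreal_pow_eq_lintegral (f := f) (μ := μ) (p := 2) two_ne_zero
  simpa using this

theorem eLpNorm_restrict_union_le {α : Type*} [MeasurableSpace α] {μ : Measure α} (f : α → ℝ)
    (s t : Set α) :
    eLpNorm f 2 (μ.restrict (s ∪ t)) ≤
      eLpNorm f 2 (μ.restrict s) + eLpNorm f 2 (μ.restrict t) := by
  rw [← ENNReal.pow_le_pow_left_iff two_ne_zero, eLpNorm_two_sq]
  refine (lintegral_union_le _ s t).trans ?_
  rw [← eLpNorm_two_sq, ← eLpNorm_two_sq, add_sq]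
  gcongr
  exact le_self_add

variable {d : ℕ} {D : TopologicalSpace.Opens (EuclideanSpace ℝ (Fin d))}

theorem norm_sum_smul_weakPartial_le (u : BL D) (h : EuclideanSpace ℝ (Fin d)) :
    ‖∑ i, h i • weakPartial D i (u : Fn D)‖ ≤ d * ‖h‖ * ‖grad D u‖ := by
  refine (norm_sum_le _ _).trans ?_
  have : ∀ i ∈ Finset.univ, ‖h i • weakPartial D i (u : Fn D)‖ ≤ ‖h‖ * ‖grad D u‖ := by
    intro i _
    rw [norm_smul]
    exact mul_le_mul (PiLp.norm_apply_le h i) (PiLp.norm_apply_le (grad D u) i) (norm_nonneg _)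
      (norm_nonneg _)
  refine (Finset.sum_le_sum this).trans_eq ?_
  simp [mul_assoc]

theorem measurable_coeFn (u : Fn D) : Measurable (u : EuclideanSpace ℝ (Fin d) → ℝ) :=
  u.stronglyMeasurable.measurable

theorem lintegral_lintegral_sub_sq_le (u : BL D) {x₀ : EuclideanSpace ℝ (Fin d)} {r : ℝ}
    (hD : Metric.closedBall x₀ r ⊆ D) :
    ∫⁻ y in Metric.ball x₀ r, ∫⁻ x in Metric.ball x₀ r, ‖(u : Fn D) x - (u : Fn D) y‖ₑ ^ 2 ≤
      ENNReal.ofReal (d * (2 * r) * ‖grad D u‖) ^ 2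
        * volume (Metric.ball (0 : EuclideanSpace ℝ (Fin d)) (2 * r)) := by
  set B := Metric.ball x₀ r with hB
  have hBm : MeasurableSet B := Metric.isOpen_ball.measurableSet
  set v : EuclideanSpace ℝ (Fin d) → ℝ := ((u : Fn D) : EuclideanSpace ℝ (Fin d) → ℝ) with hv
  have hvm : Measurable v := measurable_coeFn _
  have e1 : ∫⁻ y in B, ∫⁻ x in B, ‖v x - v y‖ₑ ^ 2
      = ∫⁻ y, ∫⁻ h, (B ∩ (fun y => y + h) ⁻¹' B).indicator
          (fun y => ‖v (y + h) - v y‖ₑ ^ 2) y := by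
    rw [← lintegral_indicator hBm]
    refine lintegral_congr fun y => ?_
    by_cases hy : y ∈ B
    · rw [Set.indicator_of_mem hy, ← lintegral_indicator hBm, ← lintegral_add_left_eq_self _ y]
      refine lintegral_congr fun h => ?_
      by_cases hyh : y + h ∈ B
      · rw [Set.indicator_of_mem hyh, Set.indicator_of_mem (by exact ⟨hy, hyh⟩)]
      · rw [Set.indicator_of_notMem hyh, Set.indicator_of_notMem (fun H => hyh H.2)]
    · rw [Set.indicator_of_notMem hy]
      symm
      rw [lintegral_eq_zero_of_ae_eq_zero]
      exact Eventually.of_forall fun h => Set.indicator_of_notMem (fun H => hy H.1) _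
  have hmeas : Measurable (Function.uncurry fun y h : EuclideanSpace ℝ (Fin d) =>
      (B ∩ (fun y => y + h) ⁻¹' B).indicator (fun y => ‖v (y + h) - v y‖ₑ ^ 2) y) := by
    have hs : MeasurableSet {p : EuclideanSpace ℝ (Fin d) × EuclideanSpace ℝ (Fin d) |
        p.1 ∈ B ∧ p.1 + p.2 ∈ B} :=
      (measurable_fst hBm).inter ((measurable_fst.add measurable_snd) hBm)
    have hf : Measurable fun p : EuclideanSpace ℝ (Fin d) × EuclideanSpace ℝ (Fin d) =>
        ‖v (p.1 + p.2) - v p.1‖ₑ ^ 2 :=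
      (((hvm.comp (measurable_fst.add measurable_snd)).sub (hvm.comp measurable_fst)).enorm).pow_const 2
    exact hf.indicator hs
  rw [e1, lintegral_lintegral_swap hmeas.aemeasurable, ← setLIntegral_const]
  rw [← lintegral_indicator Metric.isOpen_ball.measurableSet]
  refine lintegral_mono fun h => ?_
  have ho : IsOpen (B ∩ (fun y => y + h) ⁻¹' B) :=
    Metric.isOpen_ball.inter (Metric.isOpen_ball.preimage (by fun_prop))
  rw [lintegral_indicator ho.measurableSet]
  by_cases hh : h ∈ Metric.ball (0 : EuclideanSpace ℝ (Fin d)) (2 * r)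
  · rw [Set.indicator_of_mem hh, ← eLpNorm_two_sq (fun y => v (y + h) - v y)]
    gcongr
    refine (eLpNorm_translate_sub_le (U := ⟨_, ho⟩) u.2.1 (weakPartial_spec u.2) h
      (isCompact_closedBall x₀ r) hD ?_).trans ?_
    · rintro x ⟨hx1, hx2⟩ s hs
      refine Metric.ball_subset_closedBall ?_
      have := (convex_ball x₀ r).add_smul_sub_mem hx1 hx2 hs
      simpa using this
    · refine ENNReal.ofReal_le_ofReal ((norm_sum_smul_weakPartial_le u h).trans ?_)
      gcongr
      exact (mem_ball_zero_iff.1 hh).le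
  · have : B ∩ (fun y => y + h) ⁻¹' B = ∅ := by
      ext x
      simp only [Set.mem_inter_iff, Set.mem_preimage, Set.mem_empty_iff_false, iff_false, not_and]
      intro hx1 hx2
      refine hh (mem_ball_zero_iff.2 ?_)
      have h1 := Metric.mem_ball.1 hx1
      have h2 := Metric.mem_ball.1 hx2
      have h3 := dist_triangle_right (x + h) x x₀
      rw [dist_eq_norm, add_sub_cancel_left] at h3
      linarith
    simp [this]

/-- A Poincaré inequality on a ball that is relatively compact in `D`. -/
theorem exists_poincare {x₀ : EuclideanSpace ℝ (Fin d)} {r : ℝ}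
    (hr : 0 < r) (hD : Metric.closedBall x₀ r ⊆ D) :
    ∃ C : ℝ≥0∞, C ≠ ⊤ ∧ ∀ u : BL D, ∃ c : ℝ,
      eLpNorm (fun x => (u : Fn D) x - c) 2 (volume.restrict (Metric.ball x₀ r)) ≤
        C * ‖grad D u‖ₑ := by
  set B := Metric.ball x₀ r with hB
  have hB0 : volume B ≠ 0 := (Metric.measure_ball_pos volume x₀ hr).ne'
  have hBt : volume B ≠ ⊤ := measure_ball_lt_top.ne
  set A : ℝ≥0∞ := ENNReal.ofReal (d * (2 * r)) ^ 2
    * volume (Metric.ball (0 : EuclideanSpace ℝ (Fin d)) (2 * r)) / volume B with hA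
  have hAt : A ≠ ⊤ := ENNReal.div_ne_top
    (ENNReal.mul_ne_top (ENNReal.pow_ne_top ENNReal.ofReal_ne_top) measure_ball_lt_top.ne) hB0
  refine ⟨A ^ (1 / 2 : ℝ), ENNReal.rpow_ne_top_of_nonneg (by norm_num) hAt, fun u => ?_⟩
  have hum := measurable_coeFn (u : Fn D)
  have hm : Measurable fun y => ∫⁻ x in B, ‖(u : Fn D) x - (u : Fn D) y‖ₑ ^ 2 := by
    refine Measurable.lintegral_prod_right' (f := fun p : EuclideanSpace ℝ (Fin d) ×
      EuclideanSpace ℝ (Fin d) => ‖(u : Fn D) p.2 - (u : Fn D) p.1‖ₑ ^ 2) ?_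
    exact (((hum.comp measurable_snd).sub (hum.comp measurable_fst)).enorm).pow_const 2
  obtain ⟨y, -, hy⟩ := exists_le_setLAverage hB0 hBt hm.aemeasurable
  refine ⟨(u : Fn D) y, ?_⟩
  rw [← ENNReal.pow_le_pow_left_iff two_ne_zero, eLpNorm_two_sq, mul_pow]
  refine hy.trans ?_
  rw [setLAverage_eq]
  have e : (A ^ (1 / 2 : ℝ)) ^ 2 = A := by
    rw [← ENNReal.rpow_natCast, ← ENNReal.rpow_mul]
    norm_num
  rw [e, hA, ← ENNReal.mul_div_right_comm]
  gcongr
  refine (lintegral_lintegral_sub_sq_le u hD).trans_eq ?_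
  rw [ENNReal.ofReal_mul (by positivity), ofReal_norm, mul_pow]
  ring

/-! ### Local `L²` convergence -/

theorem cauchySeq_iff_tendsto_edist {X : Type*} [PseudoMetricSpace X] {c : ℕ → X} :
    CauchySeq c ↔ Tendsto (fun p : ℕ × ℕ => edist (c p.1) (c p.2)) atTop (𝓝 0) := by
  rw [cauchySeq_iff_tendsto_dist_atTop_0]
  constructor
  · intro h
    simpa [edist_dist] using ENNReal.tendsto_ofReal h
  · intro h
    simpa [edist_dist, Function.comp_def] using
      (ENNReal.tendsto_toReal ENNReal.zero_ne_top).comp h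

/-- The sequence `w` is Cauchy in the `L²` seminorm on `s`. -/
def L2CauchyOn (s : Set (EuclideanSpace ℝ (Fin d))) (w : ℕ → EuclideanSpace ℝ (Fin d) → ℝ) :
    Prop :=
  Tendsto (fun p : ℕ × ℕ => eLpNorm (w p.1 - w p.2) 2 (volume.restrict s)) atTop (𝓝 0)

theorem L2CauchyOn.mono {s t : Set (EuclideanSpace ℝ (Fin d))}
    {w : ℕ → EuclideanSpace ℝ (Fin d) → ℝ} (h : L2CauchyOn t w) (hst : s ⊆ t) : L2CauchyOn s w :=
  tendsto_of_tendsto_of_tendsto_of_le_of_le tendsto_const_nhds h (fun _ => zero_le)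
    fun _ => eLpNorm_mono_measure _ (Measure.restrict_mono hst le_rfl)

theorem L2CauchyOn.union {s t : Set (EuclideanSpace ℝ (Fin d))}
    {w : ℕ → EuclideanSpace ℝ (Fin d) → ℝ} (hs : L2CauchyOn s w) (ht : L2CauchyOn t w) :
    L2CauchyOn (s ∪ t) w :=
  tendsto_of_tendsto_of_tendsto_of_le_of_le tendsto_const_nhds (by simpa using hs.add ht)
    (fun _ => zero_le) fun _ => eLpNorm_restrict_union_le _ s t

theorem L2CauchyOn.add {s : Set (EuclideanSpace ℝ (Fin d))}
    {w z : ℕ → EuclideanSpace ℝ (Fin d) → ℝ} (hwm : ∀ n, Measurable (w n))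
    (hzm : ∀ n, Measurable (z n)) (hw : L2CauchyOn s w) (hz : L2CauchyOn s z) :
    L2CauchyOn s (fun n => w n + z n) := by
  refine tendsto_of_tendsto_of_tendsto_of_le_of_le tendsto_const_nhds
    (by simpa using Tendsto.add hw hz) (fun _ => zero_le) fun p => ?_
  rw [add_sub_add_comm]
  exact eLpNorm_add_le ((hwm _).sub (hwm _)).aestronglyMeasurable
    ((hzm _).sub (hzm _)).aestronglyMeasurable one_le_two

theorem L2CauchyOn.neg {s : Set (EuclideanSpace ℝ (Fin d))}
    {w : ℕ → EuclideanSpace ℝ (Fin d) → ℝ} (hw : L2CauchyOn s w) :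
    L2CauchyOn s (fun n => - w n) := by
  refine hw.congr fun p => ?_
  rw [← eLpNorm_neg, neg_sub', sub_neg_eq_add]

theorem l2CauchyOn_const_iff {s : Set (EuclideanSpace ℝ (Fin d))} (hs0 : volume s ≠ 0)
    (hs : volume s ≠ ⊤) (c : ℕ → ℝ) : L2CauchyOn s (fun n _ => c n) ↔ CauchySeq c := by
  have e : ∀ p : ℕ × ℕ, eLpNorm ((fun _ => c p.1) - (fun _ => c p.2)) 2 (volume.restrict s)
      = edist (c p.1) (c p.2) * volume s ^ (1 / 2 : ℝ) := by
    intro p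
    have := eLpNorm_const' (μ := volume.restrict s) (p := 2) (c p.1 - c p.2) (by simp) (by simp)
    rw [Measure.restrict_apply_univ, ← edist_eq_enorm_sub] at this
    simpa [Pi.sub_def] using this
  unfold L2CauchyOn
  simp_rw [e]
  have ha0 : volume s ^ (1 / 2 : ℝ) ≠ 0 := by
    simp [ENNReal.rpow_eq_zero_iff, hs0]
  have hat : volume s ^ (1 / 2 : ℝ) ≠ ⊤ := ENNReal.rpow_ne_top_of_nonneg (by norm_num) hs
  rw [cauchySeq_iff_tendsto_edist]
  constructor
  · intro h
    have := ENNReal.Tendsto.mul_const (b := (volume s ^ (1 / 2 : ℝ))⁻¹) h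
      (Or.inr (ENNReal.inv_ne_top.2 ha0))
    simp_rw [mul_assoc, ENNReal.mul_inv_cancel ha0 hat] at this
    simpa using this
  · intro h
    simpa using ENNReal.Tendsto.mul_const h (Or.inr hat)

end BeppoLevi

end

noncomputable section

namespace BeppoLevi

variable {d : ℕ} {D : TopologicalSpace.Opens (EuclideanSpace ℝ (Fin d))}

theorem tendsto_enorm_grad_sub {u : ℕ → BL D} (hu : CauchySeq fun n => grad D (u n)) :
    Tendsto (fun p : ℕ × ℕ => ‖grad D (u p.1 - u p.2)‖ₑ) atTop (𝓝 0) := by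
  rw [cauchySeq_iff_tendsto_edist] at hu
  refine hu.congr fun p => ?_
  rw [map_sub, edist_eq_enorm_sub]

/-- On a ball, a sequence with Cauchy gradients is Cauchy up to constants. -/
theorem exists_l2CauchyOn_ball {u : ℕ → BL D} (hu : CauchySeq fun n => grad D (u n))
    {x₀ : EuclideanSpace ℝ (Fin d)} {r : ℝ} (hr : 0 < r) (hD : Metric.closedBall x₀ r ⊆ D) :
    ∃ c : ℕ → ℝ, L2CauchyOn (Metric.ball x₀ r) (fun n x => (u n : Fn D) x - c n) := by
  obtain ⟨C, hC, hP⟩ := exists_poincare hr hD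
  set μ := volume.restrict (Metric.ball x₀ r) with hμ
  have : IsFiniteMeasure μ := ⟨by rw [hμ, Measure.restrict_apply_univ]; exact measure_ball_lt_top⟩
  have hmem : ∀ v : BL D, MemLp (v : Fn D) 2 μ := fun v =>
    (v.2.1 _ (isCompact_closedBall x₀ r) hD).mono_measure
      (Measure.restrict_mono Metric.ball_subset_closedBall le_rfl)
  let one : Lp ℝ 2 μ := Lp.const 2 μ (1 : ℝ)
  let V : Submodule ℝ (Lp ℝ 2 μ) := Submodule.span ℝ {one}
  have hex : ∀ n, ∃ c : ℝ, c • one = V.starProjection ((hmem (u n)).toLp _) := fun n =>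
    Submodule.mem_span_singleton.1 (Submodule.starProjection_apply_mem V _)
  choose c hc using hex
  refine ⟨c, ?_⟩
  have hsmul : ∀ a : ℝ, ∀ᵐ x ∂μ, (a • one) x = a := by
    intro a
    filter_upwards [Lp.coeFn_smul a one, Lp.coeFn_const (p := 2) (μ := μ) (1 : ℝ)] with x h1 h2
    rw [h1, Pi.smul_apply, show one x = 1 from h2, smul_eq_mul, mul_one]
  have hQ : ∀ f : Lp ℝ 2 μ, ∀ a : ℝ, ‖f - V.starProjection f‖ₑ ≤ ‖f - a • one‖ₑ := by
    intro f a
    have hb : BddBelow (Set.range fun x : V => ‖f - x‖) := ⟨0, by rintro _ ⟨x, rfl⟩; positivity⟩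
    have h1 := ciInf_le hb ⟨a • one, Submodule.smul_mem _ _ (Submodule.mem_span_singleton_self one)⟩
    rw [← Submodule.starProjection_minimal] at h1
    rw [← ofReal_norm, ← ofReal_norm]
    exact ENNReal.ofReal_le_ofReal h1
  refine tendsto_of_tendsto_of_tendsto_of_le_of_le (h := fun p : ℕ × ℕ =>
    C * ‖grad D (u p.1 - u p.2)‖ₑ) tendsto_const_nhds ?_ (fun _ => zero_le) fun p => ?_
  · simpa using ENNReal.Tendsto.const_mul (tendsto_enorm_grad_sub hu) (Or.inr hC)
  obtain ⟨a, ha⟩ := hP (u p.1 - u p.2)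
  refine le_trans (le_trans (le_of_eq ?_) (hQ ((hmem (u p.1)).toLp _ - (hmem (u p.2)).toLp _) a))
    (le_trans (le_of_eq ?_) ha)
  · rw [map_sub, ← hc, ← hc, Lp.enorm_def]
    refine eLpNorm_congr_ae ?_
    filter_upwards [hsmul (c p.1), hsmul (c p.2), (hmem (u p.1)).coeFn_toLp,
      (hmem (u p.2)).coeFn_toLp, Lp.coeFn_sub ((hmem (u p.1)).toLp _) ((hmem (u p.2)).toLp _),
      Lp.coeFn_sub (c p.1 • one) (c p.2 • one),
      Lp.coeFn_sub ((hmem (u p.1)).toLp _ - (hmem (u p.2)).toLp _) (c p.1 • one - c p.2 • one)]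
      with x h1 h2 h3 h4 h5 h6 h7
    simp only [Pi.sub_apply] at h5 h6 h7 ⊢
    rw [h7, h5, h6, h1, h2, h3, h4]
    ring
  · rw [Lp.enorm_def]
    refine eLpNorm_congr_ae ?_
    have hs : ∀ᵐ x ∂μ, ((u p.1 - u p.2 : BL D) : Fn D) x = (u p.1 : Fn D) x - (u p.2 : Fn D) x :=
      ae_restrict_of_subset (Metric.ball_subset_closedBall.trans hD)
        (AEEqFun.coeFn_sub (u p.1 : Fn D) (u p.2 : Fn D))
    filter_upwards [hsmul a, (hmem (u p.1)).coeFn_toLp, hs,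
      (hmem (u p.2)).coeFn_toLp, Lp.coeFn_sub ((hmem (u p.1)).toLp _) ((hmem (u p.2)).toLp _),
      Lp.coeFn_sub ((hmem (u p.1)).toLp _ - (hmem (u p.2)).toLp _) (a • one)]
      with x h1 h2 h3 h4 h5 h6
    simp only [Pi.sub_apply] at h5 h6 ⊢
    rw [h6, h5, h1, h2, h3, h4]

/-- On a connected open set, a sequence with Cauchy gradients is locally Cauchy in `L²` after
subtraction of one sequence of constants. -/
theorem exists_l2CauchyOn_compact (hD : IsConnected (D : Set (EuclideanSpace ℝ (Fin d))))
    {u : ℕ → BL D} (hu : CauchySeq fun n => grad D (u n)) :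
    ∃ c : ℕ → ℝ, ∀ K : Set (EuclideanSpace ℝ (Fin d)), IsCompact K → K ⊆ D →
      L2CauchyOn K (fun n x => (u n : Fn D) x - c n) := by
  have hball : ∀ x ∈ D, ∃ r > 0, Metric.closedBall x r ⊆ D := fun x hx =>
    Metric.nhds_basis_closedBall.mem_iff.1 (D.isOpen.mem_nhds hx)
  obtain ⟨x₀, hx₀⟩ := hD.nonempty
  obtain ⟨r₀, hr₀, hB₀⟩ := hball x₀ hx₀
  obtain ⟨c, hc⟩ := exists_l2CauchyOn_ball hu hr₀ hB₀
  refine ⟨c, ?_⟩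
  set w : ℕ → EuclideanSpace ℝ (Fin d) → ℝ := fun n x => (u n : Fn D) x - c n with hw
  let G : Set (EuclideanSpace ℝ (Fin d)) := {x | ∃ r > 0, L2CauchyOn (Metric.ball x r) w}
  have hGo : IsOpen G := by
    rw [Metric.isOpen_iff]
    rintro x ⟨r, hr, hx⟩
    refine ⟨r / 2, by positivity, fun y hy => ⟨r / 2, by positivity, hx.mono ?_⟩⟩
    refine Metric.ball_subset_ball' ?_
    have := Metric.mem_ball.1 hy
    linarith
  have hsub : (D : Set (EuclideanSpace ℝ (Fin d))) ⊆ G := by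
    refine hD.isPreconnected.subset_of_closure_inter_subset hGo ⟨x₀, hx₀, r₀, hr₀, hc⟩ ?_
    rintro x ⟨hxc, hxD⟩
    obtain ⟨r, hr, hB⟩ := hball x hxD
    obtain ⟨a, ha⟩ := exists_l2CauchyOn_ball hu hr hB
    obtain ⟨y, hyB, ⟨s, hs, hy⟩⟩ := mem_closure_iff.1 hxc _ Metric.isOpen_ball
      (Metric.mem_ball_self hr)
    have ho : IsOpen (Metric.ball x r ∩ Metric.ball y s) :=
      Metric.isOpen_ball.inter Metric.isOpen_ball
    have hm1 : ∀ n, Measurable (fun x => (u n : Fn D) x - a n) := fun n =>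
      (measurable_coeFn _).sub_const _
    have hm2 : ∀ n, Measurable (w n) := fun n => (measurable_coeFn _).sub_const _
    have h1 := (ha.mono (Set.inter_subset_left (t := Metric.ball y s))).add hm1
      (fun n => (hm2 n).neg) (hy.mono Set.inter_subset_right).neg
    have h2 : CauchySeq fun n => c n - a n := by
      rw [← l2CauchyOn_const_iff (ho.measure_pos volume ⟨y, hyB, Metric.mem_ball_self hs⟩).ne'
        ((measure_mono Set.inter_subset_left).trans_lt measure_ball_lt_top).ne]
      convert h1 using 2 with n
      ext x
      simp [hw]
    have h3 := (h2.neg).comp_tendsto tendsto_id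
    rw [← l2CauchyOn_const_iff (Metric.measure_ball_pos volume x hr).ne'
      measure_ball_lt_top.ne] at h3
    refine ⟨r, hr, ?_⟩
    have h4 := ha.add hm1 (fun _ => measurable_const) h3
    convert h4 using 2 with n
    ext x
    simp [hw]
  intro K hK hKD
  refine hK.induction_on (p := fun s => L2CauchyOn s w) ?_ (fun s t hst ht => ht.mono hst)
    (fun s t hs ht => hs.union ht) fun x hx => ?_
  · simp [L2CauchyOn]
  · obtain ⟨r, hr, h⟩ := hsub (hKD hx)
    exact ⟨_, mem_nhdsWithin_of_mem_nhds (Metric.ball_mem_nhds x hr), h⟩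

variable (D) in
/-- Convergence in `L²_loc(D)`. -/
def L2LocTendsto (w : ℕ → Fn D) (v : Fn D) : Prop :=
  ∀ K : Set (EuclideanSpace ℝ (Fin d)), IsCompact K → K ⊆ D →
    Tendsto (fun n => eLpNorm (fun x => w n x - v x) 2 (volume.restrict K)) atTop (𝓝 0)

variable (D) in
theorem exists_compact_exhaustion : ∃ K : ℕ → Set (EuclideanSpace ℝ (Fin d)),
    (∀ j, IsCompact (K j)) ∧ (∀ j, K j ⊆ D) ∧ Monotone K ∧ (∀ x ∈ D, ∃ j, x ∈ K j) ∧
      ∀ L : Set (EuclideanSpace ℝ (Fin d)), IsCompact L → L ⊆ D → ∃ j, L ⊆ K j := by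
  have : LocallyCompactSpace D := D.isOpen.locallyCompactSpace
  let X : CompactExhaustion D := default
  refine ⟨fun j => (↑) '' X j, fun j => (X.isCompact j).image continuous_subtype_val, ?_, ?_, ?_,
    ?_⟩
  · rintro j _ ⟨x, -, rfl⟩
    exact x.2
  · exact fun i j hij => Set.image_mono (X.subset hij)
  · intro x hx
    obtain ⟨j, hj⟩ := X.exists_mem ⟨x, hx⟩
    exact ⟨j, ⟨x, hx⟩, hj, rfl⟩
  · intro L hL hLD
    have hL' : IsCompact ((↑) ⁻¹' L : Set D) := by
      rw [Subtype.isCompact_iff]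
      have e : (Subtype.val '' ((↑) ⁻¹' L : Set D) : Set (EuclideanSpace ℝ (Fin d))) = L :=
        Set.image_preimage_eq_of_subset (by simpa using hLD)
      rwa [e]
    obtain ⟨j, hj⟩ := X.exists_superset_of_isCompact hL'
    exact ⟨j, fun x hx => ⟨⟨x, hLD hx⟩, hj hx, rfl⟩⟩

theorem ae_leb_of_compact {p : EuclideanSpace ℝ (Fin d) → Prop}
    (h : ∀ K : Set (EuclideanSpace ℝ (Fin d)), IsCompact K → K ⊆ D →
      ∀ᵐ x ∂(volume.restrict K), p x) : ∀ᵐ x ∂(leb D), p x := by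
  obtain ⟨K, hK, hKD, -, hcov, -⟩ := exists_compact_exhaustion D
  have hD : (D : Set (EuclideanSpace ℝ (Fin d))) = ⋃ j, K j :=
    subset_antisymm (fun x hx => Set.mem_iUnion.2 (hcov x hx)) (Set.iUnion_subset hKD)
  rw [leb, hD, ae_restrict_iUnion_iff]
  exact fun j => h _ (hK j) (hKD j)

theorem L2LocTendsto.exists_subseq {w : ℕ → Fn D} {v : Fn D} (h : L2LocTendsto D w v) :
    ∃ ns : ℕ → ℕ, StrictMono ns ∧
      ∀ᵐ x ∂(leb D), Tendsto (fun k => w (ns k) x) atTop (𝓝 (v x)) := by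
  obtain ⟨K, hK, hKD, hmono, hcov, hsup⟩ := exists_compact_exhaustion D
  have hpos : ∀ k : ℕ, (0 : ℝ≥0∞) < 2⁻¹ ^ k := fun k => by
    refine pos_iff_ne_zero.2 (pow_ne_zero _ (by simp))
  obtain ⟨ns, hns, hlt⟩ := extraction_forall_of_eventually fun k =>
    (h (K k) (hK k) (hKD k)).eventually_lt_const (hpos k)
  refine ⟨ns, hns, ae_leb_of_compact fun L hL hLD => ?_⟩
  obtain ⟨j, hj⟩ := hsup L hL hLD
  have hm : ∀ k, AEMeasurable (fun x => ‖w (ns k) x - v x‖ₑ ^ 2) (volume.restrict (K j)) :=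
    fun k => (((measurable_coeFn _).sub (measurable_coeFn _)).enorm.pow_const 2).aemeasurable
  have hfin : ∫⁻ x in K j, ∑' k, ‖w (ns (k + j)) x - v x‖ₑ ^ 2 ≠ ⊤ := by
    rw [lintegral_tsum fun k => hm (k + j)]
    refine ne_top_of_le_ne_top (b := ∑' k : ℕ, (2⁻¹ : ℝ≥0∞) ^ k) ?_ ?_
    · rw [ENNReal.tsum_geometric]
      simp [ENNReal.one_sub_inv_two]
    · refine ENNReal.tsum_le_tsum fun k => ?_
      rw [← eLpNorm_two_sq fun x => w (ns (k + j)) x - v x]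
      have h1 : eLpNorm (fun x => w (ns (k + j)) x - v x) 2 (volume.restrict (K j))
          ≤ 2⁻¹ ^ k :=
        (eLpNorm_mono_measure _ (Measure.restrict_mono (hmono (Nat.le_add_left j k)) le_rfl)).trans
          ((hlt (k + j)).le.trans (pow_le_pow_right_of_le_one' (by simp) (Nat.le_add_right k j)))
      calc _ ≤ ((2⁻¹ : ℝ≥0∞) ^ k) ^ 2 := by gcongr
        _ = 2⁻¹ ^ (k * 2) := (pow_mul _ _ _).symm
        _ ≤ 2⁻¹ ^ k := pow_le_pow_right_of_le_one' (by simp) (by omega)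
  have hae := ae_lt_top' (AEMeasurable.tsum fun k => hm (k + j)) hfin
  have hae' : ∀ᵐ x ∂(volume.restrict L), ∑' k, ‖w (ns (k + j)) x - v x‖ₑ ^ 2 < ⊤ :=
    ae_mono (Measure.restrict_mono hj le_rfl) hae
  filter_upwards [hae'] with x hx
  have h1 := ENNReal.tendsto_atTop_zero_of_tsum_ne_top hx.ne
  have h2 : Tendsto (fun k => ‖w (ns (k + j)) x - v x‖ₑ) atTop (𝓝 0) := by
    have h3 := (ENNReal.continuous_rpow_const (y := (1 / 2 : ℝ))).tendsto 0 |>.comp h1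
    simp only [Function.comp_def, ← ENNReal.rpow_natCast, ← ENNReal.rpow_mul] at h3
    simpa using h3
  have h3 : Tendsto (fun k => w (ns (k + j)) x) atTop (𝓝 (v x)) := by
    rw [tendsto_iff_edist_tendsto_0]
    simpa [edist_eq_enorm_sub] using h2
  exact (tendsto_add_atTop_iff_nat (f := fun k => w (ns k) x) j).1 h3

theorem L2LocTendsto.ae_eq {w : ℕ → Fn D} {v u : Fn D} (h : L2LocTendsto D w v)
    (hu : ∀ᵐ x ∂(leb D), Tendsto (fun n => w n x) atTop (𝓝 (u x))) : u = v := by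
  obtain ⟨ns, hns, hv⟩ := h.exists_subseq
  refine AEEqFun.ext ?_
  filter_upwards [hu, hv] with x h1 h2
  exact tendsto_nhds_unique (h1.comp hns.tendsto_atTop) h2

theorem exists_l2LocTendsto {w : ℕ → Fn D} (hw : ∀ n, IsL2Loc D (w n))
    (hc : ∀ K : Set (EuclideanSpace ℝ (Fin d)), IsCompact K → K ⊆ D →
      L2CauchyOn K (fun n => w n)) : ∃ v : Fn D, IsL2Loc D v ∧ L2LocTendsto D w v := by
  obtain ⟨K, hK, hKD, hmono, hcov, hsup⟩ := exists_compact_exhaustion D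
  have hlim : ∀ j, ∃ b : Lp ℝ 2 (volume.restrict (K j)),
      Tendsto (fun n => eLpNorm (fun x => w n x - b x) 2 (volume.restrict (K j))) atTop (𝓝 0) := by
    intro j
    let a : ℕ → Lp ℝ 2 (volume.restrict (K j)) := fun n => (hw n (K j) (hK j) (hKD j)).toLp _
    have ha : ∀ n, a n =ᵐ[volume.restrict (K j)] w n := fun n => MemLp.coeFn_toLp _
    have hca : CauchySeq a := by
      rw [cauchySeq_iff_tendsto_edist]
      refine (hc (K j) (hK j) (hKD j)).congr fun p => ?_
      rw [Lp.edist_def]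
      exact eLpNorm_congr_ae ((ha p.1).sub (ha p.2)).symm
    obtain ⟨b, hb⟩ := cauchySeq_tendsto_of_complete hca
    refine ⟨b, ?_⟩
    rw [tendsto_iff_edist_tendsto_0] at hb
    refine hb.congr fun n => ?_
    rw [Lp.edist_def]
    exact eLpNorm_congr_ae ((ha n).sub (EventuallyEq.refl _ _))
  choose b hb using hlim
  have hbm : ∀ j, Measurable (b j) := fun j => (Lp.stronglyMeasurable _).measurable
  have heq : ∀ j k, j ≤ k → ∀ᵐ x ∂(volume.restrict (K j)), b k x = b j x := by
    intro j k hjk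
    have h1 : Tendsto (fun n => eLpNorm (fun x => w n x - b j x) 2 (volume.restrict (K j))
        + eLpNorm (fun x => w n x - b k x) 2 (volume.restrict (K k))) atTop (𝓝 0) := by
      simpa using (hb j).add (hb k)
    have h2 : eLpNorm (fun x => b k x - b j x) 2 (volume.restrict (K j)) ≤ 0 := by
      refine ge_of_tendsto' h1 fun n => ?_
      have e : (fun x => b k x - b j x)
          = (fun x => w n x - b j x) - (fun x => w n x - b k x) := by
        ext x
        simp
      rw [e]
      refine (eLpNorm_sub_le ((measurable_coeFn _).sub (hbm j)).aestronglyMeasurable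
        ((measurable_coeFn _).sub (hbm k)).aestronglyMeasurable one_le_two).trans ?_
      exact add_le_add le_rfl
        (eLpNorm_mono_measure _ (Measure.restrict_mono (hmono hjk) le_rfl))
    have h3 := (eLpNorm_eq_zero_iff ((hbm k).sub (hbm j)).aestronglyMeasurable two_ne_zero).1
      (nonpos_iff_eq_zero.1 h2)
    filter_upwards [h3] with x hx
    simpa [sub_eq_zero] using hx
  have hall : ∀ j, ∀ᵐ x ∂(volume.restrict (K j)), ∀ k, j ≤ k → b k x = b j x := fun j =>
    ae_all_iff.2 fun k => by
      by_cases hjk : j ≤ k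
      · filter_upwards [heq j k hjk] with x hx _
        exact hx
      · exact Eventually.of_forall fun x h => absurd h hjk
  have hex : ∀ᵐ x ∂(leb D), ∃ l : ℝ, Tendsto (fun k => b k x) atTop (𝓝 l) := by
    refine ae_leb_of_compact fun L hL hLD => ?_
    obtain ⟨j, hj⟩ := hsup L hL hLD
    filter_upwards [ae_mono (Measure.restrict_mono hj le_rfl) (hall j)] with x hx
    exact ⟨b j x, tendsto_atTop_of_eventually_const hx⟩
  obtain ⟨f, hf, hfl⟩ := exists_stronglyMeasurable_limit_of_tendsto_ae
    (fun k => (hbm k).aestronglyMeasurable) hex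
  let v : Fn D := AEEqFun.mk f hf.aestronglyMeasurable
  have hv : ∀ᵐ x ∂(leb D), v x = f x := AEEqFun.coeFn_mk f _
  have hvb : ∀ j, ∀ᵐ x ∂(volume.restrict (K j)), v x = b j x := by
    intro j
    filter_upwards [hall j, ae_restrict_of_subset (hKD j) hv, ae_restrict_of_subset (hKD j) hfl]
      with x h1 h2 h3
    rw [h2]
    exact tendsto_nhds_unique h3 (tendsto_atTop_of_eventually_const h1)
  refine ⟨v, fun L hL hLD => ?_, fun L hL hLD => ?_⟩
  · obtain ⟨j, hj⟩ := hsup L hL hLD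
    exact ((Lp.memLp (b j)).ae_eq (EventuallyEq.symm (hvb j))).mono_measure
      (Measure.restrict_mono hj le_rfl)
  · obtain ⟨j, hj⟩ := hsup L hL hLD
    refine tendsto_of_tendsto_of_tendsto_of_le_of_le tendsto_const_nhds (hb j)
      (fun _ => zero_le) fun n => ?_
    refine (eLpNorm_mono_measure _ (Measure.restrict_mono hj le_rfl)).trans_eq ?_
    refine eLpNorm_congr_ae ?_
    filter_upwards [hvb j] with x hx
    rw [hx]

end BeppoLevi

end

noncomputable section

namespace BeppoLevi

/-! ### Sequences with convergent gradients -/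

theorem abs_integral_mul_le_eLpNorm {α : Type*} [MeasurableSpace α] {μ : Measure α} {f g : α → ℝ}
    (hf : MemLp f 2 μ) (hg : MemLp g 2 μ) :
    |∫ x, f x * g x ∂μ| ≤ (eLpNorm f 2 μ).toReal * (eLpNorm g 2 μ).toReal := by
  have h := abs_real_inner_le_norm (hf.toLp f) (hg.toLp g)
  rw [Lp.norm_toLp, Lp.norm_toLp, L2.inner_def] at h
  convert h using 2
  refine integral_congr_ae ?_
  filter_upwards [hf.coeFn_toLp, hg.coeFn_toLp] with x h1 h2
  rw [h1, h2]
  simp [mul_comm]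

variable {d : ℕ} {D : TopologicalSpace.Opens (EuclideanSpace ℝ (Fin d))}

theorem L2LocTendsto.tendsto_integral_mul {w : ℕ → Fn D} {v : Fn D} (h : L2LocTendsto D w v)
    (hw : ∀ n, IsL2Loc D (w n)) (hv : IsL2Loc D v) {K : Set (EuclideanSpace ℝ (Fin d))}
    (hK : IsCompact K) (hKD : K ⊆ D) {ψ : EuclideanSpace ℝ (Fin d) → ℝ}
    (hψ : MemLp ψ 2 (volume.restrict K)) (h0 : ∀ x ∉ K, ψ x = 0) :
    Tendsto (fun n => ∫ x in D, w n x * ψ x) atTop (𝓝 (∫ x in D, v x * ψ x)) := by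
  have e : ∀ z : Fn D, ∫ x in D, z x * ψ x = ∫ x in K, z x * ψ x := fun z =>
    (setIntegral_eq_of_support_subset hKD fun x hx => by rw [h0 x hx, mul_zero]).symm
  simp_rw [e]
  have hi : ∀ z : Fn D, IsL2Loc D z → Integrable (fun x => z x * ψ x) (volume.restrict K) :=
    fun z hz => (hz K hK hKD).integrable_mul hψ
  rw [tendsto_iff_norm_sub_tendsto_zero]
  have h1 : Tendsto (fun n => (eLpNorm (fun x => w n x - v x) 2 (volume.restrict K)).toReal
      * (eLpNorm ψ 2 (volume.restrict K)).toReal) atTop (𝓝 0) := by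
    have := (ENNReal.tendsto_toReal ENNReal.zero_ne_top).comp (h K hK hKD)
    simpa using this.mul_const _
  refine squeeze_zero (fun _ => norm_nonneg _) (fun n => ?_) h1
  rw [← integral_sub (hi _ (hw n)) (hi _ hv), Real.norm_eq_abs]
  simp_rw [← sub_mul]
  exact abs_integral_mul_le_eLpNorm ((hw n K hK hKD).sub (hv K hK hKD)) hψ

theorem IsWeakPartial.of_tendsto {i : Fin d} {w : ℕ → Fn D} {v : Fn D} (h : L2LocTendsto D w v)
    (hw : ∀ n, IsL2Loc D (w n)) (hv : IsL2Loc D v) {g : ℕ → Lp ℝ 2 (leb D)} {g' : Lp ℝ 2 (leb D)}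
    (hwg : ∀ n, IsWeakPartial D i (w n) (g n)) (hg : Tendsto g atTop (𝓝 g')) :
    IsWeakPartial D i v g' := by
  intro φ hφ
  have hc : HasCompactSupport (pd i φ) :=
    HasCompactSupport.intro hφ.compact.isCompact fun _ hx => pd_eq_zero i hx
  have h1 := h.tendsto_integral_mul hw hv hφ.compact.isCompact hφ.supp
    (((hφ.pd_continuous i).memLp_of_hasCompactSupport hc).restrict _)
    (fun x hx => pd_eq_zero i hx)
  have h2 : Tendsto (fun n => - ∫ x in D, g n x * φ x) atTop (𝓝 (- ∫ x in D, g' x * φ x)) := by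
    simp_rw [← inner_testToLp _ ⟨φ, hφ⟩]
    exact (hg.inner tendsto_const_nhds).neg
  refine tendsto_nhds_unique h1 (h2.congr fun n => (hwg n φ hφ).symm)

theorem const_mem_BL (c : ℝ) : (AEEqFun.const _ c : Fn D) ∈ BL D := by
  refine ⟨fun K hK hKD => ?_, fun i => ⟨0, isWeakPartial_const i c⟩⟩
  have : IsFiniteMeasure (volume.restrict K) :=
    ⟨by rw [Measure.restrict_apply_univ]; exact hK.measure_lt_top⟩
  exact (memLp_const c).ae_eq (EventuallyEq.symm
    (ae_restrict_of_subset hKD (AEEqFun.coeFn_const _ c)))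

variable (D) in
/-- The constant function `c` as an element of `BL(D)`. -/
def constBL (c : ℝ) : BL D := ⟨AEEqFun.const _ c, const_mem_BL c⟩

theorem grad_constBL (c : ℝ) : grad D (constBL D c) = 0 := by
  ext1 i
  exact weakPartial_eq (const_mem_BL c) (isWeakPartial_const i c)

theorem coeFn_sub_constBL (u : BL D) (c : ℝ) :
    ∀ᵐ x ∂(leb D), ((u - constBL D c : BL D) : Fn D) x = (u : Fn D) x - c := by
  filter_upwards [AEEqFun.coeFn_sub (u : Fn D) (AEEqFun.const _ c),
    AEEqFun.coeFn_const (μ := leb D) _ c] with x h1 h2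
  rw [show ((u - constBL D c : BL D) : Fn D) x = _ from h1, Pi.sub_apply, h2,
    Function.const_apply]

theorem exists_grad_eq_of_l2LocTendsto {u : ℕ → BL D} {v : Fn D} (hv : IsL2Loc D v)
    (h : L2LocTendsto D (fun n => (u n : Fn D)) v)
    {G : PiLp 2 (fun _ : Fin d => Lp ℝ 2 (leb D))}
    (hG : Tendsto (fun n => grad D (u n)) atTop (𝓝 G)) :
    ∃ hv : v ∈ BL D, grad D ⟨v, hv⟩ = G := by
  have hw : ∀ i, IsWeakPartial D i v (G i) := fun i => by
    refine IsWeakPartial.of_tendsto h (fun n => (u n).2.1) hv (g := fun n => grad D (u n) i)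
      (fun n => weakPartial_spec (u n).2 i) ?_
    exact ((PiLp.continuous_apply 2 _ i).tendsto G).comp hG
  have hv' : v ∈ BL D := ⟨hv, fun i => ⟨_, hw i⟩⟩
  refine ⟨hv', ?_⟩
  ext1 i
  exact weakPartial_eq hv' (hw i)

/-- If the gradients of a sequence in `BL(D)` are Cauchy, then the sequence converges in
`L²_loc(D)`, together with its gradients, after subtraction of suitable constants. -/
theorem exists_tendsto_sub_const (hD : IsConnected (D : Set (EuclideanSpace ℝ (Fin d))))
    {u : ℕ → BL D} (hu : CauchySeq fun n => grad D (u n)) :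
    ∃ (c : ℕ → ℝ) (v : BL D), L2LocTendsto D (fun n => ((u n - constBL D (c n) : BL D) : Fn D)) v ∧
      Tendsto (fun n => grad D (u n)) atTop (𝓝 (grad D v)) := by
  obtain ⟨c, hc⟩ := exists_l2CauchyOn_compact hD hu
  obtain ⟨v, hv, hlim⟩ := exists_l2LocTendsto
    (w := fun n => ((u n - constBL D (c n) : BL D) : Fn D))
    (fun n => (u n - constBL D (c n)).2.1) (fun K hK hKD => by
      refine (hc K hK hKD).congr fun p => eLpNorm_congr_ae ?_
      filter_upwards [ae_restrict_of_subset hKD (coeFn_sub_constBL (u p.1) (c p.1)),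
        ae_restrict_of_subset hKD (coeFn_sub_constBL (u p.2) (c p.2))] with x h1 h2
      simp only [Pi.sub_apply]
      rw [h1, h2])
  obtain ⟨G, hG⟩ := cauchySeq_tendsto_of_complete hu
  obtain ⟨hv', hgv⟩ := exists_grad_eq_of_l2LocTendsto hv hlim (G := G)
    (by simpa [map_sub, grad_constBL] using hG)
  exact ⟨c, ⟨v, hv'⟩, hlim, by rwa [hgv]⟩

theorem leb_ne_zero (hD : (D : Set (EuclideanSpace ℝ (Fin d))).Nonempty) : leb D ≠ 0 := by
  rw [Ne, Measure.restrict_eq_zero]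
  exact (D.isOpen.measure_pos volume hD).ne'

theorem eq_const_of_grad_eq_zero (hD : IsConnected (D : Set (EuclideanSpace ℝ (Fin d))))
    (u : BL D) (hu : grad D u = 0) : ∃ c : ℝ, (u : Fn D) = AEEqFun.const _ c := by
  let s : ℕ → BL D := fun n => if Even n then u else 0
  have hs : ∀ n, grad D (s n) = 0 := by
    intro n
    by_cases h : Even n <;> simp [s, h, hu]
  obtain ⟨c, hc⟩ := exists_l2CauchyOn_compact hD (u := s) (by
    simp_rw [hs]
    exact cauchySeq_const 0)
  let b : ℕ → ℝ := fun k => c (2 * k) - c (2 * k + 1)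
  have hlim : L2LocTendsto D (fun k => (AEEqFun.const _ (b k) : Fn D)) u := by
    intro K hK hKD
    have ht : Tendsto (fun k : ℕ => (2 * k, 2 * k + 1)) atTop (atTop : Filter (ℕ × ℕ)) := by
      rw [← prod_atTop_atTop_eq]
      exact (tendsto_atTop_mono (fun k => by rw [id]; omega) tendsto_id).prodMk
        (tendsto_atTop_mono (fun k => by rw [id]; omega) tendsto_id)
    refine ((hc K hK hKD).comp ht).congr fun k => ?_
    rw [Function.comp_apply, ← eLpNorm_neg]
    refine eLpNorm_congr_ae ?_
    filter_upwards [ae_restrict_of_subset hKD (AEEqFun.coeFn_const (μ := leb D) _ (b k)),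
      ae_restrict_of_subset hKD (AEEqFun.coeFn_zero (μ := leb D) (β := ℝ))] with x h1 h2
    have e0 : s (2 * k) = u := by simp [s]
    have e1 : s (2 * k + 1) = 0 := by simp [s]
    simp only [Pi.neg_apply, Pi.sub_apply, e0, e1, ZeroMemClass.coe_zero]
    rw [h1, h2]
    simp only [Pi.zero_apply, Function.const_apply, b]
    ring
  obtain ⟨ns, -, hae⟩ := hlim.exists_subseq
  have hae' : ∀ᵐ x ∂(leb D), Tendsto (fun k => b (ns k)) atTop (𝓝 ((u : Fn D) x)) := by
    have hall : ∀ᵐ x ∂(leb D), ∀ k, (AEEqFun.const _ (b k) : Fn D) x = b k :=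
      ae_all_iff.2 fun k => AEEqFun.coeFn_const (μ := leb D) _ (b k)
    filter_upwards [hae, hall] with x h1 h2
    simpa only [h2] using h1
  have : (ae (leb D)).NeBot := ae_neBot.2 (leb_ne_zero hD.nonempty)
  obtain ⟨x₀, hx₀⟩ := hae'.exists
  refine ⟨(u : Fn D) x₀, AEEqFun.ext ?_⟩
  filter_upwards [hae', AEEqFun.coeFn_const (μ := leb D) _ ((u : Fn D) x₀)] with x h1 h2
  rw [h2]
  exact tendsto_nhds_unique h1 hx₀

end BeppoLevi

end

noncomputable section

namespace BeppoLevi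

/-! ### The absolute value operates on `BL(D)` -/

variable {d : ℕ} {D : TopologicalSpace.Opens (EuclideanSpace ℝ (Fin d))}

theorem abs_integral_abs_mul_pd_le {u : Fn D} (hu : u ∈ BL D) (i : Fin d)
    {φ : EuclideanSpace ℝ (Fin d) → ℝ} (hφ : IsTest D φ) :
    |∫ x in D, |u x| * pd i φ x| ≤ ‖weakPartial D i u‖ * (eLpNorm φ 2 volume).toReal := by
  set S := tsupport φ
  have hS : IsCompact S := hφ.compact.isCompact
  obtain ⟨δ, hδ, hK'⟩ := hS.exists_cthickening_subset_open D.isOpen hφ.supp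
  set K := Metric.cthickening δ S with hKdef
  have hK : IsCompact K := hS.cthickening
  let U : TopologicalSpace.Opens (EuclideanSpace ℝ (Fin d)) :=
    ⟨Metric.thickening (δ / 2) S, Metric.isOpen_thickening⟩
  have hφU : IsTest U φ := ⟨hφ.smooth, hφ.compact, Metric.self_subset_thickening (by positivity) S⟩
  set e : EuclideanSpace ℝ (Fin d) := EuclideanSpace.single i 1 with he
  have hen : ‖e‖ = 1 := by simp [he]
  have hU : ∀ t : ℝ, |t| ≤ δ / 2 → ∀ x ∈ U, ∀ s ∈ Set.Icc (0 : ℝ) 1, x + s • t • e ∈ K := by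
    intro t ht x hx s hs
    refine Metric.thickening_subset_cthickening δ S ?_
    obtain ⟨z, hz, hxz⟩ := Metric.mem_thickening_iff.1 hx
    refine Metric.mem_thickening_iff.2 ⟨z, hz, ?_⟩
    have h1 : dist (x + s • t • e) x ≤ δ / 2 := by
      rw [dist_eq_norm, add_sub_cancel_left, norm_smul, norm_smul, hen, mul_one,
        Real.norm_eq_abs, Real.norm_eq_abs, abs_of_nonneg hs.1]
      have := mul_le_mul hs.2 ht (abs_nonneg t) zero_le_one
      linarith
    have := dist_triangle (x + s • t • e) x z
    linarith
  have huK : IntegrableOn (fun x => |u x|) K := (hu.1.integrableOn hK hK').abs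
  have hder := hasDerivAt_setIntegral_mul hK huK (F := fun s x => φ (x - s • e))
    (F' := fun s x => - fderiv ℝ φ (x - s • e) e) (fun s y => by
      have h1 : HasDerivAt (fun s : ℝ => y - s • e) (-((1 : ℝ) • e)) s :=
        ((hasDerivAt_id s).smul_const e).const_sub y
      have h2 := (hφ.smooth.differentiable (by simp) (y - s • e)).hasFDerivAt.comp_hasDerivAt s h1
      simpa [Function.comp_def] using h2)
    (fun s => hφ.smooth.continuous.comp (continuous_id.sub continuous_const)) (by
      have h1 := hφ.smooth.continuous_fderiv (by simp)
      have h2 : Continuous fun p : ℝ × EuclideanSpace ℝ (Fin d) => p.2 - p.1 • e := by fun_prop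
      exact ((h1.comp h2).clm_apply continuous_const).neg) 0
  have hsum : ∀ t : ℝ, ‖∑ j, (t • e) j • weakPartial D j u‖ = |t| * ‖weakPartial D i u‖ := by
    intro t
    rw [Finset.sum_eq_single i]
    · rw [norm_smul]
      simp [he]
    · intro j _ hj
      simp [he, hj]
    · simp
  have hlip := hder.le_of_lip' (C := ‖weakPartial D i u‖ * (eLpNorm φ 2 volume).toReal)
    (by positivity) (by
      filter_upwards [Metric.closedBall_mem_nhds (0 : ℝ) (half_pos hδ)] with t ht
      have ht' : |t| ≤ δ / 2 := by simpa using ht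
      have hUt := hU t ht'
      obtain ⟨-, h1⟩ := setIntegral_translate_sub_mul huK (t • e) (U := U)
        (fun x hx => by simpa using hUt x hx 0 (by simp))
        (fun x hx => by simpa using hUt x hx 1 (by simp))
      have h2 := eLpNorm_translate_sub_le hu.1 (weakPartial_spec hu) (t • e) hK hK' hUt
      rw [hsum] at h2
      have hum := measurable_coeFn u
      have hmm : Measurable fun x => u (x + t • e) := hum.comp (measurable_add_const (t • e))
      have hm : MemLp (fun x => |u (x + t • e)| - |u x|) 2 (leb U) := by
        refine MemLp.mono' (g := fun x => ‖u (x + t • e) - u x‖)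
          (MemLp.norm ⟨(hmm.sub hum).aestronglyMeasurable, h2.trans_lt ENNReal.ofReal_lt_top⟩)
          (hmm.abs.sub hum.abs).aestronglyMeasurable
          (Eventually.of_forall fun x => abs_abs_sub_abs_le_abs_sub _ _)
      have h3 : eLpNorm (fun x => |u (x + t • e)| - |u x|) 2 (leb U) ≤
          ENNReal.ofReal (|t| * ‖weakPartial D i u‖) :=
        (eLpNorm_mono fun x => abs_abs_sub_abs_le_abs_sub _ _).trans h2
      have h4 := abs_integral_mul_le_eLpNorm hm (hφ.memLp.restrict (U : Set _))
      rw [h1 φ hφU, hφU.eLpNorm_leb] at h4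
      have h5 := ENNReal.toReal_le_of_le_ofReal (by positivity) h3
      simp only [zero_smul, sub_zero]
      refine h4.trans ?_
      refine (mul_le_mul_of_nonneg_right h5 ENNReal.toReal_nonneg).trans_eq ?_
      rw [Real.norm_eq_abs]
      ring)
  rw [Real.norm_eq_abs] at hlip
  refine le_trans (le_of_eq ?_) hlip
  rw [← abs_neg, ← integral_neg]
  congr 1
  rw [setIntegral_eq_of_support_subset hK' fun x hx => ?_]
  · simp [pd, he]
  · have : pd i φ x = 0 := pd_eq_zero i fun hx' => hx (Metric.self_subset_cthickening S hx')
    simp only [zero_smul, sub_zero]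
    rw [show fderiv ℝ φ x e = 0 from this]
    simp

theorem exists_isWeakPartial_abs {u z : Fn D} (hu : u ∈ BL D) (hz : ∀ᵐ x ∂(leb D), z x = |u x|)
    (i : Fin d) : ∃ g, ‖g‖ ≤ ‖weakPartial D i u‖ ∧ IsWeakPartial D i z g := by
  have hzL : IsL2Loc D z := fun K hK hKD =>
    (hu.1 K hK hKD).abs.ae_eq (EventuallyEq.symm (ae_restrict_of_subset hKD hz))
  have hpd : ∀ {φ : EuclideanSpace ℝ (Fin d) → ℝ}, IsTest D φ → Differentiable ℝ φ := fun h =>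
    h.smooth.differentiable (by simp)
  let Λ : testSpace D →ₗ[ℝ] ℝ :=
    { toFun := fun φ => - ∫ x in D, z x * pd i φ.1 x
      map_add' := fun φ ψ => by
        rw [← neg_add, ← integral_add (φ.2.integrable_mul_pd i hzL) (ψ.2.integrable_mul_pd i hzL)]
        congr 1
        refine integral_congr_ae (Eventually.of_forall fun x => ?_)
        simp only [pd, Submodule.coe_add]
        rw [fderiv_add (hpd φ.2 x) (hpd ψ.2 x)]
        simp [mul_add]
      map_smul' := fun c φ => by
        rw [RingHom.id_apply, smul_eq_mul, mul_neg, ← integral_const_mul]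
        congr 1
        refine integral_congr_ae (Eventually.of_forall fun x => ?_)
        simp only [pd, Submodule.coe_smul]
        rw [fderiv_const_smul (hpd φ.2 x)]
        simp [mul_left_comm] }
  obtain ⟨g, hg, hgΛ⟩ := exists_inner_eq_of_abs_le (testToLp D) Λ
    (norm_nonneg (weakPartial D i u)) (fun φ => by
      rw [norm_testToLp, φ.2.eLpNorm_leb]
      change |-∫ x in D, z x * pd i φ.1 x| ≤ _
      rw [abs_neg]
      refine le_trans (le_of_eq ?_) (abs_integral_abs_mul_pd_le hu i φ.2)
      congr 1
      refine integral_congr_ae ?_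
      filter_upwards [hz] with x hx
      rw [hx])
  refine ⟨g, hg, fun φ hφ => ?_⟩
  have := hgΛ ⟨φ, hφ⟩
  rw [inner_testToLp] at this
  rw [← this]
  exact (neg_neg _).symm

theorem abs_mem_BL {u z : Fn D} (hu : u ∈ BL D) (hz : ∀ᵐ x ∂(leb D), z x = |u x|) : z ∈ BL D :=
  ⟨fun K hK hKD =>
    (hu.1 K hK hKD).abs.ae_eq (EventuallyEq.symm (ae_restrict_of_subset hKD hz)),
    fun i => (exists_isWeakPartial_abs hu hz i).imp fun _ h => h.2⟩

theorem norm_grad_abs_le {u z : BL D} (hz : ∀ᵐ x ∂(leb D), (z : Fn D) x = |(u : Fn D) x|) :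
    ‖grad D z‖ ≤ ‖grad D u‖ := by
  rw [PiLp.norm_eq_of_L2, PiLp.norm_eq_of_L2]
  gcongr with i
  obtain ⟨g, hg, hgw⟩ := exists_isWeakPartial_abs u.2 hz i
  exact (congrArg norm (weakPartial_eq z.2 hgw)).trans_le hg

end BeppoLevi

end

noncomputable section

namespace BeppoLevi

/-! ### The semigroup of a symmetric form -/

namespace IsSemigroupOfForm

variable {α : Type*} [MeasurableSpace α] {μ : Measure α} {T : ℝ → (Lp ℝ 2 μ →L[ℝ] Lp ℝ 2 μ)}
  {F : Set (Lp ℝ 2 μ)} {ℰ : Lp ℝ 2 μ → Lp ℝ 2 μ → ℝ}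

theorem norm_sub_le (h : IsSemigroupOfForm T F ℰ) (f : Lp ℝ 2 μ) {s t : ℝ} (hs : 0 ≤ s)
    (ht : 0 ≤ t) : ‖T s f - T t f‖ ≤ ‖T |s - t| f - f‖ := by
  wlog hst : t ≤ s generalizing s t
  · rw [norm_sub_rev, abs_sub_comm]
    exact this ht hs (le_of_not_ge hst)
  have e : T s f = T t (T |s - t| f) := by
    rw [← ContinuousLinearMap.comp_apply, ← h.add t _ ht (abs_nonneg _),
      abs_of_nonneg (sub_nonneg.2 hst), add_sub_cancel]
  rw [e, ← map_sub]
  exact h.contraction t ht _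

theorem continuousOn (h : IsSemigroupOfForm T F ℰ) (f : Lp ℝ 2 μ) :
    ContinuousOn (fun t => T t f) (Set.Ici 0) := by
  have h0 : Tendsto (fun r => ‖T r f - f‖) (𝓝[≥] (0 : ℝ)) (𝓝 0) := by
    have h1 : Tendsto (fun r => ‖T r f - f‖) (𝓝[>] (0 : ℝ)) (𝓝 0) :=
      tendsto_iff_norm_sub_tendsto_zero.1 (h.strongCont f)
    rw [← Set.Ioi_insert, nhdsWithin_insert, tendsto_sup]
    refine ⟨?_, h1⟩
    rw [tendsto_pure_left]
    intro s hs
    have : ‖T 0 f - f‖ = 0 := by simp [h.zero]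
    rw [this]
    exact mem_of_mem_nhds hs
  intro t ht
  have h2 : Tendsto (fun s : ℝ => |s - t|) (𝓝[Set.Ici 0] t) (𝓝[≥] 0) := by
    refine tendsto_nhdsWithin_of_tendsto_nhds_of_eventually_within _ ?_
      (Eventually.of_forall fun s => abs_nonneg (s - t))
    have : Continuous fun s : ℝ => |s - t| := by fun_prop
    simpa using (this.tendsto t).mono_left nhdsWithin_le_nhds
  refine tendsto_iff_norm_sub_tendsto_zero.2 ?_
  refine squeeze_zero' (Eventually.of_forall fun _ => norm_nonneg _) ?_ (h0.comp h2)
  filter_upwards [self_mem_nhdsWithin] with s hs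
  exact h.norm_sub_le f hs ht

theorem intervalIntegrable (h : IsSemigroupOfForm T F ℰ) (f : Lp ℝ 2 μ) {a b : ℝ} (ha : 0 ≤ a)
    (hb : 0 ≤ b) : IntervalIntegrable (fun t => T t f) volume a b :=
  ((h.continuousOn f).mono fun _ hx => (le_min ha hb).trans hx.1).intervalIntegrable

theorem inner_timeIntegral (h : IsSemigroupOfForm T F ℰ) (f g : Lp ℝ 2 μ) {t : ℝ} (ht : 0 ≤ t) :
    inner ℝ g (timeIntegral T t f) = ∫ s in (0 : ℝ)..t, inner ℝ g (T s f) :=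
  ((innerSL ℝ g).intervalIntegral_comp_comm (h.intervalIntegrable f le_rfl ht)).symm

theorem apply_timeIntegral (h : IsSemigroupOfForm T F ℰ) (f : Lp ℝ 2 μ) {s t : ℝ} (hs : 0 ≤ s)
    (ht : 0 ≤ t) : T s (timeIntegral T t f) = timeIntegral T t (T s f) := by
  rw [timeIntegral, timeIntegral,
    ← (T s).intervalIntegral_comp_comm (h.intervalIntegrable f le_rfl ht)]
  refine intervalIntegral.integral_congr fun r hr => ?_
  rw [Set.uIcc_of_le ht] at hr
  rw [← ContinuousLinearMap.comp_apply, ← ContinuousLinearMap.comp_apply, ← h.add s r hs hr.1,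
    ← h.add r s hr.1 hs, add_comm]

theorem timeIntegral_sub_apply (h : IsSemigroupOfForm T F ℰ) (f : Lp ℝ 2 μ) {s t : ℝ}
    (hs : 0 ≤ s) (ht : 0 ≤ t) :
    timeIntegral T t f - T s (timeIntegral T t f) = timeIntegral T s f - T t (timeIntegral T s f) := by
  have e : ∀ {a b : ℝ}, 0 ≤ a → 0 ≤ b → T a (timeIntegral T b f) = ∫ r in a..(a + b), T r f := by
    intro a b ha hb
    rw [timeIntegral, ← (T a).intervalIntegral_comp_comm (h.intervalIntegrable f le_rfl hb)]
    have : ∫ r in (0 : ℝ)..b, T a (T r f) = ∫ r in (0 : ℝ)..b, T (a + r) f := by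
      refine intervalIntegral.integral_congr fun r hr => ?_
      rw [Set.uIcc_of_le hb] at hr
      rw [h.add a r ha hr.1, ContinuousLinearMap.comp_apply]
    rw [this, intervalIntegral.integral_comp_add_left (fun r => T r f) a, add_zero]
  rw [e hs ht, e ht hs, timeIntegral, timeIntegral, sub_eq_sub_iff_add_eq_add,
    intervalIntegral.integral_add_adjacent_intervals (h.intervalIntegrable f le_rfl ht)
      (h.intervalIntegrable f ht (by positivity)),
    intervalIntegral.integral_add_adjacent_intervals (h.intervalIntegrable f le_rfl hs)
      (h.intervalIntegrable f hs (by positivity)), add_comm]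

theorem tendsto_inv_smul_timeIntegral (h : IsSemigroupOfForm T F ℰ) (f : Lp ℝ 2 μ) :
    Tendsto (fun t : ℝ => t⁻¹ • timeIntegral T t f) (𝓝[>] 0) (𝓝 f) := by
  have h1 : HasDerivWithinAt (fun t => ∫ s in (0 : ℝ)..t, T s f) (T 0 f) (Set.Ici 0) 0 := by
    refine intervalIntegral.integral_hasDerivWithinAt_right (by simp) ?_
      ((h.continuousOn f) 0 Set.self_mem_Ici |>.mono Set.Ioi_subset_Ici_self)
    exact ⟨Set.Ioi 0, self_mem_nhdsWithin,
      ((h.continuousOn f).mono Set.Ioi_subset_Ici_self).aestronglyMeasurable measurableSet_Ioi⟩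
  have h2 := hasDerivWithinAt_iff_tendsto_slope.1 h1
  rw [Set.Ici_sdiff_left, h.zero] at h2
  refine h2.congr fun t => ?_
  simp [slope_def_module, timeIntegral]

theorem tendsto_inv_smul_sub (h : IsSemigroupOfForm T F ℰ) (f : Lp ℝ 2 μ) {t : ℝ} (ht : 0 ≤ t) :
    Tendsto (fun s : ℝ => s⁻¹ • (timeIntegral T t f - T s (timeIntegral T t f))) (𝓝[>] 0)
      (𝓝 (f - T t f)) := by
  have h1 := h.tendsto_inv_smul_timeIntegral f
  refine (h1.sub (((T t).continuous.tendsto f).comp h1)).congr' ?_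
  filter_upwards [self_mem_nhdsWithin] with s hs
  rw [h.timeIntegral_sub_apply f (le_of_lt hs) ht, Function.comp_apply, map_smul, smul_sub]

theorem timeIntegral_mem (h : IsSemigroupOfForm T F ℰ) (f : Lp ℝ 2 μ) {t : ℝ} (ht : 0 ≤ t) :
    timeIntegral T t f ∈ F := by
  refine (h.mem_iff _).2 ⟨inner ℝ (f - T t f) (timeIntegral T t f), ?_⟩
  refine ((h.tendsto_inv_smul_sub f ht).inner tendsto_const_nhds).congr fun s => ?_
  rw [real_inner_smul_left]

theorem form_timeIntegral (h : IsSemigroupOfForm T F ℰ) (f : Lp ℝ 2 μ) {t : ℝ} (ht : 0 ≤ t)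
    {v : Lp ℝ 2 μ} (hv : v ∈ F) : ℰ (timeIntegral T t f) v = inner ℝ (f - T t f) v := by
  refine tendsto_nhds_unique (h.form_eq _ (h.timeIntegral_mem f ht) v hv) ?_
  refine ((h.tendsto_inv_smul_sub f ht).inner tendsto_const_nhds).congr fun s => ?_
  rw [real_inner_smul_left]

end IsSemigroupOfForm

theorem inner_nonneg_of_nonneg {α : Type*} [MeasurableSpace α] {μ : Measure α} {f g : Lp ℝ 2 μ}
    (hf : 0 ≤ f) (hg : 0 ≤ g) : 0 ≤ inner ℝ f g := by
  rw [L2.inner_def]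
  refine integral_nonneg_of_ae ?_
  filter_upwards [(Lp.coeFn_nonneg f).2 hf, (Lp.coeFn_nonneg g).2 hg] with x h1 h2
  simpa using mul_nonneg h2 h1

theorem continuous_lp_abs {α : Type*} [MeasurableSpace α] {μ : Measure α} :
    Continuous fun x : Lp ℝ 2 μ => |x| :=
  (LipschitzWith.mk_one fun a b => by
    rw [dist_eq_norm, dist_eq_norm]
    exact norm_abs_sub_abs a b).continuous

theorem norm_abs_sub_self_sq_sub_le {α : Type*} [MeasurableSpace α] {μ : Measure α}
    (a b : Lp ℝ 2 μ) :
    ‖|a| - a‖ ^ 2 - ‖|b| - b‖ ^ 2 ≤ -4 * inner ℝ (|a| - a) (a - b) := by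
  have h1 : 0 ≤ inner ℝ (|a| - a) (|b| + b) := by
    refine inner_nonneg_of_nonneg (sub_nonneg.2 (le_abs_self a)) ?_
    rw [← sub_neg_eq_add]
    exact sub_nonneg.2 (neg_le_abs b)
  have h2 : inner ℝ (|a| - a) (|a| + a) = (0 : ℝ) := by
    rw [L2.inner_def]
    refine integral_eq_zero_of_ae ?_
    filter_upwards [Lp.coeFn_abs a, Lp.coeFn_sub |a| a, Lp.coeFn_add |a| a] with x h1 h2 h3
    rw [h2, h3, Pi.sub_apply, Pi.add_apply, h1]
    simp only [RCLike.inner_apply, conj_trivial, Pi.zero_apply]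
    nlinarith [abs_mul_abs_self (a x)]
  have e : (2 : ℝ) • (a - b) = (|a| + a) - (|b| + b) - (|a| - a) + (|b| - b) := by module
  have h3 : 2 * inner ℝ (|a| - a) (a - b)
      = - inner ℝ (|a| - a) (|b| + b) - ‖|a| - a‖ ^ 2 + inner ℝ (|a| - a) (|b| - b) := by
    rw [← real_inner_smul_right, e, inner_add_right, inner_sub_right, inner_sub_right, h2,
      real_inner_self_eq_norm_sq]
    ring
  have h4 := norm_sub_sq_real (|a| - a) (|b| - b)
  nlinarith [sq_nonneg ‖|a| - a - (|b| - b)‖]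

namespace IsSemigroupOfForm

variable {α : Type*} [MeasurableSpace α] {μ : Measure α} {T : ℝ → (Lp ℝ 2 μ →L[ℝ] Lp ℝ 2 μ)}
  {F : Set (Lp ℝ 2 μ)} {ℰ : Lp ℝ 2 μ → Lp ℝ 2 μ → ℝ}

theorem norm_abs_sub_self_apply_timeIntegral_le (h : IsSemigroupOfForm T F ℰ)
    (hF : ∀ u ∈ F, |u| - u ∈ F ∧ ℰ u (|u| - u) ≤ 0) (f : Lp ℝ 2 μ) {ε t : ℝ} (hε : 0 ≤ ε)
    (ht : 0 ≤ t) :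
    ‖|T t (timeIntegral T ε f)| - T t (timeIntegral T ε f)‖ ≤
      ‖|timeIntegral T ε f| - timeIntegral T ε f‖ := by
  set v := timeIntegral T ε f with hv
  set φ : ℝ → ℝ := fun s => ‖|T s v| - T s v‖ ^ 2 with hφ
  have hcn : Continuous fun x : Lp ℝ 2 μ => |x| - x := continuous_lp_abs.sub continuous_id
  have hc : ContinuousOn φ (Set.Icc 0 t) :=
    ((hcn.norm.pow 2).comp_continuousOn (h.continuousOn v)).mono Set.Icc_subset_Ici_self
  have key := image_le_of_liminf_slope_right_le_deriv_boundary hc (B := fun _ => φ 0)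
    (B' := fun _ => 0) le_rfl continuousOn_const (fun x _ => hasDerivWithinAt_const x _ _) (by
      intro x hx r hr
      refine Eventually.frequently ?_
      have hxε : T x v = timeIntegral T ε (T x f) := h.apply_timeIntegral f hx.1 hε
      have hadd : Tendsto (fun z => z - x) (𝓝[>] x) (𝓝[>] 0) := by
        refine tendsto_nhdsWithin_of_tendsto_nhds_of_eventually_within _ ?_ ?_
        · have : Continuous fun z : ℝ => z - x := by fun_prop
          simpa using (this.tendsto x).mono_left nhdsWithin_le_nhds
        · filter_upwards [self_mem_nhdsWithin] with z hz
          exact sub_pos.2 (Set.mem_Ioi.1 hz)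
      have h1 := (h.tendsto_inv_smul_sub (T x f) hε).comp hadd
      have h2 : Tendsto (fun z => |T z v| - T z v) (𝓝[>] x) (𝓝 (|T x v| - T x v)) :=
        (hcn.tendsto _).comp (((h.continuousOn v) x hx.1).mono fun z hz => hx.1.trans (le_of_lt hz))
      have h3 := (h2.inner (𝕜 := ℝ) h1).const_mul 4
      have h4 : 4 * inner ℝ (|T x v| - T x v) (T x f - T ε (T x f)) < r := by
        rw [real_inner_comm, ← h.form_timeIntegral (T x f) hε, ← hxε]
        · have := (hF (T x v) (by rw [hxε]; exact h.timeIntegral_mem _ hε)).2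
          linarith
        · exact (hF (T x v) (by rw [hxε]; exact h.timeIntegral_mem _ hε)).1
      filter_upwards [h3.eventually_lt_const h4, self_mem_nhdsWithin] with z hz1 hz2
      refine lt_of_le_of_lt ?_ hz1
      have hzx : 0 < z - x := sub_pos.2 hz2
      have e : T z v = T (z - x) (timeIntegral T ε (T x f)) := by
        rw [← hxε, ← ContinuousLinearMap.comp_apply, ← h.add _ _ hzx.le hx.1, sub_add_cancel]
      rw [Function.comp_apply, ← e, ← hxε, real_inner_smul_right, slope_def_field, div_eq_inv_mul,
        mul_left_comm]
      refine mul_le_mul_of_nonneg_left ?_ (inv_nonneg.2 hzx.le)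
      refine (norm_abs_sub_self_sq_sub_le (T z v) (T x v)).trans_eq ?_
      rw [← neg_sub (T x v), inner_neg_right]
      ring)
  have h0 := key (Set.right_mem_Icc.2 ht)
  simp only [hφ, h.zero, ContinuousLinearMap.id_apply] at h0
  exact le_of_sq_le_sq h0 (norm_nonneg _)

theorem apply_nonneg (h : IsSemigroupOfForm T F ℰ)
    (hF : ∀ u ∈ F, |u| - u ∈ F ∧ ℰ u (|u| - u) ≤ 0) {f : Lp ℝ 2 μ} (hf : 0 ≤ f) {t : ℝ}
    (ht : 0 ≤ t) : 0 ≤ T t f := by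
  have hcn : Continuous fun x : Lp ℝ 2 μ => ‖|x| - x‖ := (continuous_lp_abs.sub continuous_id).norm
  have hl := h.tendsto_inv_smul_timeIntegral f
  have hle : ‖|T t f| - T t f‖ ≤ ‖|f| - f‖ := by
    refine le_of_tendsto_of_tendsto ((hcn.tendsto _).comp (((T t).continuous.tendsto f).comp hl))
      ((hcn.tendsto f).comp hl) ?_
    filter_upwards [self_mem_nhdsWithin] with ε hε
    have e : ε⁻¹ • timeIntegral T ε f = timeIntegral T ε (ε⁻¹ • f) := by
      rw [timeIntegral, timeIntegral, ← intervalIntegral.integral_smul]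
      simp only [map_smul]
    simp only [Function.comp_apply]
    rw [e]
    exact h.norm_abs_sub_self_apply_timeIntegral_le hF (ε⁻¹ • f) (le_of_lt hε) ht
  rw [abs_of_nonneg hf, sub_self, norm_zero] at hle
  have := norm_le_zero_iff.1 hle
  rw [← sub_eq_zero.1 this]
  exact abs_nonneg _

theorem inner_timeIntegral_nonneg (h : IsSemigroupOfForm T F ℰ)
    (hF : ∀ u ∈ F, |u| - u ∈ F ∧ ℰ u (|u| - u) ≤ 0) {f g : Lp ℝ 2 μ} (hf : 0 ≤ f) (hg : 0 ≤ g)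
    {t : ℝ} (ht : 0 ≤ t) : 0 ≤ inner ℝ g (timeIntegral T t f) := by
  rw [h.inner_timeIntegral f g ht]
  exact intervalIntegral.integral_nonneg ht fun s hs =>
    inner_nonneg_of_nonneg hg (h.apply_nonneg hF hf hs.1)

theorem two_mul_norm_sq_le (h : IsSemigroupOfForm T F ℰ) (g : Lp ℝ 2 μ) {t : ℝ} (ht : 0 ≤ t) :
    2 * t * ‖T t g‖ ^ 2 ≤ inner ℝ g (timeIntegral T (2 * t) g) := by
  have ht2 : 0 ≤ 2 * t := by positivity
  rw [h.inner_timeIntegral g g ht2]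
  have e : 2 * t * ‖T t g‖ ^ 2 = ∫ _ in (0 : ℝ)..(2 * t), ‖T t g‖ ^ 2 := by simp
  rw [e]
  refine intervalIntegral.integral_mono_on ht2 (by simp) ?_ ?_
  · refine ContinuousOn.intervalIntegrable ?_
    rw [Set.uIcc_of_le ht2]
    exact continuousOn_const.inner ((h.continuousOn g).mono Set.Icc_subset_Ici_self)
  · intro s hs
    have hs2 : 0 ≤ s / 2 := by linarith [hs.1]
    have e1 : T s g = T (s / 2) (T (s / 2) g) := by
      rw [← ContinuousLinearMap.comp_apply, ← h.add _ _ hs2 hs2, add_halves]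
    have e2 : T t g = T (t - s / 2) (T (s / 2) g) := by
      rw [← ContinuousLinearMap.comp_apply, ← h.add _ _ (by linarith [hs.2]) hs2, sub_add_cancel]
    rw [e1, ← h.symm _ hs2, real_inner_self_eq_norm_sq, e2]
    gcongr
    exact h.contraction _ (by linarith [hs.2]) _

/-- If the Green potential of `g` has finite energy, then `g` is bounded by the form. -/
theorem inner_sq_le (h : IsSemigroupOfForm T F ℰ)
    (hF : ∀ u ∈ F, |u| - u ∈ F ∧ ℰ u (|u| - u) ≤ 0)
    (hCS : ∀ u ∈ F, ∀ v ∈ F, ℰ u v ^ 2 ≤ ℰ u u * ℰ v v) (hpos : ∀ u ∈ F, 0 ≤ ℰ u u)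
    {g : Lp ℝ 2 μ} (hg : 0 ≤ g) {M : ℝ}
    (hM : ∀ N : ℕ, inner ℝ g (timeIntegral T (N : ℝ) g) ≤ M) {u : Lp ℝ 2 μ} (hu : u ∈ F) :
    inner ℝ g u ^ 2 ≤ M * ℰ u u := by
  have h1 : ∀ N : ℕ, inner ℝ (g - T (N : ℝ) g) u ^ 2 ≤ M * ℰ u u := by
    intro N
    have hN : (0 : ℝ) ≤ N := Nat.cast_nonneg N
    rw [← h.form_timeIntegral g hN hu]
    refine (hCS _ (h.timeIntegral_mem g hN) u hu).trans
      (mul_le_mul_of_nonneg_right ?_ (hpos u hu))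
    rw [h.form_timeIntegral g hN (h.timeIntegral_mem g hN), inner_sub_left]
    have := h.inner_timeIntegral_nonneg hF hg (h.apply_nonneg hF hg hN) hN
    linarith [hM N]
  have h2 : Tendsto (fun N : ℕ => T (N : ℝ) g) atTop (𝓝 0) := by
    rw [tendsto_zero_iff_norm_tendsto_zero]
    have h3 : Tendsto (fun N : ℕ => ‖T (N : ℝ) g‖ ^ 2) atTop (𝓝 0) := by
      refine squeeze_zero' (Eventually.of_forall fun _ => sq_nonneg _) ?_
        (tendsto_const_div_atTop_nhds_zero_nat (M / 2))
      filter_upwards [eventually_gt_atTop 0] with N hN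
      have hN' : (0 : ℝ) < N := Nat.cast_pos.2 hN
      rw [le_div_iff₀ hN']
      have h4 := h.two_mul_norm_sq_le g hN'.le
      have h5 := hM (2 * N)
      push_cast at h5
      linarith
    have := (Real.continuous_sqrt.tendsto 0).comp h3
    simpa [Function.comp_def] using this
  have h3 : Tendsto (fun N : ℕ => inner ℝ (g - T (N : ℝ) g) u ^ 2) atTop (𝓝 (inner ℝ g u ^ 2)) := by
    have := ((tendsto_const_nhds (x := g)).sub h2).inner (𝕜 := ℝ) (tendsto_const_nhds (x := u))
    rw [sub_zero] at this
    exact this.pow 2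
  exact le_of_tendsto' h3 h1

end IsSemigroupOfForm

end BeppoLevi

end

noncomputable section

namespace BeppoLevi

/-! ### A consequence of transience -/

variable {d : ℕ} {D : TopologicalSpace.Opens (EuclideanSpace ℝ (Fin d))}

theorem form_abs_sub_self_nonpos {u : Lp ℝ 2 (leb D)} (hu : (u : Fn D) ∈ W12 D) :
    ((|u| - u : Lp ℝ 2 (leb D)) : Fn D) ∈ W12 D ∧
      (1 / 2) * dirichlet D (u : Fn D) ((|u| - u : Lp ℝ 2 (leb D)) : Fn D) ≤ 0 := by
  have hz := Lp.coeFn_abs u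
  have hzB : ((|u| : Lp ℝ 2 (leb D)) : Fn D) ∈ BL D := abs_mem_BL hu.1 hz
  let a : BL D := ⟨u, hu.1⟩
  let z : BL D := ⟨(|u| : Lp ℝ 2 (leb D)), hzB⟩
  have hle : ‖grad D z‖ ≤ ‖grad D a‖ := norm_grad_abs_le hz
  refine ⟨⟨(z - a).2, (|u| - u).2⟩, ?_⟩
  have e := dirichlet_eq_inner a (z - a)
  rw [show dirichlet D (u : Fn D) ((|u| - u : Lp ℝ 2 (leb D)) : Fn D) = _ from e, map_sub,
    inner_sub_right, real_inner_self_eq_norm_sq]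
  have h1 := real_inner_le_norm (grad D a) (grad D z)
  nlinarith [norm_nonneg (grad D a)]

theorem exists_pos_measure_le {α : Type*} [MeasurableSpace α] {μ : Measure α} {G : α → ℝ≥0∞}
    (hG : ∀ᵐ x ∂μ, G x < ⊤) {B : Set α} (hB : μ B ≠ 0) :
    ∃ M : ℕ, μ (B ∩ {x | G x ≤ M}) ≠ 0 := by
  by_contra! hcon
  have h1 : μ (⋃ M : ℕ, B ∩ {x | G x ≤ M}) = 0 := measure_iUnion_null hcon
  refine hB (measure_mono_null_ae ?_ h1)
  filter_upwards [hG] with x hx hxB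
  obtain ⟨M, hM⟩ := ENNReal.exists_nat_gt hx.ne
  exact Set.mem_iUnion.2 ⟨M, hxB, hM.le⟩

theorem measurable_green {α : Type*} [MeasurableSpace α] {μ : Measure α}
    (T : ℝ → (Lp ℝ 2 μ →L[ℝ] Lp ℝ 2 μ)) (f : α → ℝ) (hf : Integrable f μ)
    (h0 : ∀ᵐ x ∂μ, 0 ≤ f x) : Measurable (green T f hf h0) :=
  Measurable.iSup fun _ => Measurable.iSup fun _ =>
    (Lp.stronglyMeasurable _).measurable.ennreal_ofReal

/-- Under transience, some nontrivial nonnegative function with compact support defines a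
functional on `W^{1,2}(D)` that is bounded by the Dirichlet integral. -/
theorem IsTransient.exists_bounded_functional (htr : IsTransient D)
    (hD : (D : Set (EuclideanSpace ℝ (Fin d))).Nonempty) :
    ∃ (g : EuclideanSpace ℝ (Fin d) → ℝ) (K : Set (EuclideanSpace ℝ (Fin d))) (C : ℝ),
      IsCompact K ∧ K ⊆ D ∧ MemLp g 2 (volume.restrict K) ∧ (∀ x ∉ K, g x = 0) ∧
      0 < ∫ x in D, g x ∧
      ∀ u : BL D, (u : Fn D) ∈ W12 D → |∫ x in D, (u : Fn D) x * g x| ≤ C * ‖grad D u‖ := by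
  obtain ⟨T, hT, f, hf, h0, hpos, hG⟩ := htr
  obtain ⟨x₀, hx₀⟩ := hD
  obtain ⟨r, hr, hrD⟩ := Metric.nhds_basis_closedBall.mem_iff.1 (D.isOpen.mem_nhds hx₀)
  set K := Metric.closedBall x₀ r with hKdef
  have hK : IsCompact K := isCompact_closedBall x₀ r
  have hKpos : leb D K ≠ 0 := by
    rw [Measure.restrict_apply hK.measurableSet, Set.inter_eq_left.2 hrD]
    exact (Metric.measure_closedBall_pos volume x₀ hr).ne'
  obtain ⟨M, hM⟩ := exists_pos_measure_le hG hKpos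
  set A := K ∩ {x | green T f hf h0 x ≤ M} with hA
  have hAm : MeasurableSet A :=
    hK.measurableSet.inter (measurable_green T f hf h0 measurableSet_Iic)
  let m : EuclideanSpace ℝ (Fin d) → ℝ := fun x => min (f x) ((1 : ℕ) : ℝ)
  let g : EuclideanSpace ℝ (Fin d) → ℝ := A.indicator m
  have hgm : MemLp g 2 (leb D) := (memLp_truncate hf h0 1).indicator hAm
  have hm0 : ∀ᵐ x ∂(leb D), 0 < m x := by
    filter_upwards [hpos] with x hx
    exact lt_min hx (by norm_num)
  have hgm0 : ∀ᵐ x ∂(leb D), 0 ≤ g x ∧ g x ≤ m x ∧ m x ≤ f x := by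
    filter_upwards [hm0] with x hx
    refine ⟨Set.indicator_apply_nonneg fun _ => hx.le, ?_, min_le_left _ _⟩
    by_cases hxA : x ∈ A
    · simp [g, hxA]
    · simpa [g, hxA] using hx.le
  have hgi : Integrable g (leb D) := by
    refine hf.mono' hgm.aestronglyMeasurable ?_
    filter_upwards [hgm0] with x hx
    rw [Real.norm_of_nonneg hx.1]
    exact hx.2.1.trans hx.2.2
  let gL : Lp ℝ 2 (leb D) := hgm.toLp g
  let τ : Lp ℝ 2 (leb D) := truncate f hf h0 1
  have hgL : gL =ᵐ[leb D] g := hgm.coeFn_toLp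
  have hτ : τ =ᵐ[leb D] m := MemLp.coeFn_toLp _
  have hg0 : 0 ≤ gL := by
    rw [← Lp.coeFn_nonneg]
    filter_upwards [hgL, hgm0] with x h1 h2
    rw [h1]
    exact h2.1
  have hτg : 0 ≤ τ - gL := by
    rw [← Lp.coeFn_nonneg]
    filter_upwards [hgL, hτ, hgm0, Lp.coeFn_sub τ gL] with x h1 h2 h3 h4
    rw [h4, Pi.sub_apply, h1, h2]
    exact sub_nonneg.2 h3.2.1
  have hbound : ∀ N : ℕ, inner ℝ gL (timeIntegral T (N : ℝ) gL) ≤ M * ∫ x in D, g x := by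
    intro N
    have hN : (0 : ℝ) ≤ N := Nat.cast_nonneg N
    have h1 := hT.inner_timeIntegral_nonneg (fun u hu => form_abs_sub_self_nonpos hu) hτg hg0 hN
    have e : timeIntegral T (N : ℝ) (τ - gL) = timeIntegral T N τ - timeIntegral T N gL := by
      simp only [timeIntegral, map_sub]
      exact intervalIntegral.integral_sub (hT.intervalIntegrable τ le_rfl hN)
        (hT.intervalIntegrable gL le_rfl hN)
    rw [e, inner_sub_right] at h1
    refine (sub_nonneg.1 h1).trans ?_
    rw [L2.inner_def, ← integral_const_mul]
    refine integral_mono_ae (L2.integrable_inner _ _) (hgi.const_mul _) ?_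
    filter_upwards [hgL, hgm0] with x h2 h3
    rw [h2]
    simp only [RCLike.inner_apply, conj_trivial]
    by_cases hxA : x ∈ A
    · refine mul_le_mul_of_nonneg_right ?_ h3.1
      have h4 : ENNReal.ofReal (timeIntegral T (N : ℝ) τ x) ≤ green T f hf h0 x :=
        le_iSup_of_le N (le_iSup (fun n : ℕ =>
          ENNReal.ofReal (timeIntegral T (N : ℝ) (truncate f hf h0 n) x)) 1)
      have h5 := h4.trans hxA.2
      rw [← ENNReal.ofReal_natCast] at h5
      exact (ENNReal.ofReal_le_ofReal_iff (Nat.cast_nonneg M)).1 h5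
    · simp [g, hxA]
  refine ⟨g, K, Real.sqrt ((M * ∫ x in D, g x) * (1 / 2)), hK, hrD,
    hgm.mono_measure (Measure.restrict_mono hrD le_rfl),
    fun x hx => Set.indicator_of_notMem (fun h => hx h.1) _, ?_, fun u hu => ?_⟩
  · rw [integral_pos_iff_support_of_nonneg_ae (hgm0.mono fun x hx => hx.1) hgi]
    refine pos_iff_ne_zero.2 fun h => hM (measure_mono_null_ae ?_ h)
    filter_upwards [hm0] with x hx hxA
    change g x ≠ 0
    simp only [g, Set.indicator_of_mem (show x ∈ A from hxA)]
    exact hx.ne'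
  · let uL : Lp ℝ 2 (leb D) := ⟨u, hu.2⟩
    have hdir : ∀ {a b : Lp ℝ 2 (leb D)} (ha : (a : Fn D) ∈ W12 D) (hb : (b : Fn D) ∈ W12 D),
        dirichlet D (a : Fn D) (b : Fn D) = inner ℝ (grad D ⟨a, ha.1⟩) (grad D ⟨b, hb.1⟩) :=
      fun ha hb => dirichlet_eq_inner ⟨_, ha.1⟩ ⟨_, hb.1⟩
    have key := hT.inner_sq_le (fun u hu => form_abs_sub_self_nonpos hu)
      (fun a ha b hb => by
        rw [hdir ha hb, hdir ha ha, hdir hb hb]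
        have := real_inner_mul_inner_self_le (grad D ⟨a, ha.1⟩) (grad D ⟨b, hb.1⟩)
        nlinarith)
      (fun a ha => by
        rw [hdir ha ha]
        have := real_inner_self_nonneg (x := grad D ⟨a, ha.1⟩)
        positivity)
      hg0 hbound (u := uL) hu
    have e : inner ℝ gL uL = ∫ x in D, (u : Fn D) x * g x := by
      rw [L2.inner_def]
      refine integral_congr_ae ?_
      filter_upwards [hgL] with x hx
      rw [hx]
      rfl
    rw [e, show dirichlet D (uL : Fn D) (uL : Fn D) = _ from dirichlet_self_eq u, ← mul_assoc] at key
    have := Real.abs_le_sqrt key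
    rwa [Real.sqrt_mul' _ (sq_nonneg _), Real.sqrt_sq (norm_nonneg _)] at this

end BeppoLevi

end

noncomputable section

namespace BeppoLevi

/-! ### The extended Sobolev space -/

variable {d : ℕ} {D : TopologicalSpace.Opens (EuclideanSpace ℝ (Fin d))}

theorem integrable_mul_of_memLp {u : Fn D} (hu : IsL2Loc D u)
    {K : Set (EuclideanSpace ℝ (Fin d))} (hK : IsCompact K) (hKD : K ⊆ D)
    {g : EuclideanSpace ℝ (Fin d) → ℝ} (hg : MemLp g 2 (volume.restrict K))
    (h0 : ∀ x ∉ K, g x = 0) : Integrable (fun x => u x * g x) (leb D) := by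
  have h1 : IntegrableOn (fun x => u x * g x) K volume := (hu K hK hKD).integrable_mul hg
  refine h1.of_forall_sdiff_eq_zero D.isOpen.measurableSet fun x hx => ?_
  simp [h0 x hx.2]

theorem l2LocTendsto_constBL {c : ℕ → ℝ} {a : ℝ} (hc : Tendsto c atTop (𝓝 a)) :
    L2LocTendsto D (fun n => (constBL D (c n) : Fn D)) (constBL D a : Fn D) := by
  intro K hK hKD
  have h1 : Tendsto (fun n => ‖c n - a‖ₑ * volume K ^ (1 / 2 : ℝ)) atTop (𝓝 0) := by
    have h2 := tendsto_iff_edist_tendsto_0.1 hc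
    simp_rw [edist_eq_enorm_sub] at h2
    simpa using ENNReal.Tendsto.mul_const h2
      (Or.inr (ENNReal.rpow_ne_top_of_nonneg (by norm_num : (0 : ℝ) ≤ 1 / 2) hK.measure_lt_top.ne))
  refine h1.congr fun n => ?_
  have h3 := eLpNorm_const' (μ := volume.restrict K) (p := 2) (c n - a) (by simp) (by simp)
  rw [Measure.restrict_apply_univ, ENNReal.toReal_ofNat] at h3
  rw [← h3]
  refine eLpNorm_congr_ae ?_
  filter_upwards [ae_restrict_of_subset hKD (AEEqFun.coeFn_const (μ := leb D) _ (c n)),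
    ae_restrict_of_subset hKD (AEEqFun.coeFn_const (μ := leb D) _ a)] with x h1 h2
  simp only [constBL]
  rw [h1, h2, Function.const_apply, Function.const_apply]

theorem L2LocTendsto.add {w z : ℕ → Fn D} {v y : Fn D} (hw : L2LocTendsto D w v)
    (hz : L2LocTendsto D z y) : L2LocTendsto D (fun n => w n + z n) (v + y) := by
  intro K hK hKD
  refine tendsto_of_tendsto_of_tendsto_of_le_of_le tendsto_const_nhds
    (by simpa using (hw K hK hKD).add (hz K hK hKD)) (fun _ => zero_le) fun n => ?_
  refine le_trans (le_of_eq (eLpNorm_congr_ae ?_)) (eLpNorm_add_le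
    ((measurable_coeFn (w n)).sub (measurable_coeFn v)).aestronglyMeasurable
    ((measurable_coeFn (z n)).sub (measurable_coeFn y)).aestronglyMeasurable one_le_two)
  filter_upwards [ae_restrict_of_subset hKD (AEEqFun.coeFn_add (w n) (z n)),
    ae_restrict_of_subset hKD (AEEqFun.coeFn_add v y)] with x h1 h2
  simp only [Pi.add_apply] at h1 h2 ⊢
  rw [h1, h2]
  ring

/-- Under transience, a sequence in `W^{1,2}(D)` with Cauchy gradients converges in `L²_loc(D)`,
without subtraction of constants. -/
theorem exists_tendsto_of_transient (hD : IsConnected (D : Set (EuclideanSpace ℝ (Fin d))))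
    (htr : IsTransient D) {w : ℕ → BL D} (hw : ∀ n, (w n : Fn D) ∈ W12 D)
    (hc : CauchySeq fun n => grad D (w n)) :
    ∃ v : BL D, L2LocTendsto D (fun n => (w n : Fn D)) v ∧
      Tendsto (fun n => grad D (w n)) atTop (𝓝 (grad D v)) := by
  obtain ⟨g, K, C, hK, hKD, hg, hg0, hgpos, hgb⟩ := htr.exists_bounded_functional hD.nonempty
  obtain ⟨c, v, hv, hgv⟩ := exists_tendsto_sub_const hD hc
  have hint : ∀ u : BL D, Integrable (fun x => (u : Fn D) x * g x) (leb D) := fun u =>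
    integrable_mul_of_memLp u.2.1 hK hKD hg hg0
  have hIc : CauchySeq fun n => ∫ x in D, (w n : Fn D) x * g x := by
    rw [cauchySeq_iff_tendsto_dist_atTop_0] at hc ⊢
    refine squeeze_zero (fun _ => dist_nonneg) (fun p => ?_) (by simpa using hc.const_mul C)
    have h1 := hgb (w p.1 - w p.2) ((W12 D).sub_mem (hw _) (hw _))
    rw [map_sub, ← dist_eq_norm] at h1
    refine le_trans (le_of_eq ?_) h1
    rw [Real.dist_eq, ← integral_sub (hint _) (hint _)]
    congr 1
    refine integral_congr_ae ?_
    filter_upwards [AEEqFun.coeFn_sub (w p.1 : Fn D) (w p.2 : Fn D)] with x hx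
    rw [show ((w p.1 - w p.2 : BL D) : Fn D) x = _ from hx, Pi.sub_apply, sub_mul]
  obtain ⟨I, hI⟩ := cauchySeq_tendsto_of_complete hIc
  have hJ := hv.tendsto_integral_mul (fun n => (w n - constBL D (c n)).2.1) v.2.1 hK hKD hg hg0
  have hcn : ∀ n, c n = ((∫ x in D, (w n : Fn D) x * g x)
      - ∫ x in D, ((w n - constBL D (c n) : BL D) : Fn D) x * g x) / ∫ x in D, g x := by
    intro n
    rw [eq_div_iff hgpos.ne', ← integral_sub (hint _) (hint _), ← integral_const_mul]
    refine integral_congr_ae ?_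
    filter_upwards [coeFn_sub_constBL (w n) (c n)] with x hx
    rw [hx]
    ring
  obtain ⟨a, ha⟩ : ∃ a, Tendsto c atTop (𝓝 a) :=
    ⟨_, ((hI.sub hJ).div_const _).congr fun n => (hcn n).symm⟩
  refine ⟨v + constBL D a, ?_, ?_⟩
  · have h := hv.add (l2LocTendsto_constBL ha)
    simpa only [← Submodule.coe_add, sub_add_cancel] using h
  · rwa [map_add, grad_constBL, add_zero]

theorem IsApprox.cauchySeq_grad {w : ℕ → Fn D} {u : Fn D} (h : IsApprox D w u) :
    CauchySeq fun n => grad D ⟨w n, (h.mem n).1⟩ := by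
  rw [Metric.cauchySeq_iff]
  intro ε hε
  obtain ⟨N, hN⟩ := h.cauchy (ε ^ 2 / 2) (by positivity)
  refine ⟨N, fun m hm n hn => ?_⟩
  have h1 := hN m hm n hn
  let a : BL D := ⟨w m, (h.mem m).1⟩
  let b : BL D := ⟨w n, (h.mem n).1⟩
  have e := dirichlet_self_eq (a - b)
  rw [Submodule.coe_sub] at e
  change (1 / 2) * dirichlet D ((a : Fn D) - (b : Fn D)) ((a : Fn D) - (b : Fn D)) < _ at h1
  rw [e, map_sub, ← dist_eq_norm] at h1
  exact lt_of_pow_lt_pow_left₀ 2 hε.le (by linarith)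

theorem IsApprox.tendsto_grad (hD : IsConnected (D : Set (EuclideanSpace ℝ (Fin d))))
    (htr : IsTransient D) {w : ℕ → Fn D} {u : Fn D} (h : IsApprox D w u) :
    L2LocTendsto D w u ∧ ∃ hu : u ∈ BL D,
      Tendsto (fun n => grad D ⟨w n, (h.mem n).1⟩) atTop (𝓝 (grad D ⟨u, hu⟩)) := by
  obtain ⟨v, hv, hgv⟩ := exists_tendsto_of_transient hD htr h.mem h.cauchySeq_grad
  have e : u = v := hv.ae_eq h.lim
  subst e
  exact ⟨hv, v.2, hgv⟩

theorem mem_extSobolev_of_tendsto {w : ℕ → BL D} (hw : ∀ n, (w n : Fn D) ∈ W12 D) {v : BL D}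
    (hv : L2LocTendsto D (fun n => (w n : Fn D)) v)
    (hg : CauchySeq fun n => grad D (w n)) : (v : Fn D) ∈ extSobolev D := by
  obtain ⟨ns, hns, hae⟩ := hv.exists_subseq
  refine ⟨fun k => w (ns k), fun k => hw _, fun ε hε => ?_, hae⟩
  obtain ⟨N, hN⟩ := Metric.cauchySeq_iff.1 (hg.comp_tendsto hns.tendsto_atTop) (Real.sqrt ε)
    (Real.sqrt_pos.2 hε)
  refine ⟨N, fun m hm n hn => ?_⟩
  have h1 := hN m hm n hn
  rw [Function.comp_apply, Function.comp_apply, dist_eq_norm, ← map_sub,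
    Real.lt_sqrt (norm_nonneg _), ← dirichlet_self_eq] at h1
  rw [← Submodule.coe_sub]
  linarith

theorem extSobolev_le_BL (hD : IsConnected (D : Set (EuclideanSpace ℝ (Fin d))))
    (htr : IsTransient D) : extSobolev D ≤ BL D := by
  rintro u ⟨w, hw⟩
  exact (hw.tendsto_grad hD htr).2.1

theorem W12_le_extSobolev : W12 D ≤ extSobolev D := fun u hu =>
  mem_extSobolev_of_tendsto (w := fun _ => ⟨u, hu.1⟩) (v := ⟨u, hu.1⟩) (fun _ => hu)
    (fun K _ _ => by simp) (cauchySeq_const _)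

theorem eq_zero_of_mem_extSobolev (hD : IsConnected (D : Set (EuclideanSpace ℝ (Fin d))))
    (htr : IsTransient D) {u : BL D} (hu : (u : Fn D) ∈ extSobolev D) (h0 : grad D u = 0) :
    u = 0 := by
  obtain ⟨w, hw⟩ := hu
  obtain ⟨hlim, hu', hg⟩ := hw.tendsto_grad hD htr
  obtain ⟨g, K, C, hK, hKD, hgm, hg0, hgpos, hgb⟩ := htr.exists_bounded_functional hD.nonempty
  obtain ⟨c, hc⟩ := eq_const_of_grad_eq_zero hD u h0
  have h1 := hlim.tendsto_integral_mul (fun n => (hw.mem n).1.1) u.2.1 hK hKD hgm hg0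
  have h2 : Tendsto (fun n => ∫ x in D, w n x * g x) atTop (𝓝 0) := by
    refine squeeze_zero_norm (fun n => hgb ⟨w n, (hw.mem n).1⟩ (hw.mem n)) ?_
    have := (hg.norm).const_mul C
    rw [show grad D ⟨u, hu'⟩ = 0 from h0] at this
    simpa using this
  have h3 : ∫ x in D, (u : Fn D) x * g x = c * ∫ x in D, g x := by
    rw [← integral_const_mul]
    refine integral_congr_ae ?_
    filter_upwards [AEEqFun.coeFn_const (μ := leb D) _ c] with x hx
    rw [hc, hx, Function.const_apply]
  have h4 := tendsto_nhds_unique h1 h2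
  rw [h3] at h4
  have hc0 : c = 0 := (mul_eq_zero.1 h4).resolve_right hgpos.ne'
  refine Subtype.ext ?_
  rw [hc, hc0]
  rfl

variable (D) in
/-- The closure in `L²(D)^d` of the gradients of the functions in `W^{1,2}(D)`. -/
def gradClosure : Submodule ℝ (PiLp 2 (fun _ : Fin d => Lp ℝ 2 (leb D))) :=
  (((W12 D).comap (BL D).subtype).map (grad D)).topologicalClosure

theorem mem_gradClosure_iff (hD : IsConnected (D : Set (EuclideanSpace ℝ (Fin d))))
    (htr : IsTransient D) {G : PiLp 2 (fun _ : Fin d => Lp ℝ 2 (leb D))} :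
    G ∈ gradClosure D ↔ ∃ u : BL D, (u : Fn D) ∈ extSobolev D ∧ grad D u = G := by
  constructor
  · intro hG
    obtain ⟨s, hs, hlim⟩ := mem_closure_iff_seq_limit.1 hG
    choose w hw hws using hs
    have hlim' : Tendsto (fun n => grad D (w n)) atTop (𝓝 G) := by simpa only [hws] using hlim
    obtain ⟨v, hv, hgv⟩ := exists_tendsto_of_transient hD htr hw hlim'.cauchySeq
    exact ⟨v, mem_extSobolev_of_tendsto hw hv hlim'.cauchySeq, tendsto_nhds_unique hgv hlim'⟩
  · rintro ⟨u, ⟨w, hw⟩, rfl⟩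
    obtain ⟨-, hu', hg⟩ := hw.tendsto_grad hD htr
    exact mem_closure_of_tendsto hg (Eventually.of_forall fun n =>
      ⟨⟨w n, (hw.mem n).1⟩, hw.mem n, rfl⟩)

theorem norm_gradDot (x : BLdot D) : ‖gradDot D x‖ = Real.sqrt 2 * ‖x‖ := by
  have h1 : inner ℝ x x = (1 / 2) * inner ℝ (gradDot D x) (gradDot D x) := rfl
  rw [real_inner_self_eq_norm_sq, real_inner_self_eq_norm_sq] at h1
  rw [← Real.sqrt_sq (norm_nonneg (gradDot D x)), ← Real.sqrt_sq (norm_nonneg x),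
    ← Real.sqrt_mul zero_le_two]
  congr 1
  linarith

theorem lipschitzWith_gradDot : LipschitzWith (Real.toNNReal (Real.sqrt 2)) (gradDot D) := by
  refine LipschitzWith.of_dist_le_mul fun x y => ?_
  rw [dist_eq_norm, dist_eq_norm, ← map_sub, norm_gradDot,
    Real.coe_toNNReal _ (Real.sqrt_nonneg _)]

theorem toBLdot_surjective : Function.Surjective (toBLdot D) := Submodule.mkQ_surjective _

theorem gradDot_toBLdot (u : BL D) : gradDot D (toBLdot D u) = grad D u := rfl

theorem eq_zero_of_gradDot_eq_zero (hD : IsConnected (D : Set (EuclideanSpace ℝ (Fin d))))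
    {x : BLdot D} (hx : gradDot D x = 0) : x = 0 := by
  obtain ⟨u, rfl⟩ := toBLdot_surjective x
  rw [gradDot_toBLdot] at hx
  exact (Submodule.Quotient.mk_eq_zero _).2 (eq_const_of_grad_eq_zero hD u hx)

theorem completeSpace_BLdot (hD : IsConnected (D : Set (EuclideanSpace ℝ (Fin d)))) :
    CompleteSpace (BLdot D) := by
  refine Metric.complete_of_cauchySeq_tendsto fun x hx => ?_
  choose u hu using fun n => toBLdot_surjective (D := D) (x n)
  have hg : CauchySeq fun n => grad D (u n) := by
    have := lipschitzWith_gradDot.uniformContinuous.comp_cauchySeq hx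
    simpa only [← hu, Function.comp_def, gradDot_toBLdot] using this
  obtain ⟨-, v, -, hgv⟩ := exists_tendsto_sub_const hD hg
  refine ⟨toBLdot D v, ?_⟩
  rw [tendsto_iff_norm_sub_tendsto_zero] at hgv ⊢
  have := hgv.const_mul (Real.sqrt 2)⁻¹
  rw [mul_zero] at this
  refine this.congr fun n => ?_
  rw [← hu, ← map_sub, ← map_sub, ← gradDot_toBLdot, norm_gradDot, ← mul_assoc,
    inv_mul_cancel₀ (by simp), one_mul]

theorem sup_Hstar_eq_BL (hD : IsConnected (D : Set (EuclideanSpace ℝ (Fin d))))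
    (htr : IsTransient D) : extSobolev D ⊔ Hstar D = BL D := by
  refine le_antisymm (sup_le (extSobolev_le_BL hD htr) fun u hu => hu.1) fun u hu => ?_
  have hc : IsClosed (gradClosure D : Set (PiLp 2 (fun _ : Fin d => Lp ℝ 2 (leb D)))) :=
    Submodule.isClosed_topologicalClosure _
  have : CompleteSpace (gradClosure D) := hc.completeSpace_coe
  let a : BL D := ⟨u, hu⟩
  obtain ⟨e, he, hge⟩ := (mem_gradClosure_iff hD htr).1
    ((gradClosure D).starProjection_apply_mem (grad D a))
  refine Submodule.mem_sup.2 ⟨e, he, (a - e : BL D), ⟨(a - e).2, fun v hv hve => ?_⟩, ?_⟩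
  · rw [dirichlet_eq_inner (a - e) ⟨v, hv⟩, map_sub, hge]
    exact (gradClosure D).starProjection_inner_eq_zero _ _
      ((mem_gradClosure_iff hD htr).2 ⟨⟨v, hv⟩, hve, rfl⟩)
  · rw [← Submodule.coe_add, add_sub_cancel]

theorem exists_isometry_BLdot (hD : IsConnected (D : Set (EuclideanSpace ℝ (Fin d))))
    (htr : IsTransient D) :
    ∃ J : extSobolev D →ₗ[ℝ] BLdot D,
      (∀ (u : extSobolev D) (hu : (u : Fn D) ∈ BL D), J u = toBLdot D ⟨u, hu⟩) ∧
      (∀ u v : extSobolev D, inner ℝ (J u) (J v) = (1 / 2) * dirichlet D (u : Fn D) (v : Fn D)) ∧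
      Function.Injective J ∧ IsClosed (Set.range J) := by
  have hle := extSobolev_le_BL hD htr
  refine ⟨(toBLdot D).comp (Submodule.inclusion hle), fun u hu => rfl,
    fun u v => inner_toBLdot D _ _, ?_, ?_⟩
  · rw [injective_iff_map_eq_zero]
    intro u hu
    have h1 : grad D (Submodule.inclusion hle u) = 0 := by
      rw [← gradDot_toBLdot, show toBLdot D (Submodule.inclusion hle u) = 0 from hu, map_zero]
    have h2 := eq_zero_of_mem_extSobolev hD htr u.2 h1
    exact Subtype.ext (congrArg (fun z : BL D => (z : Fn D)) h2)
  · have e : Set.range ((toBLdot D).comp (Submodule.inclusion hle)) =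
        gradDot D ⁻¹' (gradClosure D : Set (PiLp 2 (fun _ : Fin d => Lp ℝ 2 (leb D)))) := by
      ext x
      constructor
      · rintro ⟨u, rfl⟩
        exact (mem_gradClosure_iff hD htr).2 ⟨Submodule.inclusion hle u, u.2, rfl⟩
      · intro hx
        obtain ⟨u, hu, hgu⟩ := (mem_gradClosure_iff hD htr).1 hx
        refine ⟨⟨u, hu⟩, ?_⟩
        refine sub_eq_zero.1 (eq_zero_of_gradDot_eq_zero hD ?_)
        rw [map_sub, ← hgu]
        exact sub_self _
    rw [e]
    exact (Submodule.isClosed_topologicalClosure _).preimage lipschitzWith_gradDot.continuous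

end BeppoLevi

end

noncomputable section

namespace BeppoLevi

/-! ### A radial approximation of the identity -/

/-- A smooth cutoff profile: positive on `(-∞, 1)` and zero on `[1, ∞)`. -/
def profile (s : ℝ) : ℝ := Real.smoothTransition (1 - s)

/-- Half the primitive of `profile` that vanishes on `[1, ∞)`. -/
def profilePrimitive (s : ℝ) : ℝ := (1 / 2) * ∫ t in (1 : ℝ)..s, profile t

theorem contDiff_profile : ContDiff ℝ ∞ profile :=
  Real.smoothTransition.contDiff.comp (contDiff_const.sub contDiff_id)

theorem profile_eq_zero {s : ℝ} (hs : 1 ≤ s) : profile s = 0 :=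
  Real.smoothTransition.zero_of_nonpos (by linarith)

theorem hasDerivAt_profilePrimitive (s : ℝ) :
    HasDerivAt profilePrimitive (profile s / 2) s := by
  have h := (intervalIntegral.integral_hasDerivAt_right
    (contDiff_profile.continuous.intervalIntegrable 1 s)
    (contDiff_profile.continuous.stronglyMeasurableAtFilter _ _)
    contDiff_profile.continuous.continuousAt).const_mul (1 / 2)
  exact h.congr_deriv (by ring)

theorem contDiff_profilePrimitive : ContDiff ℝ ∞ profilePrimitive := by
  rw [contDiff_infty_iff_deriv]
  refine ⟨fun s => (hasDerivAt_profilePrimitive s).differentiableAt, ?_⟩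
  have e : deriv profilePrimitive = fun s => profile s / 2 :=
    funext fun s => (hasDerivAt_profilePrimitive s).deriv
  rw [e]
  exact contDiff_profile.div_const 2

theorem profilePrimitive_eq_zero {s : ℝ} (hs : 1 ≤ s) : profilePrimitive s = 0 := by
  have : ∫ t in (1 : ℝ)..s, profile t = ∫ t in (1 : ℝ)..s, (0 : ℝ) :=
    intervalIntegral.integral_congr fun t ht => by
      rw [Set.uIcc_of_le hs] at ht
      exact profile_eq_zero ht.1
  rw [profilePrimitive, this]
  simp

variable {d : ℕ} {D : TopologicalSpace.Opens (EuclideanSpace ℝ (Fin d))}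

/-- The coordinate Laplacian. -/
def lap (φ : EuclideanSpace ℝ (Fin d) → ℝ) (x : EuclideanSpace ℝ (Fin d)) : ℝ :=
  ∑ i, pd i (pd i φ) x

/-- The unnormalized radial mollifier at scale `a⁻¹`. -/
def kernel (a : ℝ) (z : EuclideanSpace ℝ (Fin d)) : ℝ := a ^ d * profile (a ^ 2 * ‖z‖ ^ 2)

/-- A compactly supported function whose Laplacian is, up to a factor, the derivative of `kernel`
in the scale. -/
def kernelPotential (a : ℝ) (z : EuclideanSpace ℝ (Fin d)) : ℝ := profilePrimitive (a ^ 2 * ‖z‖ ^ 2)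

theorem contDiff_kernel (a : ℝ) :
    ContDiff ℝ ∞ (kernel a : EuclideanSpace ℝ (Fin d) → ℝ) :=
  contDiff_const.mul (contDiff_profile.comp (contDiff_const.mul (contDiff_norm_sq ℝ)))

theorem contDiff_kernelPotential (a : ℝ) :
    ContDiff ℝ ∞ (kernelPotential a : EuclideanSpace ℝ (Fin d) → ℝ) :=
  contDiff_profilePrimitive.comp (contDiff_const.mul (contDiff_norm_sq ℝ))

theorem one_le_sq_mul_norm_sq {a : ℝ} (ha : 0 < a) {z : EuclideanSpace ℝ (Fin d)}
    (hz : a⁻¹ ≤ ‖z‖) : 1 ≤ a ^ 2 * ‖z‖ ^ 2 := by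
  have : 1 ≤ a * ‖z‖ := by
    rwa [inv_le_iff_one_le_mul₀' ha] at hz
  rw [← mul_pow]
  exact one_le_pow₀ this

theorem kernel_eq_zero {a : ℝ} (ha : 0 < a) {z : EuclideanSpace ℝ (Fin d)} (hz : a⁻¹ ≤ ‖z‖) :
    kernel a z = 0 := by
  rw [kernel, profile_eq_zero (one_le_sq_mul_norm_sq ha hz), mul_zero]

theorem kernelPotential_eq_zero {a : ℝ} (ha : 0 < a) {z : EuclideanSpace ℝ (Fin d)}
    (hz : a⁻¹ ≤ ‖z‖) : kernelPotential a z = 0 :=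
  profilePrimitive_eq_zero (one_le_sq_mul_norm_sq ha hz)

theorem hasFDerivAt_comp_norm_sq {f : ℝ → ℝ} {f' : ℝ} (a : ℝ) (z : EuclideanSpace ℝ (Fin d))
    (hf : HasDerivAt f f' (a ^ 2 * ‖z‖ ^ 2)) :
    HasFDerivAt (fun z : EuclideanSpace ℝ (Fin d) => f (a ^ 2 * ‖z‖ ^ 2))
      ((f' * (2 * a ^ 2)) • innerSL ℝ z) z := by
  have h1 : HasFDerivAt (fun z : EuclideanSpace ℝ (Fin d) => a ^ 2 * ‖z‖ ^ 2)
      ((a ^ 2) • (2 • innerSL ℝ z)) z :=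
    (hasStrictFDerivAt_norm_sq z).hasFDerivAt.const_mul (a ^ 2)
  have h2 := hf.comp_hasFDerivAt z h1
  refine h2.congr_fderiv ?_
  ext v
  simp
  ring

theorem pd_comp_norm_sq {f : ℝ → ℝ} {f' : ℝ} (a : ℝ) (z : EuclideanSpace ℝ (Fin d))
    (hf : HasDerivAt f f' (a ^ 2 * ‖z‖ ^ 2)) (i : Fin d) :
    pd i (fun z : EuclideanSpace ℝ (Fin d) => f (a ^ 2 * ‖z‖ ^ 2)) z = f' * (2 * a ^ 2) * z i := by
  rw [pd, (hasFDerivAt_comp_norm_sq a z hf).fderiv]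
  simp [EuclideanSpace.inner_single_right]

theorem pd_kernelPotential (a : ℝ) (i : Fin d) :
    pd i (kernelPotential a) = fun z : EuclideanSpace ℝ (Fin d) =>
      profile (a ^ 2 * ‖z‖ ^ 2) * (a ^ 2 * z i) := by
  ext z
  unfold kernelPotential
  rw [pd_comp_norm_sq a z (hasDerivAt_profilePrimitive _) i]
  ring

theorem hasDerivAt_profile (s : ℝ) : HasDerivAt profile (deriv profile s) s :=
  (contDiff_profile.differentiable (by simp) s).hasDerivAt

theorem lap_kernelPotential (a : ℝ) (z : EuclideanSpace ℝ (Fin d)) :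
    lap (kernelPotential a) z = a ^ 2 * (d * profile (a ^ 2 * ‖z‖ ^ 2)
      + 2 * a ^ 2 * ‖z‖ ^ 2 * deriv profile (a ^ 2 * ‖z‖ ^ 2)) := by
  have h : ∀ i : Fin d, pd i (pd i (kernelPotential a)) z = a ^ 2 * profile (a ^ 2 * ‖z‖ ^ 2)
      + 2 * a ^ 4 * deriv profile (a ^ 2 * ‖z‖ ^ 2) * (z i) ^ 2 := by
    intro i
    rw [pd_kernelPotential, pd]
    have h1 := hasFDerivAt_comp_norm_sq a z (hasDerivAt_profile (a ^ 2 * ‖z‖ ^ 2))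
    have h2 : HasFDerivAt (fun z : EuclideanSpace ℝ (Fin d) => a ^ 2 * z i)
        ((a ^ 2) • (EuclideanSpace.proj i : EuclideanSpace ℝ (Fin d) →L[ℝ] ℝ)) z :=
      (EuclideanSpace.proj i : EuclideanSpace ℝ (Fin d) →L[ℝ] ℝ).hasFDerivAt.const_mul (a ^ 2)
    have h3 : fderiv ℝ (fun z : EuclideanSpace ℝ (Fin d) =>
        profile (a ^ 2 * ‖z‖ ^ 2) * (a ^ 2 * z i)) z = _ := (h1.mul h2).fderiv
    rw [h3]
    simp [EuclideanSpace.inner_single_right]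
    ring
  rw [lap, Finset.sum_congr rfl fun i _ => h i, Finset.sum_add_distrib, Finset.sum_const,
    ← Finset.mul_sum, ← EuclideanSpace.real_norm_sq_eq, Finset.card_univ, Fintype.card_fin,
    nsmul_eq_mul]
  ring

/-- The derivative of `kernel` in the scale. -/
def kernelDeriv (a : ℝ) (z : EuclideanSpace ℝ (Fin d)) : ℝ :=
  d * a ^ (d - 1) * profile (a ^ 2 * ‖z‖ ^ 2)
    + a ^ d * (deriv profile (a ^ 2 * ‖z‖ ^ 2) * (2 * a * ‖z‖ ^ 2))

theorem hasDerivAt_kernel (a : ℝ) (z : EuclideanSpace ℝ (Fin d)) :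
    HasDerivAt (fun a => kernel a z) (kernelDeriv a z) a := by
  have h1 := hasDerivAt_pow d a
  have h2 : HasDerivAt (fun a : ℝ => a ^ 2 * ‖z‖ ^ 2) (2 * a * ‖z‖ ^ 2) a := by
    simpa using (hasDerivAt_pow 2 a).mul_const (‖z‖ ^ 2)
  have h3 : HasDerivAt (fun a : ℝ => profile (a ^ 2 * ‖z‖ ^ 2))
      (deriv profile (a ^ 2 * ‖z‖ ^ 2) * (2 * a * ‖z‖ ^ 2)) a :=
    HasDerivAt.comp (h₂ := profile) a (hasDerivAt_profile (a ^ 2 * ‖z‖ ^ 2)) h2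
  exact h1.mul h3

theorem continuous_kernelDeriv :
    Continuous fun p : ℝ × EuclideanSpace ℝ (Fin d) => kernelDeriv p.1 p.2 := by
  have h1 := contDiff_profile.continuous
  have h2 : Continuous (deriv profile) := contDiff_profile.continuous_deriv (by simp)
  unfold kernelDeriv
  fun_prop

theorem pow_three_mul_kernelDeriv (a : ℝ) (z : EuclideanSpace ℝ (Fin d)) :
    a ^ 3 * kernelDeriv a z = a ^ d * lap (kernelPotential a) z := by
  rw [lap_kernelPotential, kernelDeriv]
  rcases d with _ | n
  · simp
    ring
  · simp only [Nat.add_sub_cancel]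
    push_cast
    ring

theorem integral_kernel {a : ℝ} (ha : 0 < a) (x : EuclideanSpace ℝ (Fin d)) :
    ∫ y, kernel a (x - y) = ∫ z : EuclideanSpace ℝ (Fin d), kernel 1 z := by
  rw [integral_sub_left_eq_self (fun z => kernel a z) volume x]
  have e : ∀ z : EuclideanSpace ℝ (Fin d), kernel a z = a ^ d * kernel 1 (a • z) := by
    intro z
    rw [kernel, kernel, norm_smul, mul_pow, Real.norm_eq_abs, sq_abs]
    simp
  simp_rw [e]
  rw [integral_const_mul, Measure.integral_comp_smul, finrank_euclideanSpace_fin,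
    abs_of_pos (by positivity), smul_eq_mul, ← mul_assoc, mul_inv_cancel₀ (by positivity), one_mul]

theorem kernel_nonneg {a : ℝ} (ha : 0 ≤ a) (z : EuclideanSpace ℝ (Fin d)) : 0 ≤ kernel a z :=
  mul_nonneg (by positivity) (Real.smoothTransition.nonneg _)

theorem kernel_le {a : ℝ} (ha : 0 ≤ a) (z : EuclideanSpace ℝ (Fin d)) : kernel a z ≤ a ^ d :=
  mul_le_of_le_one_right (by positivity) (Real.smoothTransition.le_one _)

theorem hasCompactSupport_kernel {a : ℝ} (ha : 0 < a) :
    HasCompactSupport (kernel a : EuclideanSpace ℝ (Fin d) → ℝ) :=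
  HasCompactSupport.intro (isCompact_closedBall 0 a⁻¹) fun z hz =>
    kernel_eq_zero ha (by simpa using (not_le.1 (fun h => hz (by simpa using h))).le)

theorem integral_kernel_pos : 0 < ∫ z : EuclideanSpace ℝ (Fin d), kernel 1 z := by
  refine (contDiff_kernel 1).continuous.integral_pos_of_hasCompactSupport_nonneg_nonzero
    (hasCompactSupport_kernel one_pos) (fun z => kernel_nonneg zero_le_one z) (x := 0) ?_
  simp [kernel, profile]

/-- Mollification by the radial kernels at the Lebesgue points of a function. -/
theorem ae_tendsto_integral_kernel {f : EuclideanSpace ℝ (Fin d) → ℝ} (hf : LocallyIntegrable f) :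
    ∀ᵐ x, Tendsto (fun a : ℝ => ∫ y, f y * kernel a (x - y)) atTop
      (𝓝 ((∫ z : EuclideanSpace ℝ (Fin d), kernel 1 z) * f x)) := by
  set c := ∫ z : EuclideanSpace ℝ (Fin d), kernel 1 z with hc
  have hcpos : 0 < c := integral_kernel_pos
  filter_upwards [(Besicovitch.vitaliFamily
    (volume : Measure (EuclideanSpace ℝ (Fin d)))).ae_tendsto_average_norm_sub hf] with x hx
  have hinv : Tendsto (fun a : ℝ => a⁻¹) atTop (𝓝[>] 0) := tendsto_inv_atTop_nhdsGT_zero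
  have h0 := (hx.comp (Besicovitch.tendsto_filterAt volume x)).comp hinv
  have key := tendsto_integral_smul_of_tendsto_average_norm_sub
    (g := fun a y => c⁻¹ * kernel a (x - y))
    (c⁻¹ * volume.real (Metric.ball (0 : EuclideanSpace ℝ (Fin d)) 1)) h0
    (Eventually.of_forall fun a => hf.integrableOn_isCompact (isCompact_closedBall _ _))
    (by
      refine tendsto_const_nhds.congr' ?_
      filter_upwards [eventually_gt_atTop 0] with a ha
      rw [integral_const_mul, integral_kernel ha, ← hc, inv_mul_cancel₀ hcpos.ne'])
    (by
      filter_upwards [eventually_gt_atTop 0] with a ha y hy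
      by_contra hy'
      refine hy ?_
      simp only
      rw [kernel_eq_zero ha, mul_zero]
      rw [Metric.mem_closedBall, not_le, dist_comm, dist_eq_norm] at hy'
      exact hy'.le)
    (by
      filter_upwards [eventually_gt_atTop 0] with a ha y
      rw [abs_of_nonneg (mul_nonneg (by positivity) (kernel_nonneg ha.le _)),
        Measure.addHaar_real_closedBall volume x (by positivity), finrank_euclideanSpace_fin]
      have hv : 0 < volume.real (Metric.ball (0 : EuclideanSpace ℝ (Fin d)) 1) :=
        ENNReal.toReal_pos (Metric.measure_ball_pos volume _ one_pos).ne' measure_ball_lt_top.ne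
      rw [mul_div_mul_right _ _ hv.ne', inv_pow, div_inv_eq_mul]
      exact mul_le_mul_of_nonneg_left (kernel_le ha.le _) (by positivity))
  have h1 := key.const_mul c
  refine h1.congr fun a => ?_
  rw [← integral_const_mul]
  refine integral_congr_ae (Eventually.of_forall fun y => ?_)
  simp only [smul_eq_mul]
  field_simp

end BeppoLevi

end

noncomputable section

namespace BeppoLevi

/-! ### Weyl's lemma -/

variable {d : ℕ} {D : TopologicalSpace.Opens (EuclideanSpace ℝ (Fin d))}

theorem contDiff_pd {φ : EuclideanSpace ℝ (Fin d) → ℝ} (hφ : ContDiff ℝ ∞ φ) (i : Fin d) :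
    ContDiff ℝ ∞ (pd i φ) :=
  (hφ.fderiv_right (m := ∞) (by simp)).clm_apply contDiff_const

theorem tsupport_pd_subset (φ : EuclideanSpace ℝ (Fin d) → ℝ) (i : Fin d) :
    tsupport (pd i φ) ⊆ tsupport φ :=
  closure_minimal (fun x hx => by
    by_contra h
    exact hx (pd_eq_zero i h)) (isClosed_tsupport φ)

theorem hasCompactSupport_pd {φ : EuclideanSpace ℝ (Fin d) → ℝ} (hφ : HasCompactSupport φ)
    (i : Fin d) : HasCompactSupport (pd i φ) :=
  hφ.of_isClosed_subset (isClosed_tsupport _) (tsupport_pd_subset φ i)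

theorem IsTest.pd {φ : EuclideanSpace ℝ (Fin d) → ℝ} (hφ : IsTest D φ) (i : Fin d) :
    IsTest D (pd i φ) :=
  ⟨contDiff_pd hφ.smooth i, hasCompactSupport_pd hφ.compact i,
    (tsupport_pd_subset φ i).trans hφ.supp⟩

theorem lap_eq_zero {φ : EuclideanSpace ℝ (Fin d) → ℝ} {x : EuclideanSpace ℝ (Fin d)}
    (hx : x ∉ tsupport φ) : lap φ x = 0 :=
  Finset.sum_eq_zero fun i _ => pd_eq_zero i fun h => hx (tsupport_pd_subset φ i h)

theorem pd_comp_const_sub {ψ : EuclideanSpace ℝ (Fin d) → ℝ} (hψ : Differentiable ℝ ψ) (i : Fin d)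
    (x y : EuclideanSpace ℝ (Fin d)) : pd i (fun y => ψ (x - y)) y = - pd i ψ (x - y) := by
  have h1 : HasFDerivAt (fun y : EuclideanSpace ℝ (Fin d) => x - y)
      (-ContinuousLinearMap.id ℝ (EuclideanSpace ℝ (Fin d))) y := (hasFDerivAt_id y).const_sub x
  have h2 : HasFDerivAt (fun y => ψ (x - y)) _ y := (hψ (x - y)).hasFDerivAt.comp y h1
  rw [pd, h2.fderiv, pd]
  simp

theorem lap_comp_const_sub {ψ : EuclideanSpace ℝ (Fin d) → ℝ} (hψ : ContDiff ℝ ∞ ψ)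
    (x y : EuclideanSpace ℝ (Fin d)) : lap (fun y => ψ (x - y)) y = lap ψ (x - y) := by
  refine Finset.sum_congr rfl fun i _ => ?_
  have h1 : pd i (fun y => ψ (x - y)) = fun y => (- pd i ψ) (x - y) :=
    funext fun y => pd_comp_const_sub (hψ.differentiable (by simp)) i x y
  have h2 : Differentiable ℝ (-pd i ψ) := (contDiff_pd hψ i).neg.differentiable (by simp)
  rw [h1, pd_comp_const_sub h2 i x y]
  simp [pd, fderiv_neg]

theorem tsupport_comp_const_sub_subset {ψ : EuclideanSpace ℝ (Fin d) → ℝ} {r : ℝ}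
    (hψ : ∀ z, r ≤ ‖z‖ → ψ z = 0) (x : EuclideanSpace ℝ (Fin d)) :
    tsupport (fun y => ψ (x - y)) ⊆ Metric.closedBall x r := by
  refine closure_minimal (fun y hy => ?_) Metric.isClosed_closedBall
  by_contra h
  rw [Metric.mem_closedBall, not_le, dist_comm, dist_eq_norm] at h
  exact hy (hψ _ h.le)

theorem isTest_comp_const_sub {ψ : EuclideanSpace ℝ (Fin d) → ℝ} (hψ : ContDiff ℝ ∞ ψ) {r : ℝ}
    (h0 : ∀ z, r ≤ ‖z‖ → ψ z = 0) {x : EuclideanSpace ℝ (Fin d)}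
    (hD : Metric.closedBall x r ⊆ D) : IsTest D (fun y => ψ (x - y)) :=
  ⟨hψ.comp (contDiff_const.sub contDiff_id),
    (isCompact_closedBall x r).of_isClosed_subset (isClosed_tsupport _)
      (tsupport_comp_const_sub_subset h0 x), (tsupport_comp_const_sub_subset h0 x).trans hD⟩

theorem integral_kernel_eq {u : EuclideanSpace ℝ (Fin d) → ℝ}
    (hu : ∀ K : Set (EuclideanSpace ℝ (Fin d)), IsCompact K → K ⊆ D → IntegrableOn u K)
    (hw : ∀ φ, IsTest D φ → ∫ x in D, u x * lap φ x = 0) {x : EuclideanSpace ℝ (Fin d)} {a b : ℝ}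
    (ha : 0 < a) (hab : a ≤ b) (hD : Metric.closedBall x a⁻¹ ⊆ D) :
    ∫ y in D, u y * kernel b (x - y) = ∫ y in D, u y * kernel a (x - y) := by
  set K := Metric.closedBall x a⁻¹ with hKdef
  have hK : IsCompact K := isCompact_closedBall x a⁻¹
  have hout : ∀ t, a ≤ t → ∀ y ∉ K, t⁻¹ ≤ ‖x - y‖ := by
    intro t hat y hy
    rw [hKdef, Metric.mem_closedBall, not_le, dist_comm, dist_eq_norm] at hy
    exact (inv_anti₀ ha hat).trans hy.le
  have e : ∀ t, a ≤ t → ∫ y in D, u y * kernel t (x - y) = ∫ y in K, u y * kernel t (x - y) :=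
    fun t hat => (setIntegral_eq_of_support_subset hD fun y hy => by
      rw [kernel_eq_zero (ha.trans_le hat) (hout t hat y hy), mul_zero]).symm
  have hder := hasDerivAt_setIntegral_mul hK (hu K hK hD) (F := fun t y => kernel t (x - y))
    (F' := fun t y => kernelDeriv t (x - y)) (fun t y => hasDerivAt_kernel t (x - y))
    (fun t => (contDiff_kernel t).continuous.comp (continuous_const.sub continuous_id))
    (continuous_kernelDeriv.comp (by fun_prop :
      Continuous fun p : ℝ × EuclideanSpace ℝ (Fin d) => (p.1, x - p.2)))
  have hzero : ∀ t, a ≤ t → ∫ y in K, u y * kernelDeriv t (x - y) = 0 := by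
    intro t hat
    have ht : 0 < t := ha.trans_le hat
    have hballs : Metric.closedBall x t⁻¹ ⊆ K := Metric.closedBall_subset_closedBall (inv_anti₀ ha hat)
    have htest : IsTest D (fun y => kernelPotential t (x - y)) :=
      isTest_comp_const_sub (contDiff_kernelPotential t) (fun z => kernelPotential_eq_zero ht)
        (hballs.trans hD)
    have h1 := hw _ htest
    rw [← setIntegral_eq_of_support_subset hD (fun y hy => by
      rw [lap_eq_zero fun h => hy (hballs (tsupport_comp_const_sub_subset
        (fun z => kernelPotential_eq_zero ht) x h)), mul_zero])] at h1
    simp_rw [lap_comp_const_sub (contDiff_kernelPotential t)] at h1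
    have h2 : t ^ 3 * ∫ y in K, u y * kernelDeriv t (x - y)
        = t ^ d * ∫ y in K, u y * lap (kernelPotential t) (x - y) := by
      rw [← integral_const_mul, ← integral_const_mul]
      refine integral_congr_ae (Eventually.of_forall fun y => ?_)
      simp only
      rw [mul_left_comm, pow_three_mul_kernelDeriv, mul_left_comm]
    rw [h1, mul_zero] at h2
    exact (mul_eq_zero.1 h2).resolve_left (by positivity)
  rw [e b hab, e a le_rfl]
  refine constant_of_has_deriv_right_zero (b := b)
    (fun t _ => (hder t).continuousAt.continuousWithinAt) (fun t ht => ?_) b ⟨hab, le_rfl⟩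
  have := (hder t).hasDerivWithinAt (s := Set.Ici t)
  rwa [hzero t ht.1] at this

theorem contDiff_setIntegral_comp_sub {K : Set (EuclideanSpace ℝ (Fin d))} (hK : IsCompact K)
    {u ψ : EuclideanSpace ℝ (Fin d) → ℝ} (hu : IntegrableOn u K) (hψ : ContDiff ℝ ∞ ψ)
    (hc : HasCompactSupport ψ) : ContDiff ℝ ∞ fun x => ∫ y in K, u y * ψ (x - y) := by
  have h1 : LocallyIntegrable (K.indicator u) :=
    ((integrable_indicator_iff hK.measurableSet).2 hu).locallyIntegrable
  have h2 := hc.contDiff_convolution_right (ContinuousLinearMap.lsmul ℝ ℝ) h1 (n := ⊤) hψ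
  convert h2 using 1
  ext x
  rw [convolution_def, ← integral_indicator hK.measurableSet]
  refine integral_congr_ae (Eventually.of_forall fun y => ?_)
  by_cases hy : y ∈ K <;> simp [hy]

theorem pd_setIntegral_comp_sub {K : Set (EuclideanSpace ℝ (Fin d))} (hK : IsCompact K)
    {u ψ : EuclideanSpace ℝ (Fin d) → ℝ} (hu : IntegrableOn u K) (hψ : ContDiff ℝ ∞ ψ)
    (hc : HasCompactSupport ψ) (i : Fin d) :
    pd i (fun x => ∫ y in K, u y * ψ (x - y)) = fun x => ∫ y in K, u y * pd i ψ (x - y) := by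
  ext x
  set e : EuclideanSpace ℝ (Fin d) := EuclideanSpace.single i 1 with he
  have hJ := (contDiff_setIntegral_comp_sub hK hu hψ hc).differentiable (by simp) x
  have hline : ∀ z : EuclideanSpace ℝ (Fin d), ∀ s : ℝ,
      HasDerivAt (fun s : ℝ => z + s • e) e s := by
    intro z s
    simpa using ((hasDerivAt_id s).smul_const e).const_add z
  have h1 : HasDerivAt (fun s : ℝ => ∫ y in K, u y * ψ (x + s • e - y))
      (fderiv ℝ (fun x => ∫ y in K, u y * ψ (x - y)) x e) 0 :=
    HasFDerivAt.comp_hasDerivAt (l := fun x => ∫ y in K, u y * ψ (x - y)) (0 : ℝ)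
      (by simpa using hJ.hasFDerivAt) (hline x 0)
  have h2 := hasDerivAt_setIntegral_mul hK hu (F := fun s y => ψ (x + s • e - y))
    (F' := fun s y => pd i ψ (x + s • e - y)) (fun s y => by
      have h3 := (hψ.differentiable (by simp) (x + s • e - y)).hasFDerivAt.comp_hasDerivAt s
        ((hline x s).sub_const y)
      simpa [Function.comp_def, pd, he] using h3)
    (fun s => hψ.continuous.comp (by fun_prop))
    ((contDiff_pd hψ i).continuous.comp (by fun_prop :
      Continuous fun p : ℝ × EuclideanSpace ℝ (Fin d) => x + p.1 • e - p.2)) 0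
  have h4 := h1.unique h2
  simpa [pd] using h4

theorem lap_setIntegral_comp_sub {K : Set (EuclideanSpace ℝ (Fin d))} (hK : IsCompact K)
    {u ψ : EuclideanSpace ℝ (Fin d) → ℝ} (hu : IntegrableOn u K) (hψ : ContDiff ℝ ∞ ψ)
    (hc : HasCompactSupport ψ) (x : EuclideanSpace ℝ (Fin d)) :
    lap (fun x => ∫ y in K, u y * ψ (x - y)) x = ∫ y in K, u y * lap ψ (x - y) := by
  simp only [lap, Finset.mul_sum]
  rw [integral_finsetSum]
  · refine Finset.sum_congr rfl fun i _ => ?_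
    rw [pd_setIntegral_comp_sub hK hu hψ hc,
      pd_setIntegral_comp_sub hK hu (contDiff_pd hψ i) (hasCompactSupport_pd hc i)]
  · intro i _
    exact hu.mul_continuousOn (((contDiff_pd (contDiff_pd hψ i) i).continuous.comp
      (continuous_const.sub continuous_id)).continuousOn) hK

theorem laplacian_eq_lap {f : EuclideanSpace ℝ (Fin d) → ℝ} (hf : ContDiff ℝ ∞ f)
    (x : EuclideanSpace ℝ (Fin d)) : Laplacian.laplacian f x = lap f x := by
  rw [InnerProductSpace.laplacian_eq_iteratedFDeriv_orthonormalBasis f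
    (EuclideanSpace.basisFun (Fin d) ℝ)]
  refine Finset.sum_congr rfl fun i _ => ?_
  rw [iteratedFDeriv_two_apply, pd]
  have h1 : DifferentiableAt ℝ (fderiv ℝ f) x :=
    (hf.fderiv_right (m := ∞) (by simp)).differentiable (by simp) x
  have h2 : HasFDerivAt (pd i f) _ x :=
    h1.hasFDerivAt.clm_apply (hasFDerivAt_const (EuclideanSpace.single i (1 : ℝ)) x)
  rw [h2.fderiv]
  simp

/-- **Weyl's lemma**: a weakly harmonic function is a.e. equal to a harmonic function. -/
theorem exists_harmonic_of_weakly_harmonic {u : EuclideanSpace ℝ (Fin d) → ℝ}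
    (hu : ∀ K : Set (EuclideanSpace ℝ (Fin d)), IsCompact K → K ⊆ D → IntegrableOn u K)
    (hw : ∀ φ, IsTest D φ → ∫ x in D, u x * lap φ x = 0) :
    ∃ h : EuclideanSpace ℝ (Fin d) → ℝ,
      InnerProductSpace.HarmonicOnNhd h (D : Set (EuclideanSpace ℝ (Fin d))) ∧
      ∀ᵐ x ∂(leb D), u x = h x := by
  set c := ∫ z : EuclideanSpace ℝ (Fin d), kernel 1 z with hc
  have hcpos : 0 < c := integral_kernel_pos
  have hrad : ∀ x ∈ D, ∃ a : ℝ, 0 < a ∧ Metric.closedBall x a⁻¹ ⊆ D := by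
    intro x hx
    obtain ⟨r, hr, hrD⟩ := Metric.nhds_basis_closedBall.mem_iff.1 (D.isOpen.mem_nhds hx)
    exact ⟨r⁻¹, inv_pos.2 hr, by rwa [inv_inv]⟩
  choose! a ha haD using hrad
  let h : EuclideanSpace ℝ (Fin d) → ℝ := fun x => ∫ y in D, (c⁻¹ * u y) * kernel (a x) (x - y)
  have hval : ∀ x ∈ D, ∀ b : ℝ, 0 < b → Metric.closedBall x b⁻¹ ⊆ D →
      ∫ y in D, u y * kernel b (x - y) = c * h x := by
    intro x hx b hb hbD
    have e : ∫ y in D, u y * kernel b (x - y) = ∫ y in D, u y * kernel (a x) (x - y) := by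
      rcases le_total b (a x) with hle | hle
      · exact (integral_kernel_eq hu hw hb hle hbD).symm
      · exact integral_kernel_eq hu hw (ha x hx) hle (haD x hx)
    rw [e, ← integral_const_mul]
    refine integral_congr_ae (Eventually.of_forall fun y => ?_)
    simp only
    field_simp
  refine ⟨h, fun x₀ hx₀ => ?_, ?_⟩
  · obtain ⟨r, hr, hrD⟩ := Metric.nhds_basis_closedBall.mem_iff.1 (D.isOpen.mem_nhds hx₀)
    set K := Metric.closedBall x₀ r with hKdef
    have hK : IsCompact K := isCompact_closedBall x₀ r
    have huK : IntegrableOn (fun y => c⁻¹ * u y) K := (hu K hK hrD).const_mul c⁻¹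
    set b : ℝ := (r / 2)⁻¹ with hb
    have hbpos : 0 < b := by positivity
    let J : EuclideanSpace ℝ (Fin d) → ℝ := fun x => ∫ y in K, (c⁻¹ * u y) * kernel b (x - y)
    have hJs : ContDiff ℝ ∞ J :=
      contDiff_setIntegral_comp_sub hK huK (contDiff_kernel b) (hasCompactSupport_kernel hbpos)
    have hsub : ∀ x ∈ Metric.ball x₀ (r / 2), Metric.closedBall x b⁻¹ ⊆ K := by
      intro x hx
      refine Metric.closedBall_subset_closedBall' ?_
      rw [hb, inv_inv]
      have := Metric.mem_ball.1 hx
      linarith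
    have hnhds : Metric.ball x₀ (r / 2) ∈ 𝓝 x₀ := Metric.ball_mem_nhds x₀ (by positivity)
    have hoff : ∀ x ∈ Metric.ball x₀ (r / 2), ∀ y ∉ K, b⁻¹ ≤ ‖x - y‖ := by
      intro x hx y hy
      by_contra hcon
      refine hy (hsub x hx ?_)
      rw [Metric.mem_closedBall, dist_comm, dist_eq_norm]
      exact (not_le.1 hcon).le
    have hJh : h =ᶠ[𝓝 x₀] J := by
      filter_upwards [hnhds] with x hx
      have hxD : x ∈ D := hrD ((hsub x hx) (Metric.mem_closedBall_self (by positivity)))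
      have h1 := hval x hxD b hbpos ((hsub x hx).trans hrD)
      have h2 : J x = c⁻¹ * ∫ y in D, u y * kernel b (x - y) := by
        rw [← integral_const_mul, ← setIntegral_eq_of_support_subset hrD fun y hy => by
          rw [kernel_eq_zero hbpos (hoff x hx y hy), mul_zero, mul_zero]]
        simp only [J, mul_assoc]
      rw [h2, h1, ← mul_assoc, inv_mul_cancel₀ hcpos.ne', one_mul]
    rw [InnerProductSpace.harmonicAt_congr_nhds hJh]
    refine ⟨(contDiff_infty.1 hJs 2).contDiffAt, ?_⟩
    filter_upwards [hnhds] with x hx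
    rw [laplacian_eq_lap hJs, lap_setIntegral_comp_sub hK huK (contDiff_kernel b)
      (hasCompactSupport_kernel hbpos)]
    have hts : tsupport (fun y => kernel b (x - y)) ⊆ Metric.closedBall x b⁻¹ :=
      tsupport_comp_const_sub_subset (fun z => kernel_eq_zero hbpos) x
    have h1 := hw _ (isTest_comp_const_sub (contDiff_kernel b)
      (fun z => kernel_eq_zero hbpos) ((hsub x hx).trans hrD))
    rw [← setIntegral_eq_of_support_subset hrD fun y hy => by
      rw [lap_eq_zero fun hy' => hy (hsub x hx (hts hy')), mul_zero]] at h1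
    simp_rw [lap_comp_const_sub (contDiff_kernel b)] at h1
    simp_rw [mul_assoc]
    rw [integral_const_mul, h1, mul_zero]
    rfl
  · refine ae_leb_of_compact fun L hL hLD => ?_
    obtain ⟨δ, hδ, hδD⟩ := hL.exists_cthickening_subset_open D.isOpen hLD
    set M := Metric.cthickening δ L with hM
    have hMc : IsCompact M := hL.cthickening
    have hloc : LocallyIntegrable (M.indicator u) :=
      ((integrable_indicator_iff hMc.measurableSet).2 (hu M hMc hδD)).locallyIntegrable
    have hae := ae_restrict_of_ae (s := L) (ae_tendsto_integral_kernel hloc)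
    filter_upwards [hae, ae_restrict_mem hL.measurableSet] with x hx hxL
    have hxM : x ∈ M := Metric.self_subset_cthickening L hxL
    rw [Set.indicator_of_mem hxM] at hx
    have hev : ∀ᶠ b : ℝ in atTop, ∫ y, M.indicator u y * kernel b (x - y) = c * h x := by
      filter_upwards [eventually_ge_atTop δ⁻¹] with b hb
      have hb0 : 0 < b := (inv_pos.2 hδ).trans_le hb
      have hbδ : b⁻¹ ≤ δ := by
        rw [← inv_inv δ]
        exact inv_anti₀ (inv_pos.2 hδ) hb
      have hball : Metric.closedBall x b⁻¹ ⊆ M :=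
        (Metric.closedBall_subset_closedBall hbδ).trans
          (Metric.closedBall_subset_cthickening hxL δ)
      rw [← hval x (hLD hxL) b hb0 (hball.trans hδD),
        ← setIntegral_eq_of_support_subset hδD fun y hy => ?_,
        ← integral_indicator hMc.measurableSet]
      · refine integral_congr_ae (Eventually.of_forall fun y => ?_)
        by_cases hy : y ∈ M <;> simp [hy]
      · rw [kernel_eq_zero hb0, mul_zero]
        by_contra hcon
        refine hy (hball ?_)
        rw [Metric.mem_closedBall, dist_comm, dist_eq_norm]
        exact (not_le.1 hcon).le
    have h1 := tendsto_nhds_unique hx (tendsto_const_nhds.congr' (EventuallyEq.symm hev))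
    exact mul_left_cancel₀ hcpos.ne' h1

/-! ### Harmonicity of the functions in `ℍ*(D)` -/

theorem isWeakPartial_testToLp {φ : EuclideanSpace ℝ (Fin d) → ℝ} (hφ : IsTest D φ) (i : Fin d) :
    IsWeakPartial D i (testToLp D ⟨φ, hφ⟩ : Fn D) (testToLp D ⟨pd i φ, hφ.pd i⟩) := by
  intro ψ hψ
  have hcoe : ∀ {χ : EuclideanSpace ℝ (Fin d) → ℝ} (hχ : IsTest D χ),
      testToLp D ⟨χ, hχ⟩ =ᵐ[leb D] χ := fun hχ =>
    (hχ.memLp.restrict (D : Set (EuclideanSpace ℝ (Fin d)))).coeFn_toLp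
  have e1 : ∫ x in D, (testToLp D ⟨φ, hφ⟩ : Fn D) x * pd i ψ x = ∫ x, φ x * pd i ψ x := by
    refine Eq.trans (integral_congr_ae ?_) (setIntegral_eq_integral_of_forall_compl_eq_zero
      (s := (D : Set (EuclideanSpace ℝ (Fin d)))) (f := fun x => φ x * pd i ψ x) fun x hx => by
        rw [pd_eq_zero i fun hx' => hx (hψ.supp hx'), mul_zero])
    filter_upwards [hcoe hφ] with x hx
    rw [hx]
  have e2 : ∫ x in D, testToLp D ⟨pd i φ, hφ.pd i⟩ x * ψ x = ∫ x, pd i φ x * ψ x := by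
    refine Eq.trans (integral_congr_ae ?_) (setIntegral_eq_integral_of_forall_compl_eq_zero
      (s := (D : Set (EuclideanSpace ℝ (Fin d)))) (f := fun x => pd i φ x * ψ x) fun x hx => by
        rw [pd_eq_zero i fun hx' => hx (hφ.supp hx'), zero_mul])
    filter_upwards [hcoe (hφ.pd i)] with x hx
    rw [hx]
  rw [e1, e2]
  exact integral_mul_fderiv_eq_neg_fderiv_mul_of_integrable (μ := volume)
    (v := EuclideanSpace.single i 1)
    (((hφ.pd i).memLp).integrable_mul hψ.memLp) (hφ.memLp.integrable_mul (hψ.pd i).memLp)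
    (hφ.memLp.integrable_mul hψ.memLp)
    (fun x _ => hφ.smooth.differentiable (by simp) x)
    (fun x _ => hψ.smooth.differentiable (by simp) x)

theorem testToLp_mem_W12 {φ : EuclideanSpace ℝ (Fin d) → ℝ} (hφ : IsTest D φ) :
    (testToLp D ⟨φ, hφ⟩ : Fn D) ∈ W12 D :=
  ⟨⟨isL2Loc_of_mem _, fun i => ⟨_, isWeakPartial_testToLp hφ i⟩⟩, (testToLp D ⟨φ, hφ⟩).2⟩

theorem integral_mul_lap_eq_zero_of_mem_Hstar {u : Fn D} (hu : u ∈ Hstar D)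
    {φ : EuclideanSpace ℝ (Fin d) → ℝ} (hφ : IsTest D φ) : ∫ x in D, u x * lap φ x = 0 := by
  have hW := testToLp_mem_W12 hφ
  have h1 := hu.2 _ hW.1 (W12_le_extSobolev hW)
  have h2 : ∫ x in D, u x * lap φ x = - dirichlet D u (testToLp D ⟨φ, hφ⟩ : Fn D) := by
    simp only [lap, Finset.mul_sum, dirichlet]
    rw [integral_finsetSum _ fun i _ => (hφ.pd i).integrable_mul_pd i hu.1.1,
      ← Finset.sum_neg_distrib]
    refine Finset.sum_congr rfl fun i _ => ?_
    rw [weakPartial_spec hu.1 i _ (hφ.pd i), weakPartial_eq hW.1 (isWeakPartial_testToLp hφ i)]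
    congr 1
    refine integral_congr_ae ?_
    filter_upwards [((hφ.pd i).memLp.restrict
      (D : Set (EuclideanSpace ℝ (Fin d)))).coeFn_toLp] with x hx
    rw [show testToLp D ⟨pd i φ, hφ.pd i⟩ x = pd i φ x from hx]
  rw [h2, h1, neg_zero]

theorem exists_harmonic_of_mem_Hstar {u : Fn D} (hu : u ∈ Hstar D) :
    ∃ h : EuclideanSpace ℝ (Fin d) → ℝ,
      InnerProductSpace.HarmonicOnNhd h (D : Set (EuclideanSpace ℝ (Fin d))) ∧
      ∀ᵐ x ∂(leb D), u x = h x :=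
  exists_harmonic_of_weakly_harmonic (fun _ hK hKD => hu.1.1.integrableOn hK hKD)
    fun _ hφ => integral_mul_lap_eq_zero_of_mem_Hstar hu hφ

end BeppoLevi

end

theorem mainTheorem10 (d : ℕ) (D : TopologicalSpace.Opens (EuclideanSpace ℝ (Fin d)))
    (hD : IsConnected (D : Set (EuclideanSpace ℝ (Fin d))))
    (htr : BeppoLevi.IsTransient D) :
    -- the quotient of `BL(D)` by constants, with inner product `½𝐃`, is a Hilbert space
    ((∀ x : BeppoLevi.BLdot D, inner ℝ x x = (0 : ℝ) → x = 0) ∧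
      CompleteSpace (BeppoLevi.BLdot D)) ∧
    -- `W_e^{1,2}(D) ⊆ BL(D)`, and `½𝐃` is the extended form on `W_e^{1,2}(D)`
    BeppoLevi.extSobolev D ≤ BeppoLevi.BL D ∧
    (∀ u ∈ BeppoLevi.extSobolev D, ∀ w : ℕ → BeppoLevi.Fn D, BeppoLevi.IsApprox D w u →
      Tendsto (fun n => (1 / 2) * BeppoLevi.dirichlet D (w n) (w n)) atTop
        (𝓝 ((1 / 2) * BeppoLevi.dirichlet D u u))) ∧
    -- the canonical map restricted to `W_e^{1,2}(D)` is injective and isometric, with closed range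
    (∃ J : BeppoLevi.extSobolev D →ₗ[ℝ] BeppoLevi.BLdot D,
      (∀ (u : BeppoLevi.extSobolev D) (hu : (u : BeppoLevi.Fn D) ∈ BeppoLevi.BL D),
        J u = BeppoLevi.toBLdot D ⟨u, hu⟩) ∧
      (∀ u v : BeppoLevi.extSobolev D,
        inner ℝ (J u) (J v) =
          (1 / 2) * BeppoLevi.dirichlet D (u : BeppoLevi.Fn D) (v : BeppoLevi.Fn D)) ∧
      Function.Injective J ∧
      IsClosed (Set.range J)) ∧
    -- `BL(D)` is spanned by `W_e^{1,2}(D)` and `ℍ*(D)`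
    BeppoLevi.extSobolev D ⊔ BeppoLevi.Hstar D = BeppoLevi.BL D ∧
    -- every function in `ℍ*(D)` has a harmonic version
    (∀ u ∈ BeppoLevi.Hstar D, ∃ h : EuclideanSpace ℝ (Fin d) → ℝ,
      InnerProductSpace.HarmonicOnNhd h (D : Set (EuclideanSpace ℝ (Fin d))) ∧
      ∀ᵐ x ∂(BeppoLevi.leb D), u x = h x) := by
  refine ⟨⟨fun x hx => BeppoLevi.eq_zero_of_gradDot_eq_zero hD ?_,
    BeppoLevi.completeSpace_BLdot hD⟩, BeppoLevi.extSobolev_le_BL hD htr, fun u _ w hw => ?_,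
    BeppoLevi.exists_isometry_BLdot hD htr, BeppoLevi.sup_Hstar_eq_BL hD htr,
    fun u hu => BeppoLevi.exists_harmonic_of_mem_Hstar hu⟩
  · change (1 / 2 : ℝ) * inner ℝ (BeppoLevi.gradDot D x) (BeppoLevi.gradDot D x) = 0 at hx
    exact inner_self_eq_zero.1 ((mul_eq_zero.1 hx).resolve_left (by norm_num))
  · obtain ⟨-, hu, hlim⟩ := hw.tendsto_grad hD htr
    have hsq := (hlim.norm.pow 2).const_mul (1 / 2)
    simp only [← BeppoLevi.dirichlet_self_eq] at hsq
    exact hsq
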